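/- Let $n\ge 4$ be an integer, let $X=\mathbb{R}/M\mathbb{Z}$ with $M>0$ be a periodic interval, and let $a_0>0$. For real $s\ge 0$ let $H^s=H^s(X)$ be the usual $L^2$-based Sobolev space of real-valued periodic functions, with norm $\|f\|_{H^s}^2=M\sum_{k\in\mathbb{Z}}(1+(2\pi k/M)^2)^s|\hat f(k)|^2$, where $\hat f(k)=\frac1M\int_0^M f(x)e^{-2\pi i kx/M}\,dx$. Let $u_0\in H^n$ satisfy $u_0(x)>a_0$ for all $x\in X$. Then there exist $T>0$ and $u\in C([0,T];H^n)$ such that $u(x,t)>a_0/2$ for all $x\in X$, $t\in[0,T]$, and such that $u$ is the unique solution in $C([0,T];H^n)$ of the initial value problem for the Rosenau–Hyman $K(2,2)$ equation $$u_t=2uu_{xxx}+6u_xu_{xx}+2uu_x,\qquad u(x,0)=u_0(x).$$ Moreover, with this same $T$: for every real $n'$ with $0\le n'<n$ and every $\epsilon>0$ there exists $\delta>0$ such that for every $v_0\in H^n$ with $v_0(x)>a_0$ for all $x\in X$ and $\|v_0-u_0\|_{H^n}\le\delta$, the initial value problem for the same equation with $v(x,0)=v_0(x)$ has a unique solution $v\in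 C([0,T];H^n)$, and $$\sup_{t\in[0,T]}\|u(\cdot,t)-v(\cdot,t)\|_{H^{n'}}<\epsilon.$$ -/

import Mathlib

open scoped ENNReal Topology
open Set Filter

noncomputable section

/-- The `M`-periodic real function on the line that corresponds to a function on the circle
`AddCircle M = ℝ / Mℤ`. -/
def periodicLift {M : ℝ} (f : C(AddCircle M, ℝ)) : ℝ → ℝ :=
  fun x => f (x : AddCircle M)

/-- The norm of the `L²`-based Sobolev space `H^s` of `M`-periodic functions,
`‖f‖² = M * ∑ₖ (1 + (2πk/M)²)^s * |f̂(k)|²` with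
`f̂(k) = (1/M) ∫₀ᴹ f(x) e^{-2πikx/M} dx`. It takes the value `∞` when `f` is not in `H^s`. For
`s = 0` it is the norm of `L²(0, M)`, for `s = 1` its square is `∫₀ᴹ f² + (f')²`. -/
def sobolevNorm {M : ℝ} [Fact (0 < M)] (s : ℝ) (f : C(AddCircle M, ℝ)) : ℝ≥0∞ :=
  (∑' k : ℤ, ENNReal.ofReal (M * (1 + (2 * Real.pi * k / M) ^ 2) ^ s *
    ‖fourierCoeff (fun x : AddCircle M => (f x : ℂ)) k‖ ^ 2)) ^ (1 / 2 : ℝ)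

/-- `f` belongs to the periodic Sobolev space `H^s`. A function in `H^s` with `s > 1 / 2` is
identified with its continuous representative. -/
def MemSobolev {M : ℝ} [Fact (0 < M)] (s : ℝ) (f : C(AddCircle M, ℝ)) : Prop :=
  sobolevNorm s f < ∞

/-- `u ∈ C([0,T]; H^s)`; only the values `u t` with `t ∈ [0,T]` matter. -/
def ContinuousIntoSobolev {M : ℝ} [Fact (0 < M)] (s T : ℝ) (u : ℝ → C(AddCircle M, ℝ)) : Prop :=
  (∀ t ∈ Icc 0 T, MemSobolev s (u t)) ∧
    ∀ t ∈ Icc 0 T, Tendsto (fun r => sobolevNorm s (u r - u t)) (𝓝[Icc 0 T] t) (𝓝 0)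

/-- `u` satisfies `u_t = 2 u u_xxx + 6 u_x u_xx + 2 u u_x` at every point of `[0,T] × X`. The time
derivative is one-sided at `t = 0` and `t = T`. -/
def SatisfiesK22 {M : ℝ} (T : ℝ) (u : ℝ → C(AddCircle M, ℝ)) : Prop :=
  ∀ t ∈ Icc 0 T, ∀ x : ℝ,
    HasDerivWithinAt (fun r => periodicLift (u r) x)
      (2 * periodicLift (u t) x * iteratedDeriv 3 (periodicLift (u t)) x
        + 6 * deriv (periodicLift (u t)) x * iteratedDeriv 2 (periodicLift (u t)) x
        + 2 * periodicLift (u t) x * deriv (periodicLift (u t)) x)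
      (Icc 0 T) t

/-- `u` is a solution in `C([0,T]; H^s)` of the initial value problem for the `K(2,2)` equation
with initial value `u₀`. It is used for `s ≥ 4`, where the elements of `H^s` are `C³`. -/
def IsK22Solution {M : ℝ} [Fact (0 < M)] (s T : ℝ) (u₀ : C(AddCircle M, ℝ))
    (u : ℝ → C(AddCircle M, ℝ)) : Prop :=
  ContinuousIntoSobolev s T u ∧ SatisfiesK22 T u ∧ u 0 = u₀

/-- `u` is the only solution in `C([0,T]; H^s)` of the initial value problem for the `K(2,2)`
equation with initial value `u₀`. -/
def IsUniqueK22Solution {M : ℝ} [Fact (0 < M)] (s T : ℝ) (u₀ : C(AddCircle M, ℝ))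
    (u : ℝ → C(AddCircle M, ℝ)) : Prop :=
  IsK22Solution s T u₀ u ∧
    ∀ v : ℝ → C(AddCircle M, ℝ), IsK22Solution s T u₀ v → ∀ t ∈ Icc 0 T, v t = u t

end

noncomputable section

open scoped ContDiff InnerProductSpace ComplexConjugate

set_option linter.unusedSectionVars false

/-- The algebra of smooth `M`-periodic real functions on the line, as a subalgebra. -/
def smoothPeriodicSubalgebra (M : ℝ) : Subalgebra ℝ (ℝ → ℝ) where
  carrier := {f | ContDiff ℝ ∞ f ∧ Function.Periodic f M}
  mul_mem' := fun hf hg => ⟨hf.1.mul hg.1, hf.2.mul hg.2⟩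
  add_mem' := fun hf hg => ⟨hf.1.add hg.1, hf.2.add hg.2⟩
  algebraMap_mem' := fun _ => ⟨contDiff_const, fun _ => rfl⟩

/-- The type of smooth `M`-periodic real functions on the line. -/
def SmoothPeriodic (M : ℝ) : Type := smoothPeriodicSubalgebra M

namespace SmoothPeriodic

variable {M : ℝ}

instance : CommRing (SmoothPeriodic M) :=
  inferInstanceAs (CommRing (smoothPeriodicSubalgebra M))

instance : Algebra ℝ (SmoothPeriodic M) :=
  inferInstanceAs (Algebra ℝ (smoothPeriodicSubalgebra M))

instance : FunLike (SmoothPeriodic M) ℝ ℝ where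
  coe f := f.1
  coe_injective := Subtype.val_injective

/-- Construct a smooth periodic function. -/
def mk (f : ℝ → ℝ) (h : ContDiff ℝ ∞ f) (hp : Function.Periodic f M) : SmoothPeriodic M :=
  ⟨f, h, hp⟩

@[simp] lemma mk_apply (f : ℝ → ℝ) (h : ContDiff ℝ ∞ f) (hp : Function.Periodic f M) (x : ℝ) :
    mk f h hp x = f x := rfl

@[ext] lemma ext {f g : SmoothPeriodic M} (h : ∀ x, f x = g x) : f = g := DFunLike.ext f g h

lemma contDiff (f : SmoothPeriodic M) : ContDiff ℝ ∞ f := f.2.1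

lemma periodic (f : SmoothPeriodic M) : Function.Periodic f M := f.2.2

lemma continuous (f : SmoothPeriodic M) : Continuous f := f.contDiff.continuous

lemma differentiable (f : SmoothPeriodic M) : Differentiable ℝ f :=
  f.contDiff.differentiable (by simp)

@[simp] lemma add_apply (f g : SmoothPeriodic M) (x : ℝ) : (f + g) x = f x + g x := rfl
@[simp] lemma sub_apply (f g : SmoothPeriodic M) (x : ℝ) : (f - g) x = f x - g x := rfl
@[simp] lemma neg_apply (f : SmoothPeriodic M) (x : ℝ) : (-f) x = -f x := rfl
@[simp] lemma mul_apply (f g : SmoothPeriodic M) (x : ℝ) : (f * g) x = f x * g x := rfl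
@[simp] lemma smul_apply (r : ℝ) (f : SmoothPeriodic M) (x : ℝ) : (r • f) x = r * f x := rfl
@[simp] lemma zero_apply (x : ℝ) : (0 : SmoothPeriodic M) x = 0 := rfl
@[simp] lemma one_apply (x : ℝ) : (1 : SmoothPeriodic M) x = 1 := rfl

@[simp] lemma pow_apply (f : SmoothPeriodic M) (n : ℕ) (x : ℝ) : (f ^ n) x = f x ^ n := by
  induction n with
  | zero => simp
  | succ k ih => rw [pow_succ, mul_apply, ih, pow_succ]

/-- Evaluation at a point as a linear map. -/
def evalₗ (x : ℝ) : SmoothPeriodic M →ₗ[ℝ] ℝ where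
  toFun f := f x
  map_add' _ _ := rfl
  map_smul' _ _ := rfl

@[simp] lemma evalₗ_apply (x : ℝ) (f : SmoothPeriodic M) : evalₗ x f = f x := rfl

/-- The derivative. -/
def D : SmoothPeriodic M →ₗ[ℝ] SmoothPeriodic M where
  toFun f := ⟨deriv f, (contDiff_infty_iff_deriv.1 f.contDiff).2, fun x => by
    have h : (fun y => f (y + M)) = f := funext f.periodic
    conv_rhs => rw [← h]
    exact (deriv_comp_add_const (f := (f : ℝ → ℝ)) M x).symm⟩
  map_add' f g := Subtype.ext <| funext fun x =>
    deriv_add (f.differentiable x) (g.differentiable x)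
  map_smul' r f := Subtype.ext <| funext fun x => deriv_const_smul r (f.differentiable x)

lemma D_apply (f : SmoothPeriodic M) (x : ℝ) : D f x = deriv f x := rfl

lemma hasDerivAt (f : SmoothPeriodic M) (x : ℝ) : HasDerivAt f (D f x) x :=
  (f.differentiable x).hasDerivAt

lemma D_mul (f g : SmoothPeriodic M) : D (f * g) = D f * g + f * D g := by
  ext x
  exact deriv_mul (f.differentiable x) (g.differentiable x)

lemma iteratedDeriv_eq (f : SmoothPeriodic M) (j : ℕ) : iteratedDeriv j f = (D ^ j) f := by
  induction j with
  | zero => simp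
  | succ k ih => rw [iteratedDeriv_succ, ih, pow_succ']; rfl

lemma D_pow_succ (f : SmoothPeriodic M) (j : ℕ) : (D ^ (j + 1)) f = D ((D ^ j) f) := by
  rw [pow_succ']; rfl

lemma D_pow_succ' (f : SmoothPeriodic M) (j : ℕ) : (D ^ (j + 1)) f = (D ^ j) (D f) := by
  rw [pow_succ]; rfl

lemma D_pow_add (f : SmoothPeriodic M) (i j : ℕ) : (D ^ (i + j)) f = (D ^ i) ((D ^ j) f) := by
  rw [pow_add]; rfl

lemma D_pow_mul (f g : SmoothPeriodic M) (m : ℕ) :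
    (D ^ m) (f * g) = ∑ i ∈ Finset.range (m + 1),
      (m.choose i : ℝ) • ((D ^ i) f * (D ^ (m - i)) g) := by
  have key : (D ^ m) (f * g) = ∑ ij ∈ Finset.HasAntidiagonal.antidiagonal m,
      m.choose ij.1 • ((D ^ ij.1) f * (D ^ ij.2) g) := by
    induction m with
    | zero => simp
    | succ m ih =>
      rw [Finset.sum_antidiagonal_choose_succ_nsmul
        (fun i j => (D ^ i) f * (D ^ j) g) m, D_pow_succ, ih, map_sum, ← Finset.sum_add_distrib]
      have hc : ∀ x ∈ Finset.HasAntidiagonal.antidiagonal m, m.choose x.2 = m.choose x.1 := fun x hx =>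
        m.choose_symm_of_eq_add (by have := Finset.HasAntidiagonal.mem_antidiagonal.1 hx; omega)
      refine Finset.sum_congr rfl fun ij hij => ?_
      rw [hc ij hij, map_nsmul, D_mul, D_pow_succ, D_pow_succ, smul_add, add_comm]
  rw [key, Finset.Nat.sum_antidiagonal_eq_sum_range_succ
    (fun i j => m.choose i • ((D ^ i) f * (D ^ j) g))]
  simp only [Nat.cast_smul_eq_nsmul]

/-- The integral over a period. -/
def I : SmoothPeriodic M →ₗ[ℝ] ℝ where
  toFun f := ∫ x in (0 : ℝ)..M, f x
  map_add' f g := intervalIntegral.integral_add (f.continuous.intervalIntegrable _ _)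
    (g.continuous.intervalIntegrable _ _)
  map_smul' r _ := intervalIntegral.integral_const_mul r _

lemma I_apply (f : SmoothPeriodic M) : I f = ∫ x in (0 : ℝ)..M, f x := rfl

lemma I_D (f : SmoothPeriodic M) : I (D f) = 0 := by
  rw [I_apply, intervalIntegral.integral_eq_sub_of_hasDerivAt (fun x _ => f.hasDerivAt x)
    ((D f).continuous.intervalIntegrable _ _)]
  have := f.periodic 0
  rw [zero_add] at this
  rw [this, sub_self]

lemma I_mul_D (f g : SmoothPeriodic M) : I (f * D g) = -I (D f * g) := by
  have := I_D (f * g)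
  rw [D_mul, map_add] at this
  linarith

lemma I_mul_D_pow (f g : SmoothPeriodic M) (j : ℕ) :
    I (f * (D ^ j) g) = (-1) ^ j * I ((D ^ j) f * g) := by
  induction j generalizing g with
  | zero => simp
  | succ k ih => rw [D_pow_succ', ih, I_mul_D, ← D_pow_succ]; ring

@[simp] lemma I_one : I (1 : SmoothPeriodic M) = M := by
  rw [I_apply]; simp

variable [hM : Fact (0 < M)]

lemma I_mono {f g : SmoothPeriodic M} (h : ∀ x, f x ≤ g x) : I f ≤ I g :=
  intervalIntegral.integral_mono hM.out.le (f.continuous.intervalIntegrable _ _)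
    (g.continuous.intervalIntegrable _ _) h

lemma I_nonneg {f : SmoothPeriodic M} (h : ∀ x, 0 ≤ f x) : 0 ≤ I f := by
  have := I_mono (f := 0) (g := f) h
  simpa using this

/-- The `L²` inner product, as a core. -/
@[reducible] def innerCore : PreInnerProductSpace.Core ℝ (SmoothPeriodic M) where
  inner f g := I (f * g)
  conj_inner_symm f g := by simp [mul_comm]
  re_inner_nonneg f := by
    simp only [RCLike.re_to_real]
    exact I_nonneg fun x => mul_self_nonneg (f x)
  add_left f g h := by rw [add_mul, map_add]
  smul_left f g r := by rw [smul_mul_assoc, map_smul]; simp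

instance : SeminormedAddCommGroup (SmoothPeriodic M) :=
  @InnerProductSpace.Core.toSeminormedAddCommGroup ℝ _ _ _ _ innerCore

instance : InnerProductSpace ℝ (SmoothPeriodic M) := InnerProductSpace.ofCore innerCore

lemma inner_eq (f g : SmoothPeriodic M) : ⟪f, g⟫_ℝ = I (f * g) := rfl

lemma norm_sq_eq (f : SmoothPeriodic M) : ‖f‖ ^ 2 = I (f * f) := by
  rw [← real_inner_self_eq_norm_sq, inner_eq]

lemma abs_I_mul_le (f g : SmoothPeriodic M) : |I (f * g)| ≤ ‖f‖ * ‖g‖ :=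
  abs_real_inner_le_norm f g

lemma I_mul_le (f g : SmoothPeriodic M) : I (f * g) ≤ ‖f‖ * ‖g‖ :=
  real_inner_le_norm f g

lemma norm_mul_le_of_abs_le {f : SmoothPeriodic M} {C : ℝ} (hf : ∀ x, |f x| ≤ C)
    (g : SmoothPeriodic M) : ‖f * g‖ ≤ C * ‖g‖ := by
  have hC : 0 ≤ C := (abs_nonneg _).trans (hf 0)
  refine le_of_sq_le_sq ?_ (by positivity)
  rw [mul_pow, norm_sq_eq, norm_sq_eq, ← smul_eq_mul (C ^ 2), ← map_smul]
  refine I_mono fun x => ?_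
  have h1 : f x ^ 2 ≤ C ^ 2 := sq_le_sq' (by linarith [neg_abs_le (f x), hf x])
    ((le_abs_self _).trans (hf x))
  simp only [mul_apply, smul_apply]
  nlinarith [mul_le_mul_of_nonneg_right h1 (sq_nonneg (g x))]

lemma norm_le_of_abs_le {f : SmoothPeriodic M} {C : ℝ} (hf : ∀ x, |f x| ≤ C) :
    ‖f‖ ≤ C * √M := by
  have h1 : ‖(1 : SmoothPeriodic M)‖ = √M := by
    rw [← Real.sqrt_sq (norm_nonneg _), norm_sq_eq, mul_one, I_one]
  have := norm_mul_le_of_abs_le hf 1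
  rwa [mul_one, h1] at this

lemma norm_D_sq_le (f : SmoothPeriodic M) : ‖D f‖ ^ 2 ≤ ‖f‖ * ‖D (D f)‖ := by
  rw [norm_sq_eq, I_mul_D, ← map_neg, ← neg_mul]
  refine (I_mul_le _ _).trans ?_
  rw [norm_neg, mul_comm]

/-- Agmon's inequality on the circle. -/
lemma sq_le_agmon (f : SmoothPeriodic M) (x : ℝ) :
    f x ^ 2 ≤ ‖f‖ ^ 2 / M + 2 * (‖f‖ * ‖D f‖) := by
  have hM0 : 0 < M := hM.out
  have key : ∀ y ∈ Icc x (x + M), f x ^ 2 ≤ f y ^ 2 + 2 * (‖f‖ * ‖D f‖) := by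
    intro y hy
    have h1 : ∫ s in x..y, (-2 * (f s * D f s)) = f x ^ 2 - f y ^ 2 := by
      rw [intervalIntegral.integral_eq_sub_of_hasDerivAt (f := fun s => -(f s ^ 2))]
      · ring
      · intro s _
        have := ((f.hasDerivAt s).pow 2).neg
        refine this.congr_deriv ?_
        simp; ring
      · exact ((f * D f).continuous.const_mul _).intervalIntegrable _ _
    -- The factors are replaced by absolute values, which are not smooth, so the
    -- Cauchy-Schwarz inequality is used through a weighted arithmetic-geometric mean.
    have h2 : ∀ r : ℝ, 0 < r → f x ^ 2 - f y ^ 2 ≤ r * ‖f‖ ^ 2 + r⁻¹ * ‖D f‖ ^ 2 := by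
      intro r hr
      rw [← h1, norm_sq_eq, norm_sq_eq, ← smul_eq_mul r, ← smul_eq_mul r⁻¹, ← map_smul,
        ← map_smul, ← map_add]
      set F : SmoothPeriodic M := r • (f * f) + r⁻¹ • (D f * D f) with hF
      have hFx : ∀ s, F s = r * (f s * f s) + r⁻¹ * (D f s * D f s) := fun s => rfl
      have hF0 : ∀ s, 0 ≤ F s := fun s => by
        rw [hFx]
        have := mul_self_nonneg (f s)
        have := mul_self_nonneg (D f s)
        positivity
      calc ∫ s in x..y, (-2 * (f s * D f s)) ≤ ∫ s in x..y, F s := by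
            refine intervalIntegral.integral_mono hy.1
              (((f * D f).continuous.const_mul _).intervalIntegrable _ _)
              (F.continuous.intervalIntegrable _ _) fun s => ?_
            rw [hFx]
            have h3 : 0 ≤ r⁻¹ * (r * f s + D f s) ^ 2 := by positivity
            have h4 : r⁻¹ * (r * f s + D f s) ^ 2
                = r * (f s * f s) + r⁻¹ * (D f s * D f s) + 2 * (f s * D f s) := by
              field_simp; ring
            linarith
        _ ≤ ∫ s in x..(x + M), F s := by
            refine intervalIntegral.integral_mono_interval le_rfl hy.1 hy.2
              (MeasureTheory.ae_of_all _ hF0) (F.continuous.intervalIntegrable _ _)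
        _ = I F := by
            rw [I_apply, F.periodic.intervalIntegral_add_eq x 0, zero_add]
    have h5 : f x ^ 2 - f y ^ 2 ≤ 2 * (‖f‖ * ‖D f‖) := by
      refine le_of_forall_pos_le_add fun ε hε => ?_
      have hα := norm_nonneg f
      have hβ := norm_nonneg (D f)
      generalize ‖f‖ = α at *
      generalize ‖D f‖ = β at *
      obtain ⟨δ, hδ, hδε⟩ : ∃ δ : ℝ, 0 < δ ∧ δ * (α + β) ≤ ε := by
        refine ⟨ε / (α + β + 1), by positivity, ?_⟩
        rw [div_mul_eq_mul_div, div_le_iff₀ (by positivity)]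
        nlinarith
      refine (h2 ((β + δ) / (α + δ)) (by positivity)).trans ?_
      have e1 : (β + δ) / (α + δ) * α ^ 2 ≤ (β + δ) * α := by
        rw [div_mul_eq_mul_div, div_le_iff₀ (by positivity)]
        nlinarith [mul_nonneg (mul_nonneg (add_nonneg hβ hδ.le) hα) hδ.le]
      have e2 : ((β + δ) / (α + δ))⁻¹ * β ^ 2 ≤ (α + δ) * β := by
        rw [inv_div, div_mul_eq_mul_div, div_le_iff₀ (by positivity)]
        nlinarith [mul_nonneg (mul_nonneg (add_nonneg hα hδ.le) hβ) hδ.le]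
      linarith
    linarith
  have h6 : ∫ y in x..(x + M), f x ^ 2 ≤ ∫ y in x..(x + M), (f y ^ 2 + 2 * (‖f‖ * ‖D f‖)) := by
    refine intervalIntegral.integral_mono_on (by linarith) (by simp)
      (((f.continuous.pow 2).add continuous_const).intervalIntegrable _ _) key
  rw [intervalIntegral.integral_add (f := fun y => f y ^ 2)
    ((f.continuous.pow 2).intervalIntegrable _ _) (by simp)] at h6
  have h7 : ∫ y in x..(x + M), f y ^ 2 = ‖f‖ ^ 2 := by
    have h8 := (f * f).periodic.intervalIntegral_add_eq x 0
    rw [norm_sq_eq, I_apply]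
    rw [zero_add] at h8
    rw [← h8]
    simp only [mul_apply, pow_two]
  rw [h7] at h6
  simp only [intervalIntegral.integral_const, add_sub_cancel_left, smul_eq_mul] at h6
  rw [div_add' _ _ _ hM0.ne', le_div_iff₀ hM0]
  linarith

end SmoothPeriodic

section Hat

variable {M : ℝ} [hM : Fact (0 < M)]

/-- The frequency of the `k`-th Fourier mode of period `M`. -/
def freq (M : ℝ) (k : ℤ) : ℝ := 2 * Real.pi * k / M

/-- The complex Fourier coefficient as a linear functional on continuous functions. -/
def fourierCoeffₗ (k : ℤ) : C(AddCircle M, ℂ) →ₗ[ℂ] ℂ where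
  toFun f := fourierCoeff f k
  map_add' f g := by
    have hi : ∀ h : C(AddCircle M, ℂ), MeasureTheory.Integrable h AddCircle.haarAddCircle :=
      fun h => h.continuous.integrable_of_hasCompactSupport (HasCompactSupport.of_compactSpace _)
    exact congrFun (fourierCoeff.add (hi f) (hi g)) k
  map_smul' c f := fourierCoeff.const_smul f c k

/-- A real continuous function regarded as complex valued. -/
def ofRealMap : C(AddCircle M, ℝ) →ₗ[ℝ] C(AddCircle M, ℂ) where
  toFun f := ⟨fun x => (f x : ℂ), by fun_prop⟩
  map_add' f g := by ext; simp
  map_smul' r f := by ext; simp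

@[simp] lemma ofRealMap_apply (f : C(AddCircle M, ℝ)) (x : AddCircle M) :
    ofRealMap f x = (f x : ℂ) := rfl

/-- The Fourier coefficients of a real continuous function. -/
def hat : C(AddCircle M, ℝ) →ₗ[ℝ] (ℤ → ℂ) where
  toFun f k := fourierCoeff (fun x : AddCircle M => (f x : ℂ)) k
  map_add' f g := by
    ext k
    exact (congrArg (fourierCoeffₗ k) (map_add ofRealMap f g)).trans (map_add _ _ _)
  map_smul' r f := by
    ext k
    have h : ofRealMap (r • f) = (r : ℂ) • ofRealMap f := by ext; simp
    refine (congrArg (fourierCoeffₗ k) h).trans ((map_smul _ _ _).trans ?_)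
    rfl

lemma hat_apply (f : C(AddCircle M, ℝ)) (k : ℤ) :
    hat f k = fourierCoeff (fun x : AddCircle M => (f x : ℂ)) k := rfl

lemma hat_eq (f : C(AddCircle M, ℝ)) (k : ℤ) : hat f k = fourierCoeffₗ k (ofRealMap f) := rfl

lemma hasSum_sq_hat (f : C(AddCircle M, ℝ)) :
    HasSum (fun k => ‖hat f k‖ ^ 2) (M⁻¹ * ∫ x in (0 : ℝ)..M, periodicLift f x ^ 2) := by
  have h := hasSum_sq_fourierCoeff
    (ContinuousMap.toLp (E := ℂ) 2 AddCircle.haarAddCircle ℂ (ofRealMap f))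
  simp_rw [fourierCoeff_toLp] at h
  have h1 : ∫ t : AddCircle M, ‖(ContinuousMap.toLp (E := ℂ) 2 AddCircle.haarAddCircle ℂ
      (ofRealMap f)) t‖ ^ 2 ∂AddCircle.haarAddCircle
      = ∫ t : AddCircle M, f t ^ 2 ∂AddCircle.haarAddCircle := by
    refine MeasureTheory.integral_congr_ae ?_
    filter_upwards [ContinuousMap.coeFn_toLp (p := 2) (𝕜 := ℂ) AddCircle.haarAddCircle
      (ofRealMap f)] with x hx
    rw [hx]; simp
  rw [h1, AddCircle.integral_haarAddCircle,
    ← AddCircle.intervalIntegral_preimage M 0 (fun t => f t ^ 2), zero_add, smul_eq_mul] at h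
  exact h

lemma continuous_periodicLift (f : C(AddCircle M, ℝ)) : Continuous (periodicLift f) :=
  f.continuous.comp (AddCircle.continuous_mk' M)

lemma periodic_periodicLift (f : C(AddCircle M, ℝ)) : Function.Periodic (periodicLift f) M :=
  fun x => by simp [periodicLift]

lemma hat_eq_intervalIntegral (f : C(AddCircle M, ℝ)) (k : ℤ) :
    hat f k = (1 / M : ℝ) • ∫ x in (0 : ℝ)..M,
      fourier (-k) (x : AddCircle M) * (periodicLift f x : ℂ) := by
  rw [hat_apply, fourierCoeff_eq_intervalIntegral _ _ 0, zero_add]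
  rfl

lemma hat_neg_index (f : C(AddCircle M, ℝ)) (k : ℤ) : hat f (-k) = conj (hat f k) := by
  rw [hat_eq_intervalIntegral, hat_eq_intervalIntegral, Complex.real_smul, Complex.real_smul,
    map_mul, Complex.conj_ofReal, intervalIntegral.integral_of_le hM.out.le,
    intervalIntegral.integral_of_le hM.out.le, ← integral_conj]
  congr 1
  refine MeasureTheory.integral_congr_ae (MeasureTheory.ae_of_all _ fun x => ?_)
  simp only [map_mul, Complex.conj_ofReal]
  rw [fourier_neg]

lemma norm_hat_le {f : C(AddCircle M, ℝ)} {C : ℝ} (h : ∀ x, |f x| ≤ C) (k : ℤ) :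
    ‖hat f k‖ ≤ C := by
  have hM0 := hM.out
  have hb : ‖∫ x in (0 : ℝ)..M, fourier (-k) (x : AddCircle M) * (periodicLift f x : ℂ)‖
      ≤ C * |M - 0| := by
    refine intervalIntegral.norm_integral_le_of_norm_le_const fun x _ => ?_
    rw [norm_mul, fourier_apply, Circle.norm_coe, one_mul, Complex.norm_real]
    exact h _
  rw [hat_eq_intervalIntegral, norm_smul]
  rw [sub_zero, abs_of_pos hM0] at hb
  rw [Real.norm_of_nonneg (by positivity), one_div, inv_mul_le_iff₀ hM0]
  linarith

end Hat

namespace SmoothPeriodic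

variable {M : ℝ} 

/-- A smooth periodic function as a continuous function on the circle. -/
def toCircle : SmoothPeriodic M →ₗ[ℝ] C(AddCircle M, ℝ) where
  toFun f := ⟨f.periodic.lift, continuous_coinduced_dom.2 f.continuous⟩
  map_add' f g := by
    ext x; induction x using QuotientAddGroup.induction_on with | _ x => rfl
  map_smul' r f := by
    ext x; induction x using QuotientAddGroup.induction_on with | _ x => rfl

@[simp] lemma toCircle_coe (f : SmoothPeriodic M) (x : ℝ) : toCircle f (x : AddCircle M) = f x :=
  rfl

@[simp] lemma periodicLift_toCircle (f : SmoothPeriodic M) : periodicLift (toCircle f) = f := rfl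

variable [hM : Fact (0 < M)]

lemma hasSum_sq_hat (f : SmoothPeriodic M) :
    HasSum (fun k => M * ‖hat (toCircle f) k‖ ^ 2) (‖f‖ ^ 2) := by
  have h := (_root_.hasSum_sq_hat (toCircle f)).mul_left M
  rw [mul_inv_cancel_left₀ hM.out.ne'] at h
  have h1 : ‖f‖ ^ 2 = ∫ x in (0 : ℝ)..M, periodicLift (toCircle f) x ^ 2 := by
    rw [norm_sq_eq, I_apply]
    simp [pow_two]
  rw [h1]
  exact h

lemma hat_D (f : SmoothPeriodic M) (k : ℤ) :
    hat (toCircle (D f)) k = Complex.I * freq M k * hat (toCircle f) k := by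
  have hM0 := hM.out
  have h0 : ∫ x in (0 : ℝ)..M, (fourier (-k) (x : AddCircle M) * (D f x : ℂ) +
      (-2 * Real.pi * Complex.I * k / M * fourier (-k) (x : AddCircle M)) * (f x : ℂ)) = 0 := by
    rw [intervalIntegral.integral_eq_sub_of_hasDerivAt
      (f := fun x : ℝ => fourier (-k) (x : AddCircle M) * (f x : ℂ))]
    · have := f.periodic 0
      rw [zero_add] at this
      rw [this, AddCircle.coe_period, AddCircle.coe_zero, sub_self]
    · intro x _
      refine ((hasDerivAt_fourier_neg M k x).mul (f.hasDerivAt x).ofReal_comp).congr_deriv ?_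
      ring
    · refine Continuous.intervalIntegrable ?_ _ _
      have h1 : Continuous fun x : ℝ => fourier (-k) (x : AddCircle M) :=
        (map_continuous _).comp (AddCircle.continuous_mk' M)
      have h2 := (D f).continuous
      have h3 := f.continuous
      fun_prop
  have h1 : Continuous fun x : ℝ => fourier (-k) (x : AddCircle M) :=
        (map_continuous _).comp (AddCircle.continuous_mk' M)
  have h2 := (D f).continuous
  have h3 := f.continuous
  rw [intervalIntegral.integral_add
    (Continuous.intervalIntegrable (by fun_prop) _ _)
    (Continuous.intervalIntegrable (by fun_prop) _ _)] at h0
  simp_rw [mul_assoc (_ / _ : ℂ)] at h0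
  rw [intervalIntegral.integral_const_mul] at h0
  rw [hat_eq_intervalIntegral, hat_eq_intervalIntegral, periodicLift_toCircle,
    periodicLift_toCircle, eq_neg_of_add_eq_zero_left h0, Complex.real_smul, Complex.real_smul,
    freq]
  push_cast
  ring

lemma hat_D_pow (f : SmoothPeriodic M) (j : ℕ) (k : ℤ) :
    hat (toCircle ((D ^ j) f)) k = (Complex.I * freq M k) ^ j * hat (toCircle f) k := by
  induction j with
  | zero => simp
  | succ j ih => rw [D_pow_succ, hat_D, ih]; ring

lemma hasSum_sq_hat_D_pow (f : SmoothPeriodic M) (j : ℕ) :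
    HasSum (fun k => M * (freq M k) ^ (2 * j) * ‖hat (toCircle f) k‖ ^ 2) (‖(D ^ j) f‖ ^ 2) := by
  convert ((D ^ j) f).hasSum_sq_hat using 2 with k
  rw [hat_D_pow, norm_mul, norm_pow, norm_mul, Complex.norm_I, one_mul, Complex.norm_real,
    mul_pow, ← pow_mul, mul_comm j 2, pow_mul, pow_mul, Real.norm_eq_abs, sq_abs]
  ring

omit hM in
lemma hasDerivAt_re_fourier (c : ℂ) (k : ℤ) (x : ℝ) :
    HasDerivAt (fun x : ℝ => (c * fourier k (x : AddCircle M)).re)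
      ((Complex.I * freq M k * c) * fourier k (x : AddCircle M)).re x := by
  have h := ((hasDerivAt_fourier M k x).const_mul c)
  have h2 := Complex.reCLM.hasFDerivAt.comp_hasDerivAt x h
  refine h2.congr_deriv ?_
  simp only [Complex.reCLM_apply, freq]
  push_cast
  ring_nf

omit hM in
lemma contDiff_re_fourier (c : ℂ) (k : ℤ) :
    ContDiff ℝ ∞ (fun x : ℝ => (c * fourier k (x : AddCircle M)).re) := by
  simp_rw [fourier_coe_apply]
  exact Complex.reCLM.contDiff.comp (contDiff_const.mul (Complex.contDiff_exp.comp
    ((contDiff_const.mul Complex.ofRealCLM.contDiff).div_const _)))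

/-- The real trigonometric polynomial `Re ∑_{|k| ≤ N} c_k e^{2πikx/M}`. -/
def trig (N : ℕ) : (ℤ → ℂ) →ₗ[ℝ] SmoothPeriodic M where
  toFun c := mk (fun x => ∑ k ∈ Finset.Icc (-N : ℤ) N, (c k * fourier k (x : AddCircle M)).re)
    (ContDiff.sum fun k _ => contDiff_re_fourier (c k) k) (fun x => by simp [-fourier_apply])
  map_add' c d := by
    ext x
    change ∑ k ∈ Finset.Icc (-N : ℤ) N, ((c + d) k * fourier k (x : AddCircle M)).re =
      ∑ k ∈ Finset.Icc (-N : ℤ) N, (c k * fourier k (x : AddCircle M)).re +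
      ∑ k ∈ Finset.Icc (-N : ℤ) N, (d k * fourier k (x : AddCircle M)).re
    simp_rw [Pi.add_apply, add_mul, Complex.add_re, Finset.sum_add_distrib]
  map_smul' r c := by
    ext x
    change ∑ k ∈ Finset.Icc (-N : ℤ) N, ((r • c) k * fourier k (x : AddCircle M)).re =
      r * ∑ k ∈ Finset.Icc (-N : ℤ) N, (c k * fourier k (x : AddCircle M)).re
    rw [Finset.mul_sum]
    refine Finset.sum_congr rfl fun k _ => ?_
    simp only [Pi.smul_apply, Complex.real_smul, mul_assoc, Complex.re_ofReal_mul]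

lemma trig_apply (N : ℕ) (c : ℤ → ℂ) (x : ℝ) : (trig N c : SmoothPeriodic M) x =
    ∑ k ∈ Finset.Icc (-N : ℤ) N, (c k * fourier k (x : AddCircle M)).re := rfl

lemma D_trig (N : ℕ) (c : ℤ → ℂ) :
    D (trig N c : SmoothPeriodic M) = trig N (fun k => Complex.I * freq M k * c k) := by
  ext x
  exact (HasDerivAt.fun_sum (u := Finset.Icc (-N : ℤ) N)
    fun k _ => hasDerivAt_re_fourier (M := M) (c k) k x).deriv

lemma abs_trig_le {N : ℕ} {c : ℤ → ℂ} (x : ℝ) :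
    |(trig N c : SmoothPeriodic M) x| ≤ ∑ k ∈ Finset.Icc (-N : ℤ) N, ‖c k‖ := by
  rw [trig_apply]
  refine (Finset.abs_sum_le_sum_abs _ _).trans (Finset.sum_le_sum fun k _ => ?_)
  refine (Complex.abs_re_le_norm _).trans ?_
  rw [norm_mul, fourier_apply, Circle.norm_coe, mul_one]

lemma hat_trig (N : ℕ) (c : ℤ → ℂ) (j : ℤ) : hat (toCircle (trig N c : SmoothPeriodic M)) j =
    if j ∈ Finset.Icc (-N : ℤ) N then (c j + conj (c (-j))) / 2 else 0 := by
  have h : ofRealMap (toCircle (trig N c : SmoothPeriodic M)) =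
      ∑ k ∈ Finset.Icc (-N : ℤ) N,
        ((c k / 2) • (fourier k : C(AddCircle M, ℂ)) +
          (conj (c k) / 2) • (fourier (-k) : C(AddCircle M, ℂ))) := by
    ext x
    induction x using QuotientAddGroup.induction_on with | _ x => ?_
    rw [ofRealMap_apply]
    change (((trig N c : SmoothPeriodic M) x : ℝ) : ℂ) = _
    rw [trig_apply, ContinuousMap.sum_apply]
    push_cast
    refine Finset.sum_congr rfl fun k _ => ?_
    rw [Complex.re_eq_add_conj, map_mul]
    change _ = c k / 2 * fourier k (x : AddCircle M) +
      conj (c k) / 2 * fourier (-k) (x : AddCircle M)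
    rw [fourier_neg]
    ring
  have hf : ∀ k : ℤ, fourierCoeffₗ j (fourier k : C(AddCircle M, ℂ)) = if j = k then 1 else 0 := by
    intro k
    have := congrFun (fourierCoeff_fourier (T := M) k) j
    rw [Pi.single_apply] at this
    exact this
  rw [hat_eq, h, map_sum]
  simp_rw [map_add, map_smul, hf, smul_eq_mul, mul_ite, mul_one, mul_zero]
  rw [Finset.sum_add_distrib, Finset.sum_ite_eq]
  have h2 : ∑ k ∈ Finset.Icc (-N : ℤ) N, (if j = -k then conj (c k) / 2 else 0) =
      if j ∈ Finset.Icc (-N : ℤ) N then conj (c (-j)) / 2 else 0 := by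
    have : ∀ k, (j = -k) = (-j = k) := fun k => by rw [eq_iff_iff]; omega
    simp_rw [this]
    rw [Finset.sum_ite_eq]
    congr 1
    simp only [Finset.mem_Icc, eq_iff_iff]; omega
  rw [h2]
  split_ifs
  · ring
  · ring

lemma hat_trig_hat (N : ℕ) (f : C(AddCircle M, ℝ)) (j : ℤ) :
    hat (toCircle (trig N (hat f) : SmoothPeriodic M)) j =
      if j ∈ Finset.Icc (-N : ℤ) N then hat f j else 0 := by
  rw [hat_trig, hat_neg_index]
  simp

/-- The `L²` projection to trigonometric polynomials of degree at most `N`. -/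
def proj (N : ℕ) : SmoothPeriodic M →ₗ[ℝ] SmoothPeriodic M := trig N ∘ₗ hat ∘ₗ toCircle

lemma proj_apply (N : ℕ) (f : SmoothPeriodic M) : proj N f = trig N (hat (toCircle f)) := rfl

lemma hat_proj (N : ℕ) (f : SmoothPeriodic M) (k : ℤ) : hat (toCircle (proj N f)) k =
    if k ∈ Finset.Icc (-N : ℤ) N then hat (toCircle f) k else 0 := hat_trig_hat N _ k

lemma D_proj (N : ℕ) (f : SmoothPeriodic M) : D (proj N f) = proj N (D f) := by
  rw [proj_apply, D_trig, proj_apply]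
  congr 1
  ext k
  rw [hat_D]

lemma D_pow_proj (N j : ℕ) (f : SmoothPeriodic M) : (D ^ j) (proj N f) = proj N ((D ^ j) f) := by
  induction j with
  | zero => rfl
  | succ j ih => rw [D_pow_succ, ih, D_proj, D_pow_succ]

lemma norm_proj_le (N : ℕ) (f : SmoothPeriodic M) : ‖proj N f‖ ≤ ‖f‖ := by
  refine le_of_sq_le_sq (hasSum_le (fun k => ?_) (proj N f).hasSum_sq_hat f.hasSum_sq_hat)
    (norm_nonneg _)
  rw [hat_proj]
  have := hM.out
  split_ifs
  · exact le_rfl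
  · simp; positivity

lemma freq_sq_le {N : ℕ} {k : ℤ} (hk : k ∈ Finset.Icc (-N : ℤ) N) :
    freq M k ^ 2 ≤ (2 * Real.pi * N / M) ^ 2 := by
  have hM0 := hM.out
  rw [Finset.mem_Icc] at hk
  have h1 : (k : ℝ) ^ 2 ≤ (N : ℝ) ^ 2 := by
    have h3 : (-N : ℝ) ≤ k := by exact_mod_cast hk.1
    have h4 : (k : ℝ) ≤ N := by exact_mod_cast hk.2
    exact sq_le_sq' h3 h4
  rw [freq, div_pow, div_pow, mul_pow, mul_pow _ (N : ℝ)]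
  gcongr

lemma le_freq_sq {N : ℕ} {k : ℤ} (hk : k ∉ Finset.Icc (-N : ℤ) N) :
    (2 * Real.pi * N / M) ^ 2 ≤ freq M k ^ 2 := by
  have hM0 := hM.out
  rw [Finset.mem_Icc] at hk
  have h1 : (N : ℝ) ^ 2 ≤ (k : ℝ) ^ 2 := by
    have h3 : (N : ℤ) ^ 2 ≤ k ^ 2 := by
      rw [sq_le_sq, Nat.abs_cast, le_abs]
      omega
    exact_mod_cast h3
  rw [freq, div_pow, div_pow, mul_pow, mul_pow _ (k : ℝ)]
  gcongr

/-- Bernstein's inequality. -/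
lemma norm_D_le_of_hat_eq_zero {N : ℕ} {f : SmoothPeriodic M}
    (hf : ∀ k, k ∉ Finset.Icc (-N : ℤ) N → hat (toCircle f) k = 0) :
    ‖D f‖ ≤ 2 * Real.pi * N / M * ‖f‖ := by
  have hM0 := hM.out
  refine le_of_sq_le_sq ?_ (by positivity)
  rw [mul_pow]
  have h := f.hasSum_sq_hat_D_pow 1
  rw [pow_one] at h
  refine hasSum_le (fun k => ?_) h (f.hasSum_sq_hat.mul_left _)
  by_cases hk : k ∈ Finset.Icc (-N : ℤ) N
  · have := freq_sq_le (M := M) hk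
    rw [mul_one, mul_comm M, mul_assoc]
    gcongr
  · rw [hf k hk]; simp

/-- The truncation error gains a derivative. -/
lemma norm_sub_proj_le {N : ℕ} (hN : 0 < N) (f : SmoothPeriodic M) :
    ‖f - proj N f‖ ≤ M / (2 * Real.pi * N) * ‖D f‖ := by
  have hM0 := hM.out
  have hN' : (0 : ℝ) < N := by exact_mod_cast hN
  have hq : 0 < 2 * Real.pi * N / M := by positivity
  rw [← inv_div, ← div_eq_inv_mul, le_div_iff₀ hq, mul_comm]
  refine le_of_sq_le_sq ?_ (by positivity)
  rw [mul_pow]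
  have h := f.hasSum_sq_hat_D_pow 1
  rw [pow_one] at h
  refine hasSum_le (fun k => ?_) ((f - proj N f).hasSum_sq_hat.mul_left _) h
  rw [map_sub, map_sub, Pi.sub_apply, hat_proj]
  split_ifs with hk
  · rw [sub_self, norm_zero]
    simp only [ne_eq, OfNat.ofNat_ne_zero, not_false_eq_true, zero_pow, mul_zero, mul_one]
    positivity
  · have := le_freq_sq (M := M) hk
    rw [sub_zero, mul_one, mul_comm M (freq M k ^ 2), mul_assoc (freq M k ^ 2)]
    gcongr

lemma I_trig_mul (N : ℕ) (c : ℤ → ℂ) (g : SmoothPeriodic M) :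
    I (trig N c * g) = ∑ k ∈ Finset.Icc (-N : ℤ) N, M * (c k * conj (hat (toCircle g) k)).re := by
  have hM0 := hM.out
  rw [I_apply]
  simp_rw [mul_apply, trig_apply, Finset.sum_mul]
  have hc : ∀ k : ℤ, Continuous fun x : ℝ => fourier k (x : AddCircle M) := fun k =>
        (map_continuous _).comp (AddCircle.continuous_mk' M)
  have hg := g.continuous
  rw [intervalIntegral.integral_finsetSum]
  · refine Finset.sum_congr rfl fun k _ => ?_
    have h1 : ∀ x : ℝ, (c k * fourier k (x : AddCircle M)).re * g x
        = Complex.reCLM (c k * (fourier (-(-k)) (x : AddCircle M) * (g x : ℂ))) := by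
      intro x
      rw [neg_neg, ← mul_assoc, mul_comm _ (g x : ℂ)]
      simp only [Complex.reCLM_apply, Complex.re_ofReal_mul]
      ring
    simp_rw [h1]
    rw [ContinuousLinearMap.intervalIntegral_comp_comm, intervalIntegral.integral_const_mul,
      ← hat_neg_index, hat_eq_intervalIntegral, periodicLift_toCircle]
    · simp only [Complex.reCLM_apply, Complex.real_smul]
      rw [mul_left_comm, Complex.re_ofReal_mul]
      field_simp
    · refine Continuous.intervalIntegrable ?_ _ _
      have := hc (-(-k))
      fun_prop
  · intro k _
    refine Continuous.intervalIntegrable ?_ _ _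
    have := hc k
    fun_prop

/-- The projection is symmetric. -/
lemma I_proj_mul (N : ℕ) (f g : SmoothPeriodic M) : I (proj N f * g) = I (f * proj N g) := by
  rw [mul_comm f, proj_apply, proj_apply, I_trig_mul, I_trig_mul]
  refine Finset.sum_congr rfl fun k _ => ?_
  rw [← Complex.conj_re (hat (toCircle f) k * _), map_mul, Complex.conj_conj, mul_comm (conj _)]

end SmoothPeriodic

section Sobolev

variable {M : ℝ} [hM : Fact (0 < M)]

/-- The square of the Sobolev norm. -/
def sobolevSq (s : ℝ) (f : C(AddCircle M, ℝ)) : ℝ≥0∞ :=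
  ∑' k : ℤ, ENNReal.ofReal (M * (1 + freq M k ^ 2) ^ s * ‖hat f k‖ ^ 2)

lemma sobolevNorm_eq (s : ℝ) (f : C(AddCircle M, ℝ)) :
    sobolevNorm s f = sobolevSq s f ^ (1 / 2 : ℝ) := rfl

lemma sobolevNorm_le_iff {s : ℝ} {f : C(AddCircle M, ℝ)} {r : ℝ} (hr : 0 ≤ r) :
    sobolevNorm s f ≤ ENNReal.ofReal r ↔ sobolevSq s f ≤ ENNReal.ofReal (r ^ 2) := by
  rw [sobolevNorm_eq, one_div, ENNReal.rpow_inv_le_iff (by norm_num), ENNReal.ofReal_rpow_of_nonneg hr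
    (by norm_num)]
  norm_num

lemma memSobolev_iff {s : ℝ} {f : C(AddCircle M, ℝ)} : MemSobolev s f ↔ sobolevSq s f < ⊤ := by
  rw [MemSobolev, sobolevNorm_eq, one_div, ENNReal.rpow_inv_lt_iff (by norm_num),
    ENNReal.top_rpow_of_pos (by norm_num)]

lemma weight_nonneg (s : ℝ) (k : ℤ) : 0 ≤ M * (1 + freq M k ^ 2) ^ s := by
  have := hM.out
  positivity

lemma sobolevSq_sub_le (s : ℝ) (f g : C(AddCircle M, ℝ)) :
    sobolevSq s (f - g) ≤ 2 * (sobolevSq s f + sobolevSq s g) := by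
  rw [sobolevSq, sobolevSq, sobolevSq, ← ENNReal.tsum_add, ← ENNReal.tsum_mul_left]
  refine ENNReal.tsum_le_tsum fun k => ?_
  have hw := weight_nonneg (M := M) s k
  rw [← ENNReal.ofReal_add (by positivity) (by positivity),
    show (2 : ℝ≥0∞) = ENNReal.ofReal 2 by simp, ← ENNReal.ofReal_mul (by norm_num)]
  refine ENNReal.ofReal_le_ofReal ?_
  rw [map_sub, Pi.sub_apply]
  have h1 := norm_sub_le (hat f k) (hat g k)
  have h2 : ‖hat f k - hat g k‖ ^ 2 ≤ 2 * (‖hat f k‖ ^ 2 + ‖hat g k‖ ^ 2) := by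
    nlinarith [norm_nonneg (hat f k - hat g k), sq_nonneg (‖hat f k‖ - ‖hat g k‖)]
  nlinarith [mul_le_mul_of_nonneg_left h2 hw]

lemma sobolevSq_neg (s : ℝ) (f : C(AddCircle M, ℝ)) : sobolevSq s (-f) = sobolevSq s f := by
  simp [sobolevSq]

lemma sobolevSq_sub_comm (s : ℝ) (f g : C(AddCircle M, ℝ)) :
    sobolevSq s (f - g) = sobolevSq s (g - f) := by
  rw [← neg_sub, sobolevSq_neg]

lemma sobolevSq_le_of_sub (s : ℝ) (f g : C(AddCircle M, ℝ)) :
    sobolevSq s f ≤ 2 * (sobolevSq s g + sobolevSq s (f - g)) := by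
  have h := sobolevSq_sub_le s g (g - f)
  rwa [sub_sub_cancel, sobolevSq_sub_comm s g f] at h

lemma sobolevSq_zero_index (f : C(AddCircle M, ℝ)) :
    sobolevSq 0 f = ENNReal.ofReal (∫ x in (0 : ℝ)..M, periodicLift f x ^ 2) := by
  have hM0 := hM.out
  have h := (hasSum_sq_hat f).mul_left M
  rw [mul_inv_cancel_left₀ hM0.ne'] at h
  rw [← h.tsum_eq, ENNReal.ofReal_tsum_of_nonneg (fun k => by positivity) h.summable]
  simp [sobolevSq]

/-- Interpolation between Sobolev norms. -/
lemma sobolevSq_le_interp {s r Λ : ℝ} (hs : 0 ≤ s) (hsr : s ≤ r) (hΛ : 0 < Λ)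
    (f : C(AddCircle M, ℝ)) :
    sobolevSq s f ≤ ENNReal.ofReal (Λ ^ s) * sobolevSq 0 f
      + ENNReal.ofReal (Λ ^ (s - r)) * sobolevSq r f := by
  have hM0 := hM.out
  rw [sobolevSq, sobolevSq, sobolevSq, ← ENNReal.tsum_mul_left, ← ENNReal.tsum_mul_left,
    ← ENNReal.tsum_add]
  refine ENNReal.tsum_le_tsum fun k => ?_
  rw [← ENNReal.ofReal_mul (by positivity), ← ENNReal.ofReal_mul (by positivity),
    ← ENNReal.ofReal_add (by positivity) (by positivity)]
  refine ENNReal.ofReal_le_ofReal ?_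
  rw [Real.rpow_zero, mul_one]
  set Ω := 1 + freq M k ^ 2 with hΩ
  have hΩ0 : 0 < Ω := by positivity
  have key : Ω ^ s ≤ Λ ^ s + Λ ^ (s - r) * Ω ^ r := by
    rcases le_total Ω Λ with h | h
    · have := Real.rpow_le_rpow hΩ0.le h hs
      have h2 : 0 ≤ Λ ^ (s - r) * Ω ^ r := by positivity
      linarith
    · have h1 : Ω ^ (s - r) ≤ Λ ^ (s - r) :=
        Real.rpow_le_rpow_of_nonpos hΛ h (by linarith)
      have h2 : Ω ^ s = Ω ^ (s - r) * Ω ^ r := by rw [← Real.rpow_add hΩ0]; ring_nf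
      have h3 : Ω ^ (s - r) * Ω ^ r ≤ Λ ^ (s - r) * Ω ^ r := by gcongr
      have h4 : 0 ≤ Λ ^ s := by positivity
      linarith
  have h5 : 0 ≤ M * ‖hat f k‖ ^ 2 := by positivity
  nlinarith [mul_le_mul_of_nonneg_left key h5]

/-- The Sobolev norms are lower semicontinuous for uniform convergence. -/
lemma sobolevSq_le_of_tendsto {s : ℝ} {F : ℕ → C(AddCircle M, ℝ)} {f : C(AddCircle M, ℝ)}
    (hF : ∀ ε > 0, ∀ᶠ m in atTop, ∀ x, |F m x - f x| ≤ ε) {K : ℝ≥0∞}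
    (hK : ∀ᶠ m in atTop, sobolevSq s (F m) ≤ K) : sobolevSq s f ≤ K := by
  have hhat : ∀ k, Tendsto (fun m => hat (F m) k) atTop (𝓝 (hat f k)) := by
    intro k
    rw [Metric.tendsto_nhds]
    intro ε hε
    filter_upwards [hF (ε / 2) (by positivity)] with m hm
    rw [dist_eq_norm, ← Pi.sub_apply, ← map_sub]
    exact (norm_hat_le hm k).trans_lt (by linarith)
  rw [sobolevSq, ENNReal.tsum_eq_iSup_sum]
  refine iSup_le fun S => ?_
  refine le_of_tendsto (f := fun m => ∑ k ∈ S,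
    ENNReal.ofReal (M * (1 + freq M k ^ 2) ^ s * ‖hat (F m) k‖ ^ 2))
    (tendsto_finsetSum S fun k _ => ?_) (hK.mono fun m hm => ?_)
  · exact ENNReal.tendsto_ofReal (((hhat k).norm.pow 2).const_mul _)
  · exact (ENNReal.sum_le_tsum S).trans hm

/-- A continuous function is determined by its Fourier coefficients. -/
lemma eq_of_hat_eq {f g : C(AddCircle M, ℝ)} (h : hat f = hat g) : f = g := by
  have h1 := hasSum_sq_hat (f - g)
  rw [map_sub, h, sub_self] at h1
  have h2 : M⁻¹ * ∫ x in (0 : ℝ)..M, periodicLift (f - g) x ^ 2 = 0 :=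
    h1.unique (by simp)
  have hM0 := hM.out
  have h3 : ∫ x in (0 : ℝ)..M, periodicLift (f - g) x ^ 2 = 0 := by
    rcases mul_eq_zero.1 h2 with h | h
    · exact absurd h (by positivity)
    · exact h
  have hc : Continuous fun x => periodicLift (f - g) x ^ 2 :=
    (continuous_periodicLift (f - g)).pow 2
  have h4 : ∀ x ∈ Icc 0 M, periodicLift (f - g) x ^ 2 = 0 := by
    by_contra! hne
    obtain ⟨c, hc1, hc2⟩ := hne
    have := intervalIntegral.integral_pos hM0 hc.continuousOn (fun x _ => sq_nonneg _)
      ⟨c, hc1, lt_of_le_of_ne (sq_nonneg _) hc2.symm⟩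
    linarith
  ext x
  obtain ⟨y, hy, rfl⟩ : ∃ y ∈ Icc 0 M, (y : AddCircle M) = x := by
    have := AddCircle.coe_image_Icc_eq M 0
    rw [zero_add] at this
    have hx : x ∈ ((↑) : ℝ → AddCircle M) '' Icc 0 M := this ▸ mem_univ x
    exact hx
  have := pow_eq_zero_iff (two_ne_zero) |>.1 (h4 y hy)
  simpa [periodicLift, sub_eq_zero] using this

end Sobolev

namespace SmoothPeriodic

variable {M : ℝ} [hM : Fact (0 < M)]

lemma ofReal_norm_sq_D_pow (f : SmoothPeriodic M) (j : ℕ) : ENNReal.ofReal (‖(D ^ j) f‖ ^ 2) =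
    ∑' k, ENNReal.ofReal (M * (freq M k) ^ (2 * j) * ‖hat (toCircle f) k‖ ^ 2) := by
  have hM0 := hM.out
  have h := f.hasSum_sq_hat_D_pow j
  rw [← h.tsum_eq, ENNReal.ofReal_tsum_of_nonneg (fun k => ?_) h.summable]
  rw [pow_mul]
  positivity

lemma ofReal_norm_sq_D_pow_le {n j : ℕ} (hj : j ≤ n) (f : SmoothPeriodic M) :
    ENNReal.ofReal (‖(D ^ j) f‖ ^ 2) ≤ sobolevSq n (toCircle f) := by
  have hM0 := hM.out
  rw [ofReal_norm_sq_D_pow]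
  refine ENNReal.tsum_le_tsum fun k => ENNReal.ofReal_le_ofReal ?_
  rw [Real.rpow_natCast]
  gcongr
  rw [pow_mul]
  calc (freq M k ^ 2) ^ j ≤ (1 + freq M k ^ 2) ^ j := by gcongr; linarith
    _ ≤ (1 + freq M k ^ 2) ^ n := pow_le_pow_right₀ (by nlinarith [sq_nonneg (freq M k)]) hj

lemma norm_D_pow_le_of_sobolevSq_le {n j : ℕ} (hj : j ≤ n) {f : SmoothPeriodic M} {R : ℝ}
    (hR : 0 ≤ R) (h : sobolevSq n (toCircle f) ≤ ENNReal.ofReal (R ^ 2)) : ‖(D ^ j) f‖ ≤ R := by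
  have := (ofReal_norm_sq_D_pow_le hj f).trans h
  rw [ENNReal.ofReal_le_ofReal_iff (by positivity)] at this
  exact le_of_sq_le_sq this hR

lemma sobolevSq_toCircle_le (n : ℕ) (f : SmoothPeriodic M) :
    sobolevSq n (toCircle f) ≤ ENNReal.ofReal (2 ^ n * (‖f‖ ^ 2 + ‖(D ^ n) f‖ ^ 2)) := by
  have hM0 := hM.out
  rw [ENNReal.ofReal_mul (by positivity), ENNReal.ofReal_add (by positivity) (by positivity),
    ofReal_norm_sq_D_pow f n, show ‖f‖ = ‖(D ^ 0) f‖ from rfl, ofReal_norm_sq_D_pow f 0,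
    ← ENNReal.tsum_add, ← ENNReal.tsum_mul_left]
  refine ENNReal.tsum_le_tsum fun k => ?_
  rw [mul_zero, pow_zero, mul_one, pow_mul]
  rw [← ENNReal.ofReal_add (by positivity) (by positivity), ← ENNReal.ofReal_mul (by positivity)]
  refine ENNReal.ofReal_le_ofReal ?_
  rw [Real.rpow_natCast]
  have h1 : (1 + freq M k ^ 2) ^ n ≤ 2 ^ n * (1 + (freq M k ^ 2) ^ n) := by
    have h2 := add_pow_le (zero_le_one) (sq_nonneg (freq M k)) n
    rw [one_pow] at h2
    refine h2.trans ?_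
    gcongr
    · norm_num
    · omega
  have h5 : 0 ≤ M * ‖hat (toCircle f) k‖ ^ 2 := by positivity
  nlinarith [mul_le_mul_of_nonneg_left h1 h5]

lemma norm_D_pow_sq_le {n j : ℕ} (hj : j ≤ n) (f : SmoothPeriodic M) :
    ‖(D ^ j) f‖ ^ 2 ≤ ‖f‖ ^ 2 + ‖(D ^ n) f‖ ^ 2 := by
  have hM0 := hM.out
  refine hasSum_le (fun k => ?_) (f.hasSum_sq_hat_D_pow j)
    (f.hasSum_sq_hat.add (f.hasSum_sq_hat_D_pow n))
  rw [pow_mul, pow_mul]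
  have h1 : (freq M k ^ 2) ^ j ≤ 1 + (freq M k ^ 2) ^ n := by
    rcases le_total (freq M k ^ 2) 1 with h | h
    · have := pow_le_one₀ (sq_nonneg (freq M k)) h (n := j)
      have h2 : 0 ≤ (freq M k ^ 2) ^ n := by positivity
      linarith
    · have := pow_le_pow_right₀ h hj
      linarith
  have h5 : 0 ≤ M * ‖hat (toCircle f) k‖ ^ 2 := by positivity
  nlinarith [mul_le_mul_of_nonneg_left h1 h5]

lemma sobolevSq_trig_hat_le (s : ℝ) (N : ℕ) (g : C(AddCircle M, ℝ)) :
    sobolevSq s (toCircle (trig N (hat g) : SmoothPeriodic M)) ≤ sobolevSq s g := by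
  have hM0 := hM.out
  refine ENNReal.tsum_le_tsum fun k => ENNReal.ofReal_le_ofReal ?_
  rw [hat_trig_hat]
  split_ifs
  · exact le_rfl
  · simp; positivity

/-- The truncated Fourier series of a function in `H^n` is a Cauchy sequence in `H^n`. -/
lemma exists_norm_D_pow_trig_sub_le {n : ℕ} {g : C(AddCircle M, ℝ)} (hg : sobolevSq n g < ⊤)
    {ε : ℝ} (hε : 0 < ε) : ∃ N₀ : ℕ, ∀ N ≥ N₀, ∀ N' ≥ N₀, ∀ j ≤ n,
      ‖(D ^ j) (trig N (hat g) - trig N' (hat g) : SmoothPeriodic M)‖ ≤ ε := by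
  have hM0 := hM.out
  set a : ℤ → ℝ≥0∞ := fun k => ENNReal.ofReal (M * (1 + freq M k ^ 2) ^ (n : ℝ) * ‖hat g k‖ ^ 2)
    with ha
  have ht := ENNReal.tendsto_tsum_compl_atTop_zero (f := a) hg.ne
  have hpos : (0 : ℝ≥0∞) < ENNReal.ofReal (ε ^ 2) := ENNReal.ofReal_pos.2 (by positivity)
  obtain ⟨S, hS⟩ := (ht.eventually (gt_mem_nhds hpos)).exists
  obtain ⟨N₀, hN₀⟩ : ∃ N₀ : ℕ, S ⊆ Finset.Icc (-N₀ : ℤ) N₀ := by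
    refine ⟨S.sup Int.natAbs, fun k hk => ?_⟩
    have : k.natAbs ≤ S.sup Int.natAbs := Finset.le_sup (f := Int.natAbs) hk
    rw [Finset.mem_Icc]; omega
  refine ⟨N₀, fun N hN N' hN' j hj => ?_⟩
  refine norm_D_pow_le_of_sobolevSq_le hj hε.le (le_trans ?_ hS.le)
  refine le_of_le_of_eq ?_ (tsum_subtype {k | k ∉ S} a).symm
  refine ENNReal.tsum_le_tsum fun k => ?_
  rw [map_sub, map_sub, Pi.sub_apply, hat_trig_hat, hat_trig_hat]
  by_cases hk : k ∈ S
  · have h1 := Finset.mem_Icc.1 (hN₀ hk)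
    rw [if_pos (Finset.mem_Icc.2 (by omega)), if_pos (Finset.mem_Icc.2 (by omega))]
    simp
  · rw [indicator_of_mem (by exact hk)]
    refine ENNReal.ofReal_le_ofReal ?_
    gcongr
    split_ifs <;> simp

end SmoothPeriodic

namespace SmoothPeriodic

variable {M : ℝ} [hM : Fact (0 < M)]

/-- The constant in Agmon's inequality `sup |f| ≤ C max (‖f‖, ‖f'‖)`. -/
def agmonConst (M : ℝ) : ℝ := √(1 / M + 2)

lemma agmonConst_pos : 0 < agmonConst M := by
  have := hM.out
  exact Real.sqrt_pos.2 (by positivity)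

lemma abs_le_agmon {f : SmoothPeriodic M} {R : ℝ} (h0 : ‖f‖ ≤ R) (h1 : ‖D f‖ ≤ R) (x : ℝ) :
    |f x| ≤ agmonConst M * R := by
  have hM0 := hM.out
  have hR : 0 ≤ R := (norm_nonneg _).trans h0
  refine abs_le_of_sq_le_sq ((f.sq_le_agmon x).trans ?_) (by have := agmonConst_pos (M := M); positivity)
  rw [mul_pow, agmonConst, Real.sq_sqrt (by positivity)]
  have h2 : ‖f‖ ^ 2 / M ≤ R ^ 2 / M := by gcongr
  have h3 : ‖f‖ * ‖D f‖ ≤ R * R := by gcongr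
  calc _ ≤ R ^ 2 / M + 2 * (R * R) := by linarith
    _ = _ := by ring

lemma exists_norm_D_pow_sub_le {τ : Type*} {F : ℕ → τ → SmoothPeriodic M} {R : ℝ}
    (hR : ∀ m t, ∀ j ≤ 4, ‖(D ^ j) (F m t)‖ ≤ R)
    (hC : ∀ ε > 0, ∃ m₀, ∀ m ≥ m₀, ∀ m' ≥ m₀, ∀ t, ‖F m t - F m' t‖ ≤ ε) (j : ℕ) (hj : j ≤ 3) :
    ∀ ε > 0, ∃ m₀, ∀ m ≥ m₀, ∀ m' ≥ m₀, ∀ t, ‖(D ^ j) (F m t - F m' t)‖ ≤ ε := by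
  induction j with
  | zero => exact hC
  | succ j ih =>
    intro ε hε
    rcases isEmpty_or_nonempty τ with hτ | ⟨⟨t₀⟩⟩
    · exact ⟨0, fun _ _ _ _ t => isEmptyElim t⟩
    have hR0 : 0 ≤ R := (norm_nonneg _).trans (hR 0 t₀ 0 (by omega))
    obtain ⟨m₀, hm₀⟩ := ih (by omega) (ε ^ 2 / (2 * R + 1)) (by positivity)
    refine ⟨m₀, fun m hm m' hm' t => ?_⟩
    have h1 := hm₀ m hm m' hm' t
    have h2 : ‖(D ^ (j + 2)) (F m t - F m' t)‖ ≤ 2 * R := by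
      rw [map_sub]
      refine (norm_sub_le _ _).trans ?_
      have := hR m t (j + 2) (by omega)
      have := hR m' t (j + 2) (by omega)
      linarith
    have h3 := norm_D_sq_le ((D ^ j) (F m t - F m' t))
    rw [← D_pow_succ, ← D_pow_succ] at h3
    refine le_of_sq_le_sq (h3.trans ?_) hε.le
    calc _ ≤ (ε ^ 2 / (2 * R + 1)) * (2 * R) := by gcongr
      _ ≤ (ε ^ 2 / (2 * R + 1)) * (2 * R + 1) := by gcongr; linarith
      _ = ε ^ 2 := by field_simp

lemma exists_abs_D_pow_sub_le {τ : Type*} {F : ℕ → τ → SmoothPeriodic M} {R : ℝ}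
    (hR : ∀ m t, ∀ j ≤ 4, ‖(D ^ j) (F m t)‖ ≤ R)
    (hC : ∀ ε > 0, ∃ m₀, ∀ m ≥ m₀, ∀ m' ≥ m₀, ∀ t, ‖F m t - F m' t‖ ≤ ε) (j : ℕ) (hj : j ≤ 3) :
    ∀ ε > 0, ∃ m₀, ∀ m ≥ m₀, ∀ m' ≥ m₀, ∀ t x,
      |(D ^ j) (F m t) x - (D ^ j) (F m' t) x| ≤ ε := by
  intro ε hε
  have hM0 := hM.out
  rcases isEmpty_or_nonempty τ with hτ | ⟨⟨t₀⟩⟩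
  · exact ⟨0, fun _ _ _ _ t => isEmptyElim t⟩
  have hR0 : 0 ≤ R := (norm_nonneg _).trans (hR 0 t₀ 0 (by omega))
  set L : ℝ := 2 * R / M + 2 * (2 * R) with hL
  have hL0 : 0 ≤ L := by positivity
  obtain ⟨m₀, hm₀⟩ := exists_norm_D_pow_sub_le hR hC j hj (ε ^ 2 / (L + 1)) (by positivity)
  refine ⟨m₀, fun m hm m' hm' t x => ?_⟩
  have h1 := hm₀ m hm m' hm' t
  have hb : ∀ i ≤ 4, ‖(D ^ i) (F m t - F m' t)‖ ≤ 2 * R := by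
    intro i hi
    rw [map_sub]
    refine (norm_sub_le _ _).trans ?_
    have := hR m t i hi
    have := hR m' t i hi
    linarith
  have h3 := sq_le_agmon ((D ^ j) (F m t - F m' t)) x
  rw [← D_pow_succ] at h3
  rw [← sub_apply, ← map_sub]
  refine abs_le_of_sq_le_sq (h3.trans ?_) hε.le
  have h4 := hb j (by omega)
  have h5 := hb (j + 1) (by omega)
  set a := ‖(D ^ j) (F m t - F m' t)‖
  have ha : 0 ≤ a := norm_nonneg _
  calc a ^ 2 / M + 2 * (a * ‖(D ^ (j + 1)) (F m t - F m' t)‖)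
      ≤ a * (2 * R) / M + 2 * (a * (2 * R)) := by rw [pow_two]; gcongr
    _ = a * L := by rw [hL]; ring
    _ ≤ (ε ^ 2 / (L + 1)) * (L + 1) := by gcongr; linarith
    _ = ε ^ 2 := by field_simp

/-- A family of sequences of smooth functions that is bounded in `H⁴` and uniformly Cauchy in `L²`
converges uniformly with three derivatives. -/
theorem exists_uniform_limit {τ : Type*} {F : ℕ → τ → SmoothPeriodic M} {R : ℝ}
    (hR : ∀ m t, ∀ j ≤ 4, ‖(D ^ j) (F m t)‖ ≤ R)
    (hC : ∀ ε > 0, ∃ m₀, ∀ m ≥ m₀, ∀ m' ≥ m₀, ∀ t, ‖F m t - F m' t‖ ≤ ε) :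
    ∃ f : τ → C(AddCircle M, ℝ), (∀ t, ContDiff ℝ 3 (periodicLift (f t))) ∧
      ∀ j ≤ 3, ∀ ε > 0, ∃ m₀, ∀ m ≥ m₀, ∀ t x,
        |(D ^ j) (F m t) x - iteratedDeriv j (periodicLift (f t)) x| ≤ ε := by
  have hS := exists_abs_D_pow_sub_le hR hC
  have hlim : ∀ j t x, ∃ y, j ≤ 3 → Tendsto (fun m => (D ^ j) (F m t) x) atTop (𝓝 y) := by
    intro j t x
    by_cases hj : j ≤ 3
    · have : CauchySeq (fun m => (D ^ j) (F m t) x) := by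
        rw [Metric.cauchySeq_iff]
        intro ε hε
        obtain ⟨m₀, h⟩ := hS j hj (ε / 2) (by positivity)
        exact ⟨m₀, fun m hm m' hm' => (h m hm m' hm' t x).trans_lt (by linarith)⟩
      obtain ⟨y, hy⟩ := cauchySeq_tendsto_of_complete this
      exact ⟨y, fun _ => hy⟩
    · exact ⟨0, fun h => absurd h hj⟩
  choose G hG using hlim
  have hunif : ∀ j ≤ 3, ∀ ε > 0, ∃ m₀, ∀ m ≥ m₀, ∀ t x, |(D ^ j) (F m t) x - G j t x| ≤ ε := by
    intro j hj ε hε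
    obtain ⟨m₀, h⟩ := hS j hj ε hε
    refine ⟨m₀, fun m hm t x => ?_⟩
    exact le_of_tendsto ((tendsto_const_nhds.sub (hG j t x hj)).abs)
      ((eventually_ge_atTop m₀).mono fun m' hm' => h m hm m' hm' t x)
  have hTU : ∀ j ≤ 3, ∀ t, TendstoUniformly (fun m => ((D ^ j) (F m t) : ℝ → ℝ)) (G j t) atTop := by
    intro j hj t
    rw [Metric.tendstoUniformly_iff]
    intro ε hε
    obtain ⟨m₀, h⟩ := hunif j hj (ε / 2) (by positivity)
    filter_upwards [eventually_ge_atTop m₀] with m hm x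
    rw [dist_comm]
    exact (h m hm t x).trans_lt (by linarith)
  have hcont : ∀ j ≤ 3, ∀ t, Continuous (G j t) := fun j hj t =>
    (hTU j hj t).continuous (Eventually.of_forall fun m => SmoothPeriodic.continuous _).frequently
  have hder : ∀ j < 3, ∀ t x, HasDerivAt (G j t) (G (j + 1) t x) x := by
    intro j hj t x
    refine hasDerivAt_of_tendstoUniformly (hTU (j + 1) (by omega) t)
      (Eventually.of_forall fun m x => ?_) (fun x => hG j t x (by omega)) x
    rw [D_pow_succ]
    exact SmoothPeriodic.hasDerivAt _ x
  have hper : ∀ t, Function.Periodic (G 0 t) M := by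
    intro t x
    refine tendsto_nhds_unique (hG 0 t (x + M) (by omega)) ?_
    simp_rw [SmoothPeriodic.periodic _ x]
    exact hG 0 t x (by omega)
  refine ⟨fun t => ⟨(hper t).lift, continuous_coinduced_dom.2 (hcont 0 (by omega) t)⟩, ?_⟩
  have hit : ∀ j ≤ 3, ∀ t, iteratedDeriv j (G 0 t) = G j t := by
    intro j
    induction j with
    | zero => intro _ t; simp
    | succ j ih =>
      intro hj t
      rw [iteratedDeriv_succ, ih (by omega)]
      ext x
      exact (hder j (by omega) t x).deriv
  change (∀ t, ContDiff ℝ 3 (G 0 t)) ∧ ∀ j ≤ 3, ∀ ε > 0, ∃ m₀, ∀ m ≥ m₀, ∀ t x,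
        |(D ^ j) (F m t) x - iteratedDeriv j (G 0 t) x| ≤ ε
  constructor
  · intro t
    have h3 : ((3 : ℕ) : ℕ∞ω) = 3 := rfl
    rw [← h3, contDiff_nat_iff_iteratedDeriv]
    constructor
    · intro j hj
      rw [hit j hj]
      exact hcont j hj t
    · intro j hj
      rw [hit j hj.le]
      exact fun x => (hder j hj t x).differentiableAt
  · intro j hj
    simp_rw [hit j hj]
    exact hunif j hj

end SmoothPeriodic

section Regularity

open SmoothPeriodic

variable {M : ℝ} [hM : Fact (0 < M)]

/-- Functions in `H^n`, `n ≥ 4`, are three times continuously differentiable with bounds, and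
their Fourier series converges uniformly. -/
theorem regularity_of_sobolevSq_le {n : ℕ} (hn : 4 ≤ n) {f : C(AddCircle M, ℝ)} {R : ℝ}
    (hR : 0 ≤ R) (hf : sobolevSq n f ≤ ENNReal.ofReal (R ^ 2)) :
    ContDiff ℝ 3 (periodicLift f) ∧
    (∀ j ≤ 3, ∀ x, |iteratedDeriv j (periodicLift f) x| ≤ agmonConst M * R) ∧
    ∀ ε > 0, ∃ N₀, ∀ N ≥ N₀, ∀ x, |(trig N (hat f) : SmoothPeriodic M) x - periodicLift f x| ≤ ε := by
  set F : ℕ → Unit → SmoothPeriodic M := fun N _ => trig N (hat f) with hF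
  have hb : ∀ m t, ∀ j ≤ 4, ‖(D ^ j) (F m t)‖ ≤ R := fun m t j hj =>
    norm_D_pow_le_of_sobolevSq_le (hj.trans hn) hR ((sobolevSq_trig_hat_le _ _ _).trans hf)
  have hC : ∀ ε > 0, ∃ m₀, ∀ m ≥ m₀, ∀ m' ≥ m₀, ∀ t, ‖F m t - F m' t‖ ≤ ε := by
    intro ε hε
    obtain ⟨m₀, h⟩ := exists_norm_D_pow_trig_sub_le (hf.trans_lt ENNReal.ofReal_lt_top) hε
    exact ⟨m₀, fun m hm m' hm' _ => h m hm m' hm' 0 (by omega)⟩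
  obtain ⟨g, hg1, hg2⟩ := exists_uniform_limit hb hC
  have hgf : g () = f := by
    refine eq_of_hat_eq ?_
    ext k
    have h1 : Tendsto (fun m => hat (toCircle (F m ())) k) atTop (𝓝 (hat (g ()) k)) := by
      rw [Metric.tendsto_nhds]
      intro ε hε
      obtain ⟨m₀, h⟩ := hg2 0 (by omega) (ε / 2) (by positivity)
      filter_upwards [eventually_ge_atTop m₀] with m hm
      rw [dist_eq_norm, ← Pi.sub_apply, ← map_sub]
      refine (norm_hat_le (C := ε / 2) (fun x => ?_) k).trans_lt (by linarith)
      induction x using QuotientAddGroup.induction_on with | _ x => ?_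
      have := h m hm () x
      rw [iteratedDeriv_zero] at this
      exact this
    refine tendsto_nhds_unique h1 (tendsto_const_nhds.congr' ?_)
    filter_upwards [eventually_ge_atTop k.natAbs] with m hm
    rw [hF, hat_trig_hat, if_pos (Finset.mem_Icc.2 (by omega))]
  subst hgf
  refine ⟨hg1 (), fun j hj x => ?_, fun ε hε => ?_⟩
  · refine le_of_forall_pos_le_add fun ε hε => ?_
    obtain ⟨m₀, h⟩ := hg2 j hj ε hε
    have h1 := h m₀ le_rfl () x
    have h2 := abs_le_agmon (hb m₀ () j (by omega))
      (by rw [← D_pow_succ]; exact hb m₀ () (j + 1) (by omega)) x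
    rw [abs_sub_comm] at h1
    have := abs_sub_abs_le_abs_sub (iteratedDeriv j (periodicLift (g ())) x) ((D ^ j) (F m₀ ()) x)
    linarith
  · obtain ⟨m₀, h⟩ := hg2 0 (by omega) ε hε
    refine ⟨m₀, fun N hN x => ?_⟩
    have := h N hN () x
    rw [iteratedDeriv_zero] at this
    exact this

end Regularity

/-- The right-hand side `2 f f''' + 6 f' f'' + 2 f f'` of the `K(2,2)` equation. -/
def k22 (f : ℝ → ℝ) (x : ℝ) : ℝ :=
  2 * f x * iteratedDeriv 3 f x + 6 * deriv f x * iteratedDeriv 2 f x + 2 * f x * deriv f x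

/-- A Grönwall inequality for integrals that depend on a parameter. -/
theorem integral_le_exp_of_deriv_le {T M C K L : ℝ} {F F' : ℝ → ℝ → ℝ} (hM : 0 < M)
    (hd : ∀ t ∈ Icc 0 T, ∀ x, HasDerivWithinAt (fun r => F r x) (F' t x) (Icc 0 T) t)
    (hc : ∀ t ∈ Icc 0 T, Continuous (F t)) (hc' : ∀ t ∈ Icc 0 T, Continuous (F' t))
    (hb : ∀ t ∈ Icc 0 T, ∀ x, |F' t x| ≤ C) (hK : 0 ≤ K) (hL : 0 ≤ L)
    (hineq : ∀ t ∈ Icc 0 T,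
      ∫ x in (0 : ℝ)..M, F' t x ≤ K * (∫ x in (0 : ℝ)..M, F t x) + L) :
    ∀ t ∈ Icc 0 T, ∫ x in (0 : ℝ)..M, F t x ≤
      Real.exp (K * t) * ((∫ x in (0 : ℝ)..M, F 0 x) + L * t) := by
  intro t ht
  set Φ : ℝ → ℝ := fun t => ∫ x in (0 : ℝ)..M, F t x with hΦ
  have hlip : ∀ s ∈ Icc 0 T, ∀ r ∈ Icc 0 T, ∀ x, |F r x - F s x| ≤ C * |r - s| := by
    intro s hs r hr x
    exact (convex_Icc 0 T).norm_image_sub_le_of_norm_hasDerivWithin_le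
      (f := fun r => F r x) (fun y hy => hd y hy x) (fun y hy => hb y hy x) hs hr
  have hC : 0 ≤ C := (abs_nonneg _).trans (hb t ht 0)
  have hΦc : ContinuousOn Φ (Icc 0 T) := by
    refine LipschitzOnWith.continuousOn (K := (C * M).toNNReal) ?_
    refine LipschitzOnWith.of_dist_le_mul fun r hr s hs => ?_
    rw [Real.coe_toNNReal _ (by positivity), Real.dist_eq, Real.dist_eq, hΦ]
    simp only
    rw [← intervalIntegral.integral_sub ((hc r hr).intervalIntegrable _ _)
      ((hc s hs).intervalIntegrable _ _)]
    have := intervalIntegral.norm_integral_le_of_norm_le_const (a := 0) (b := M)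
      (f := fun x => F r x - F s x) (C := C * |r - s|) (fun x _ => hlip s hs r hr x)
    rw [sub_zero, abs_of_pos hM] at this
    rw [Real.norm_eq_abs] at this
    linarith
  have hΦd : ∀ s ∈ Ioo 0 T, HasDerivAt Φ (∫ x in (0 : ℝ)..M, F' s x) s := by
    intro s hs
    have hs' : s ∈ Icc 0 T := Ioo_subset_Icc_self hs
    refine (intervalIntegral.hasDerivAt_integral_of_dominated_loc_of_deriv_le
      (bound := fun _ => C) (s := Ioo 0 T) (Ioo_mem_nhds hs.1 hs.2) ?_
      ((hc s hs').intervalIntegrable _ _) (hc' s hs').aestronglyMeasurable ?_ (by simp) ?_).2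
    · filter_upwards [Ioo_mem_nhds hs.1 hs.2] with r hr
      exact (hc r (Ioo_subset_Icc_self hr)).aestronglyMeasurable
    · exact MeasureTheory.ae_of_all _ fun x _ r hr => hb r (Ioo_subset_Icc_self hr) x
    · exact MeasureTheory.ae_of_all _ fun x _ r hr =>
        (hd r (Ioo_subset_Icc_self hr) x).hasDerivAt (Icc_mem_nhds hr.1 hr.2)
  set φ : ℝ → ℝ := fun s => Real.exp (-(K * s)) * Φ s - L * s with hφ
  have hφd : ∀ s ∈ Ioo 0 T, HasDerivAt φ
      (Real.exp (-(K * s)) * ((∫ x in (0 : ℝ)..M, F' s x) - K * Φ s) - L) s := by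
    intro s hs
    have h1 : HasDerivAt (fun s : ℝ => Real.exp (-(K * s))) (Real.exp (-(K * s)) * -(K * 1)) s :=
      ((hasDerivAt_id s).const_mul K).neg.exp
    refine ((h1.mul (hΦd s hs)).sub ((hasDerivAt_id s).const_mul L)).congr_deriv ?_
    ring
  have hanti : AntitoneOn φ (Icc 0 T) := by
    refine antitoneOn_of_deriv_nonpos (convex_Icc 0 T) ?_ ?_ ?_
    · exact ((Continuous.continuousOn (by fun_prop)).mul hΦc).sub
        (Continuous.continuousOn (by fun_prop))
    · rw [interior_Icc]
      exact fun s hs => (hφd s hs).differentiableAt.differentiableWithinAt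
    · rw [interior_Icc]
      intro s hs
      rw [(hφd s hs).deriv]
      have h2 := hineq s (Ioo_subset_Icc_self hs)
      have h3 : Real.exp (-(K * s)) ≤ 1 := Real.exp_le_one_iff.2 (by
        have := mul_nonneg hK hs.1.le
        linarith)
      have h4 : Real.exp (-(K * s)) * ((∫ x in (0 : ℝ)..M, F' s x) - K * Φ s)
          ≤ Real.exp (-(K * s)) * L := by
        gcongr
        simp only [hΦ]
        linarith
      nlinarith
  have h5 := hanti ⟨le_rfl, ht.1.trans ht.2⟩ ht ht.1
  simp only [hφ, mul_zero, neg_zero, Real.exp_zero, one_mul, sub_zero] at h5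
  have h6 : Real.exp (-(K * t)) * Φ t ≤ Φ 0 + L * t := by linarith
  calc Φ t = Real.exp (K * t) * (Real.exp (-(K * t)) * Φ t) := by
        rw [← mul_assoc, ← Real.exp_add]; simp
    _ ≤ _ := by gcongr

section Difference

variable {M : ℝ}

lemma ContDiff.hasDerivAt_iteratedDeriv {f : ℝ → ℝ} (hf : ContDiff ℝ 3 f) {j : ℕ} (hj : j < 3)
    (x : ℝ) : HasDerivAt (iteratedDeriv j f) (iteratedDeriv (j + 1) f x) x := by
  rw [iteratedDeriv_succ]
  exact (hf.differentiable_iteratedDeriv j (by exact_mod_cast hj) x).hasDerivAt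

lemma Function.Periodic.iteratedDeriv {f : ℝ → ℝ} (hf : Function.Periodic f M) (j : ℕ) :
    Function.Periodic (iteratedDeriv j f) M := by
  intro x
  have h : (fun y => f (y + M)) = f := funext hf
  conv_rhs => rw [← h]
  rw [iteratedDeriv_comp_add_const]

/-- A function that is `C³`, `M`-periodic and bounded by `B` together with its derivatives. -/
structure IsC3Bounded (M B : ℝ) (f : ℝ → ℝ) : Prop where
  contDiff : ContDiff ℝ 3 f
  periodic : Function.Periodic f M
  bound : ∀ j ≤ 3, ∀ x, |iteratedDeriv j f x| ≤ B

lemma IsC3Bounded.continuous_k22 {B : ℝ} {f : ℝ → ℝ} (hf : IsC3Bounded M B f) :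
    Continuous (k22 f) := by
  have h0 := hf.contDiff.continuous
  have h1 := hf.contDiff.continuous_iteratedDeriv 1 (by norm_num)
  have h2 := hf.contDiff.continuous_iteratedDeriv 2 (by norm_num)
  have h3 := hf.contDiff.continuous_iteratedDeriv 3 (by norm_num)
  rw [iteratedDeriv_one] at h1
  unfold k22
  fun_prop

lemma IsC3Bounded.abs_k22_le {B : ℝ} {f : ℝ → ℝ} (hf : IsC3Bounded M B f) (x : ℝ) :
    |k22 f x| ≤ 10 * B ^ 2 := by
  have h0 := hf.bound 0 (by omega) x
  have h1 := hf.bound 1 (by omega) x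
  have h2 := hf.bound 2 (by omega) x
  have h3 := hf.bound 3 (by omega) x
  rw [iteratedDeriv_zero] at h0
  rw [iteratedDeriv_one] at h1
  have hB : 0 ≤ B := (abs_nonneg _).trans h0
  have e1 : |f x * iteratedDeriv 3 f x| ≤ B * B := by rw [abs_mul]; gcongr
  have e2 : |deriv f x * iteratedDeriv 2 f x| ≤ B * B := by rw [abs_mul]; gcongr
  have e3 : |f x * deriv f x| ≤ B * B := by rw [abs_mul]; gcongr
  rw [abs_le] at *
  unfold k22
  constructor <;> nlinarith

lemma abs_product_derivatives_le {B u0 u1 u2 u3 v0 v1 v2 v3 : ℝ} (bu0 : |u0| ≤ B) (bu1 : |u1| ≤ B)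
    (bu2 : |u2| ≤ B) (bu3 : |u3| ≤ B) (bv0 : |v0| ≤ B) (bv1 : |v1| ≤ B) (bv2 : |v2| ≤ B)
    (bv3 : |v3| ≤ B) :
    |2 * (u3 * (u0 - v0) + 3 * (u2 * (u1 - v1)) + 3 * (u1 * (u2 - v2)) + u0 * (u3 - v3)) +
      2 * (u1 * (u0 - v0) + u0 * (u1 - v1))| ≤ 40 * B ^ 2 := by
  have hB : 0 ≤ B := (abs_nonneg _).trans bu0
  have key : ∀ a b c : ℝ, |a| ≤ B → |b| ≤ B → |c| ≤ B →
      -(2 * B ^ 2) ≤ a * (b - c) ∧ a * (b - c) ≤ 2 * B ^ 2 := by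
    intro a b c ha hb hc
    rw [← abs_le, abs_mul]
    calc |a| * |b - c| ≤ B * (2 * B) := by
          gcongr
          exact (abs_sub _ _).trans (by linarith)
      _ = _ := by ring
  have e1 := key u3 u0 v0 bu3 bu0 bv0
  have e2 := key u2 u1 v1 bu2 bu1 bv1
  have e3 := key u1 u2 v2 bu1 bu2 bv2
  have e4 := key u0 u3 v3 bu0 bu3 bv3
  have e5 := key u1 u0 v0 bu1 bu0 bv0
  have e6 := key u0 u1 v1 bu0 bu1 bv1
  rw [abs_le]
  constructor <;> linarith

/-- The linearization of the `K(2,2)` equation is skew-symmetric in `L²` with weight `u`, and the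
quadratic remainder only costs derivatives of `u` and `v`. -/
lemma integral_weighted_difference_le {B : ℝ} {u v : ℝ → ℝ} (hM : 0 < M)
    (hu : IsC3Bounded M B u) (hv : IsC3Bounded M B v) :
    ∫ x in (0 : ℝ)..M, 2 * u x * (u x - v x) * (k22 u x - k22 v x) ≤
      40 * B ^ 2 * ∫ x in (0 : ℝ)..M, (u x - v x) ^ 2 := by
  set u1 := deriv u with hu1
  set u2 := iteratedDeriv 2 u with hu2
  set u3 := iteratedDeriv 3 u with hu3
  set v1 := deriv v with hv1
  set v2 := iteratedDeriv 2 v with hv2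
  set v3 := iteratedDeriv 3 v with hv3
  have du0 : ∀ x, HasDerivAt u (u1 x) x := fun x => by
    have := hu.contDiff.hasDerivAt_iteratedDeriv (j := 0) (by omega) x
    rwa [iteratedDeriv_zero, zero_add, iteratedDeriv_one] at this
  have du1 : ∀ x, HasDerivAt u1 (u2 x) x := fun x => by
    have := hu.contDiff.hasDerivAt_iteratedDeriv (j := 1) (by omega) x
    rwa [iteratedDeriv_one] at this
  have du2 : ∀ x, HasDerivAt u2 (u3 x) x :=
    hu.contDiff.hasDerivAt_iteratedDeriv (j := 2) (by omega)
  have dv0 : ∀ x, HasDerivAt v (v1 x) x := fun x => by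
    have := hv.contDiff.hasDerivAt_iteratedDeriv (j := 0) (by omega) x
    rwa [iteratedDeriv_zero, zero_add, iteratedDeriv_one] at this
  have dv1 : ∀ x, HasDerivAt v1 (v2 x) x := fun x => by
    have := hv.contDiff.hasDerivAt_iteratedDeriv (j := 1) (by omega) x
    rwa [iteratedDeriv_one] at this
  have dv2 : ∀ x, HasDerivAt v2 (v3 x) x :=
    hv.contDiff.hasDerivAt_iteratedDeriv (j := 2) (by omega)
  have cu0 := hu.contDiff.continuous
  have cv0 := hv.contDiff.continuous
  have cu1 : Continuous u1 := continuous_iff_continuousAt.2 fun x => (du1 x).continuousAt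
  have cu2 : Continuous u2 := continuous_iff_continuousAt.2 fun x => (du2 x).continuousAt
  have cu3 : Continuous u3 := hu.contDiff.continuous_iteratedDeriv 3 (by norm_num)
  have cv1 : Continuous v1 := continuous_iff_continuousAt.2 fun x => (dv1 x).continuousAt
  have cv2 : Continuous v2 := continuous_iff_continuousAt.2 fun x => (dv2 x).continuousAt
  have cv3 : Continuous v3 := hv.contDiff.continuous_iteratedDeriv 3 (by norm_num)
  have cku := hu.continuous_k22
  have ckv := hv.continuous_k22
  -- `g = 2 u d` and `h = d ^ 2` with `d = u - v`
  set d0 : ℝ → ℝ := fun x => u x - v x with hd0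
  set d1 : ℝ → ℝ := fun x => u1 x - v1 x with hd1
  set d2 : ℝ → ℝ := fun x => u2 x - v2 x with hd2
  set d3 : ℝ → ℝ := fun x => u3 x - v3 x with hd3
  set g0 : ℝ → ℝ := fun x => 2 * (u x * d0 x) with hg0
  set g1 : ℝ → ℝ := fun x => 2 * (u1 x * d0 x + u x * d1 x) with hg1
  set g2 : ℝ → ℝ := fun x => 2 * (u2 x * d0 x + 2 * (u1 x * d1 x) + u x * d2 x) with hg2
  set g3 : ℝ → ℝ := fun x =>
    2 * (u3 x * d0 x + 3 * (u2 x * d1 x) + 3 * (u1 x * d2 x) + u x * d3 x) with hg3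
  set h0 : ℝ → ℝ := fun x => d0 x ^ 2 with hh0
  set h1 : ℝ → ℝ := fun x => 2 * (d0 x * d1 x) with hh1
  set h2 : ℝ → ℝ := fun x => 2 * (d1 x * d1 x + d0 x * d2 x) with hh2
  set h3 : ℝ → ℝ := fun x => 2 * (3 * (d1 x * d2 x) + d0 x * d3 x) with hh3
  have dd0 : ∀ x, HasDerivAt d0 (d1 x) x := fun x => (du0 x).sub (dv0 x)
  have dd1 : ∀ x, HasDerivAt d1 (d2 x) x := fun x => (du1 x).sub (dv1 x)
  have dd2 : ∀ x, HasDerivAt d2 (d3 x) x := fun x => (du2 x).sub (dv2 x)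
  have dg0 : ∀ x, HasDerivAt g0 (g1 x) x := fun x => ((du0 x).mul (dd0 x)).const_mul 2
  have dg1 : ∀ x, HasDerivAt g1 (g2 x) x := fun x =>
    ((((du1 x).mul (dd0 x)).add ((du0 x).mul (dd1 x))).const_mul 2).congr_deriv (by
      simp only [hg2]; ring)
  have dg2 : ∀ x, HasDerivAt g2 (g3 x) x := fun x =>
    (((((du2 x).mul (dd0 x)).add (((du1 x).mul (dd1 x)).const_mul 2)).add
      ((du0 x).mul (dd2 x))).const_mul 2).congr_deriv (by simp only [hg3]; ring)
  have dh0 : ∀ x, HasDerivAt h0 (h1 x) x := fun x =>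
    ((dd0 x).pow 2).congr_deriv (by simp only [hh1]; ring)
  have dh1 : ∀ x, HasDerivAt h1 (h2 x) x := fun x => ((dd0 x).mul (dd1 x)).const_mul 2
  have dh2 : ∀ x, HasDerivAt h2 (h3 x) x := fun x =>
    ((((dd1 x).mul (dd1 x)).add ((dd0 x).mul (dd2 x))).const_mul 2).congr_deriv (by
      simp only [hh3]; ring)
  set Φ : ℝ → ℝ := fun x => g0 x * g2 x - g1 x * g1 x / 2 + g0 x * g0 x / 2
    - (g0 x * h2 x - g1 x * h1 x + g2 x * h0 x) - g0 x * h0 x with hΦ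
  have dΦ : ∀ x, HasDerivAt Φ (g0 x * (g3 x + g1 x - h3 x - h1 x) - (g3 x + g1 x) * h0 x) x := by
    intro x
    refine ((((((dg0 x).mul (dg2 x)).sub (((dg1 x).mul (dg1 x)).div_const 2)).add
      (((dg0 x).mul (dg0 x)).div_const 2)).sub ((((dg0 x).mul (dh2 x)).sub
      ((dg1 x).mul (dh1 x))).add ((dg2 x).mul (dh0 x)))).sub ((dg0 x).mul (dh0 x))).congr_deriv ?_
    ring
  have hk : ∀ x, k22 u x - k22 v x = g3 x + g1 x - h3 x - h1 x := by
    intro x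
    simp only [k22, hg3, hg1, hh3, hh1, hd0, hd1, hd2, hd3, ← hu1, ← hv1, ← hu2, ← hv2, ← hu3, ← hv3]
    ring
  have hΦp : Φ M = Φ 0 := by
    have pu : u M = u 0 := by simpa using hu.periodic 0
    have pv : v M = v 0 := by simpa using hv.periodic 0
    have pu1 : u1 M = u1 0 := by simpa [hu1] using hu.periodic.iteratedDeriv 1 0
    have pv1 : v1 M = v1 0 := by simpa [hv1] using hv.periodic.iteratedDeriv 1 0
    have pu2 : u2 M = u2 0 := by simpa [hu2] using hu.periodic.iteratedDeriv 2 0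
    have pv2 : v2 M = v2 0 := by simpa [hv2] using hv.periodic.iteratedDeriv 2 0
    simp only [hΦ, hg0, hg1, hg2, hh0, hh1, hh2, hd0, hd1, hd2, pu, pv, pu1, pv1, pu2, pv2]
  have hint : ∫ x in (0 : ℝ)..M, (g0 x * (g3 x + g1 x - h3 x - h1 x) - (g3 x + g1 x) * h0 x) = 0 := by
    rw [intervalIntegral.integral_eq_sub_of_hasDerivAt (fun x _ => dΦ x), hΦp, sub_self]
    refine Continuous.intervalIntegrable ?_ _ _
    simp only [hg0, hg1, hg3, hh0, hh1, hh3, hd0, hd1, hd2, hd3]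
    fun_prop
  have hbound : ∀ x, |g3 x + g1 x| ≤ 40 * B ^ 2 := by
    intro x
    have bu0 := hu.bound 0 (by omega) x
    have bu1 := hu.bound 1 (by omega) x
    have bu2 := hu.bound 2 (by omega) x
    have bu3 := hu.bound 3 (by omega) x
    have bv0 := hv.bound 0 (by omega) x
    have bv1 := hv.bound 1 (by omega) x
    have bv2 := hv.bound 2 (by omega) x
    have bv3 := hv.bound 3 (by omega) x
    rw [iteratedDeriv_zero] at bu0 bv0
    rw [iteratedDeriv_one] at bu1 bv1
    exact abs_product_derivatives_le bu0 bu1 bu2 bu3 bv0 bv1 bv2 bv3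
  have cg : Continuous fun x => (g3 x + g1 x) * h0 x := by
    simp only [hg1, hg3, hh0, hd0, hd1, hd2, hd3]
    fun_prop
  have cg' : Continuous fun x => g0 x * (g3 x + g1 x - h3 x - h1 x) := by
    simp only [hg0, hg1, hg3, hh1, hh3, hd0, hd1, hd2, hd3]
    fun_prop
  rw [intervalIntegral.integral_sub (cg'.intervalIntegrable _ _) (cg.intervalIntegrable _ _),
    sub_eq_zero] at hint
  have e : ∀ x, 2 * u x * (u x - v x) * (k22 u x - k22 v x) =
      g0 x * (g3 x + g1 x - h3 x - h1 x) := by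
    intro x
    rw [hk]
    simp only [hg0, hd0]
    ring
  simp_rw [e]
  rw [hint, ← intervalIntegral.integral_const_mul]
  refine intervalIntegral.integral_mono hM.le (cg.intervalIntegrable _ _)
    (Continuous.intervalIntegrable (by simp only [hd0] at *; fun_prop) _ _) fun x => ?_
  simp only [hh0]
  have := (abs_le.1 (hbound x)).2
  nlinarith [mul_le_mul_of_nonneg_right this (sq_nonneg (d0 x))]

/-- `u` is a solution of the `K(2,2)` equation on `[0,T]` up to an error `η`, with time derivative
`u'`. -/
structure IsApproxSolution (M B η T : ℝ) (u u' : ℝ → ℝ → ℝ) : Prop where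
  bounded : ∀ t ∈ Icc 0 T, IsC3Bounded M B (u t)
  continuous : ∀ t ∈ Icc 0 T, Continuous (u' t)
  hasDeriv : ∀ t ∈ Icc 0 T, ∀ x, HasDerivWithinAt (fun r => u r x) (u' t x) (Icc 0 T) t
  error : ∀ t ∈ Icc 0 T, ∀ x, |u' t x - k22 (u t) x| ≤ η

/-- The growth rate of differences of solutions. -/
def diffRate (M B a : ℝ) : ℝ := (50 * B ^ 2 + 1) / a + 8 * B ^ 2 * M

/-- Stability of the `K(2,2)` equation in weighted `L²`. -/
theorem weighted_stability {B a η T : ℝ} {u v u' v' : ℝ → ℝ → ℝ} (hM : 0 < M) (ha : 0 < a)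
    (hη : 0 ≤ η) (hη1 : η ≤ 1) (hu : IsApproxSolution M B η T u u')
    (hv : IsApproxSolution M B η T v v') (hua : ∀ t ∈ Icc 0 T, ∀ x, a ≤ u t x) :
    ∀ t ∈ Icc 0 T, ∫ x in (0 : ℝ)..M, u t x * (u t x - v t x) ^ 2 ≤
      Real.exp (diffRate M B a * t) * ((∫ x in (0 : ℝ)..M, u 0 x * (u 0 x - v 0 x) ^ 2)
        + (diffRate M B a * η) * t) := by
  have hub : ∀ t ∈ Icc 0 T, ∀ x, |u t x| ≤ B := fun t ht x => by
    have := (hu.bounded t ht).bound 0 (by omega) x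
    rwa [iteratedDeriv_zero] at this
  have hvb : ∀ t ∈ Icc 0 T, ∀ x, |v t x| ≤ B := fun t ht x => by
    have := (hv.bounded t ht).bound 0 (by omega) x
    rwa [iteratedDeriv_zero] at this
  have hub' : ∀ t ∈ Icc 0 T, ∀ x, |u' t x| ≤ 10 * B ^ 2 + 1 := fun t ht x => by
    have h1 := hu.error t ht x
    have h2 := (hu.bounded t ht).abs_k22_le x
    have h3 := abs_sub_abs_le_abs_sub (u' t x) (k22 (u t) x)
    linarith
  have hvb' : ∀ t ∈ Icc 0 T, ∀ x, |v' t x| ≤ 10 * B ^ 2 + 1 := fun t ht x => by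
    have h1 := hv.error t ht x
    have h2 := (hv.bounded t ht).abs_k22_le x
    have h3 := abs_sub_abs_le_abs_sub (v' t x) (k22 (v t) x)
    linarith
  have hrate : 0 ≤ diffRate M B a := by unfold diffRate; positivity
  refine integral_le_exp_of_deriv_le (F := fun t x => u t x * (u t x - v t x) ^ 2)
    (F' := fun t x => u' t x * (u t x - v t x) ^ 2 +
      2 * u t x * (u t x - v t x) * (u' t x - v' t x))
    (C := (10 * B ^ 2 + 1) * (2 * B) ^ 2 + 2 * B * (2 * B) * (2 * (10 * B ^ 2 + 1))) hM
    ?_ ?_ ?_ ?_ hrate (by positivity) ?_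
  · intro t ht x
    refine ((hu.hasDeriv t ht x).mul (((hu.hasDeriv t ht x).sub (hv.hasDeriv t ht x)).pow 2)).congr_deriv
      ?_
    simp only [Pi.sub_apply, Pi.pow_apply]
    push_cast
    ring
  · intro t ht
    have h1 := (hu.bounded t ht).contDiff.continuous
    have h2 := (hv.bounded t ht).contDiff.continuous
    fun_prop
  · intro t ht
    have h1 := (hu.bounded t ht).contDiff.continuous
    have h2 := (hv.bounded t ht).contDiff.continuous
    have h3 := hu.continuous t ht
    have h4 := hv.continuous t ht
    fun_prop
  · intro t ht x
    have hB : 0 ≤ B := (abs_nonneg _).trans (hub t ht x)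
    have h1 : |u t x - v t x| ≤ 2 * B := (abs_sub _ _).trans (by linarith [hub t ht x, hvb t ht x])
    have h2 : |u' t x - v' t x| ≤ 2 * (10 * B ^ 2 + 1) :=
      (abs_sub _ _).trans (by linarith [hub' t ht x, hvb' t ht x])
    refine (abs_add_le _ _).trans ?_
    rw [abs_mul, abs_mul, abs_mul, abs_mul, abs_pow, abs_two]
    gcongr
    · exact hub' t ht x
    · exact hub t ht x
  · intro t ht
    have hB : 0 ≤ B := (abs_nonneg _).trans (hub t ht 0)
    have c1 := (hu.bounded t ht).contDiff.continuous
    have c2 := (hv.bounded t ht).contDiff.continuous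
    have c3 := hu.continuous t ht
    have c4 := hv.continuous t ht
    have c5 := (hu.bounded t ht).continuous_k22
    have c6 := (hv.bounded t ht).continuous_k22
    have key := integral_weighted_difference_le hM (hu.bounded t ht) (hv.bounded t ht)
    have hsq : ∫ x in (0 : ℝ)..M, (u t x - v t x) ^ 2 ≤
        a⁻¹ * ∫ x in (0 : ℝ)..M, u t x * (u t x - v t x) ^ 2 := by
      rw [← intervalIntegral.integral_const_mul]
      refine intervalIntegral.integral_mono hM.le (Continuous.intervalIntegrable (by fun_prop) _ _)
        (Continuous.intervalIntegrable (by fun_prop) _ _) fun x => ?_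
      simp only
      rw [← mul_assoc]
      refine le_mul_of_one_le_left (sq_nonneg _) ?_
      rw [inv_mul_eq_div, one_le_div ha]
      exact hua t ht x
    have hw0 : 0 ≤ ∫ x in (0 : ℝ)..M, u t x * (u t x - v t x) ^ 2 :=
      intervalIntegral.integral_nonneg hM.le fun x _ =>
        mul_nonneg (ha.le.trans (hua t ht x)) (sq_nonneg _)
    calc ∫ x in (0 : ℝ)..M, (u' t x * (u t x - v t x) ^ 2 +
          2 * u t x * (u t x - v t x) * (u' t x - v' t x))
        ≤ ∫ x in (0 : ℝ)..M, ((10 * B ^ 2 + 1) * (u t x - v t x) ^ 2 +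
          2 * u t x * (u t x - v t x) * (k22 (u t) x - k22 (v t) x) + 8 * B ^ 2 * η) := by
          refine intervalIntegral.integral_mono hM.le
            (Continuous.intervalIntegrable (by fun_prop) _ _)
            (Continuous.intervalIntegrable (by fun_prop) _ _) fun x => ?_
          simp only
          have h1 := (abs_le.1 (hub' t ht x)).2
          have h2 := mul_le_mul_of_nonneg_right h1 (sq_nonneg (u t x - v t x))
          have h3 : |2 * u t x * (u t x - v t x) *
              ((u' t x - k22 (u t) x) - (v' t x - k22 (v t) x))| ≤
              2 * B * (2 * B) * (2 * η) := by
            rw [abs_mul, abs_mul, abs_mul, abs_two]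
            have h4 : |u t x - v t x| ≤ 2 * B :=
              (abs_sub _ _).trans (by linarith [hub t ht x, hvb t ht x])
            have h5 : |(u' t x - k22 (u t) x) - (v' t x - k22 (v t) x)| ≤ 2 * η :=
              (abs_sub _ _).trans (by linarith [hu.error t ht x, hv.error t ht x])
            gcongr
            exact hub t ht x
          have h6 := (abs_le.1 h3).2
          nlinarith
      _ = (10 * B ^ 2 + 1) * (∫ x in (0 : ℝ)..M, (u t x - v t x) ^ 2) +
          (∫ x in (0 : ℝ)..M, 2 * u t x * (u t x - v t x) * (k22 (u t) x - k22 (v t) x)) +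
          M * (8 * B ^ 2 * η) := by
          rw [intervalIntegral.integral_add (Continuous.intervalIntegrable (by fun_prop) _ _)
            (by simp), intervalIntegral.integral_add
            (Continuous.intervalIntegrable (by fun_prop) _ _)
            (Continuous.intervalIntegrable (by fun_prop) _ _),
            intervalIntegral.integral_const_mul]
          simp only [intervalIntegral.integral_const, sub_zero, smul_eq_mul]
      _ ≤ (50 * B ^ 2 + 1) * (∫ x in (0 : ℝ)..M, (u t x - v t x) ^ 2) + 8 * B ^ 2 * M * η := by
          linarith
      _ ≤ (50 * B ^ 2 + 1) * (a⁻¹ * ∫ x in (0 : ℝ)..M, u t x * (u t x - v t x) ^ 2)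
          + 8 * B ^ 2 * M * η := by gcongr
      _ ≤ diffRate M B a * (∫ x in (0 : ℝ)..M, u t x * (u t x - v t x) ^ 2)
          + diffRate M B a * η := by
          unfold diffRate
          have h1 : 0 ≤ 8 * B ^ 2 * M * ∫ x in (0 : ℝ)..M, u t x * (u t x - v t x) ^ 2 := by
            positivity
          have h2 : 0 ≤ (50 * B ^ 2 + 1) / a * η := by positivity
          rw [add_mul, add_mul, div_mul_eq_mul_div, mul_div_assoc, div_eq_inv_mul (intervalIntegral _ _ _ _)]
          linarith

end Difference

namespace SmoothPeriodic

variable {M : ℝ}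

/-- A real power of a positive smooth periodic function. -/
def rpow (f : SmoothPeriodic M) (hf : ∀ x, 0 < f x) (q : ℝ) : SmoothPeriodic M :=
  mk (fun x => f x ^ q) (f.contDiff.rpow_const_of_ne fun x => (hf x).ne') fun x => by
    simp only [f.periodic x]

@[simp] lemma rpow_apply (f : SmoothPeriodic M) (hf : ∀ x, 0 < f x) (q x : ℝ) :
    rpow f hf q x = f x ^ q := rfl

lemma D_rpow (f : SmoothPeriodic M) (hf : ∀ x, 0 < f x) (q : ℝ) :
    D (rpow f hf q) = q • (rpow f hf (q - 1) * D f) := by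
  ext x
  refine ((f.hasDerivAt x).rpow_const (p := q) (Or.inl (hf x).ne')).deriv.trans ?_
  simp only [smul_apply, mul_apply, rpow_apply]
  ring

lemma mul_rpow_sub_one (f : SmoothPeriodic M) (hf : ∀ x, 0 < f x) (q : ℝ) :
    f * rpow f hf (q - 1) = rpow f hf q := by
  ext x
  simp only [mul_apply, rpow_apply]
  rw [Real.rpow_sub_one (hf x).ne']
  field_simp [(hf x).ne']

lemma mul_D_rpow (f : SmoothPeriodic M) (hf : ∀ x, 0 < f x) (q : ℝ) :
    f * D (rpow f hf q) = q • (rpow f hf q * D f) := by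
  rw [D_rpow, mul_smul_comm, ← mul_assoc, mul_rpow_sub_one]

lemma D_pow_two (f : SmoothPeriodic M) : (D ^ 2) f = D (D f) := rfl
lemma D_pow_three (f : SmoothPeriodic M) : (D ^ 3) f = D (D (D f)) := rfl

/-- The spatial part `(f²)''' + (f²)'` of the `K(2,2)` equation. -/
def field (f : SmoothPeriodic M) : SmoothPeriodic M := (D ^ 3) (f * f) + D (f * f)

lemma field_apply (f : SmoothPeriodic M) (x : ℝ) : field f x = k22 f x := by
  rw [k22, iteratedDeriv_eq, iteratedDeriv_eq, ← D_apply]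
  simp only [field, D_pow_three, D_pow_two, D_mul, map_add, add_apply, mul_apply]
  ring

/-- Leibniz' rule for a square with the `2 r` top order terms separated. -/
lemma D_pow_sq (f : SmoothPeriodic M) {n r : ℕ} (hr : r ≤ n + 1) :
    (D ^ (n + r)) (f * f) =
      (∑ i ∈ Finset.range r,
        (2 * (n + r).choose i : ℝ) • ((D ^ i) f * (D ^ (r - i)) ((D ^ n) f))) +
      ∑ i ∈ Finset.range (n + 1 - r),
        ((n + r).choose (r + i) : ℝ) • ((D ^ (r + i)) f * (D ^ (n - i)) f) := by
  set F : ℕ → SmoothPeriodic M := fun i =>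
    ((n + r).choose i : ℝ) • ((D ^ i) f * (D ^ (n + r - i)) f) with hF
  have e1 : n + r + 1 = (r + (n + 1 - r)) + r := by omega
  rw [D_pow_mul, e1, Finset.sum_range_add, Finset.sum_range_add,
    ← Finset.sum_range_reflect (fun x => ((n + r).choose (r + (n + 1 - r) + x) : ℝ) •
      ((D ^ (r + (n + 1 - r) + x)) f * (D ^ (n + r - (r + (n + 1 - r) + x))) f)),
    add_right_comm, ← Finset.sum_add_distrib]
  congr 1
  · refine Finset.sum_congr rfl fun i hi => ?_
    have hi' := Finset.mem_range.1 hi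
    have h1 : r + (n + 1 - r) + (r - 1 - i) = n + r - i := by omega
    have h2 : n + r - (n + r - i) = i := by omega
    have h3 : n + r - i = (r - i) + n := by omega
    rw [h1, h2, Nat.choose_symm (by omega), h3, D_pow_add, mul_comm ((D ^ (r - i)) _), ← add_smul,
      ← two_mul]
  · refine Finset.sum_congr rfl fun i hi => ?_
    have h1 : n + r - (r + i) = n - i := by omega
    rw [h1]

lemma I_third_order (A w : SmoothPeriodic M) :
    I (A * w * (D ^ 3) w + (3 / 2 : ℝ) • (D A * w * (D ^ 2) w)) =
      (1 / 4 : ℝ) * I ((D ^ 3) A * (w * w)) := by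
  have h := I_D (A * w * D (D w) - (1 / 2 : ℝ) • (A * (D w * D w)) + (1 / 2 : ℝ) • (D A * w * D w)
    - (1 / 4 : ℝ) • (D (D A) * (w * w)))
  rw [← sub_eq_zero, ← smul_eq_mul (1 / 4 : ℝ), ← map_smul, ← map_sub, ← h]
  congr 1
  ext x
  simp only [D_pow_three, D_pow_two, D_mul, map_add, map_sub, map_smul, add_apply, sub_apply,
    mul_apply, smul_apply]
  ring

lemma I_mul_mul_D (A w : SmoothPeriodic M) : I (A * w * D w) = -(1 / 2 : ℝ) * I (D A * (w * w)) := by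
  have h := I_D (A * (w * w))
  rw [D_mul, D_mul, map_add, show A * (D w * w + w * D w) = (2 : ℝ) • (A * w * D w) by
    ext x; simp only [mul_apply, add_apply, smul_apply]; ring, map_smul, smul_eq_mul] at h
  linarith

variable [hM : Fact (0 < M)]

/-- `f` is bounded by `R` in `H^n` and bounded below by `a`. -/
structure EnergyBounded (n : ℕ) (R a : ℝ) (f : SmoothPeriodic M) : Prop where
  norm_le : ∀ j ≤ n, ‖(D ^ j) f‖ ≤ R
  lower : ∀ x, a ≤ f x

namespace EnergyBounded

variable {n : ℕ} {R a : ℝ} {f : SmoothPeriodic M}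

lemma R_nonneg (h : EnergyBounded n R a f) : 0 ≤ R := (norm_nonneg _).trans (h.norm_le 0 (by omega))

lemma abs_le (h : EnergyBounded n R a f) {j : ℕ} (hj : j < n) (x : ℝ) :
    |(D ^ j) f x| ≤ agmonConst M * R :=
  abs_le_agmon (h.norm_le j hj.le) (by rw [← D_pow_succ]; exact h.norm_le (j + 1) hj) x

lemma pos (h : EnergyBounded n R a f) (ha : 0 < a) (x : ℝ) : 0 < f x := ha.trans_le (h.lower x)

lemma norm_mul_le (h : EnergyBounded n R a f) {i j : ℕ} (hi : i ≤ n) (hj : j ≤ n)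
    (hij : i < n ∨ j < n) : ‖(D ^ i) f * (D ^ j) f‖ ≤ agmonConst M * R * R := by
  have hR := h.R_nonneg
  have hA := agmonConst_pos (M := M)
  rcases hij with hi' | hj'
  · refine (norm_mul_le_of_abs_le (h.abs_le hi') _).trans ?_
    gcongr
    exact h.norm_le j hj
  · rw [mul_comm]
    refine (norm_mul_le_of_abs_le (h.abs_le hj') _).trans ?_
    gcongr
    exact h.norm_le i hi

lemma norm_sum_le (h : EnergyBounded n R a f) {r : ℕ} (hr : r < n) :
    ‖∑ i ∈ Finset.range (n + 1 - r),
        ((n + r).choose (r + i) : ℝ) • ((D ^ (r + i)) f * (D ^ (n - i)) f)‖ ≤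
      ∑ i ∈ Finset.range (n + 1 - r), ((n + r).choose (r + i) : ℝ) * (agmonConst M * R * R) := by
  refine (_root_.norm_sum_le _ _).trans (Finset.sum_le_sum fun i hi => ?_)
  have := Finset.mem_range.1 hi
  rw [norm_smul, Real.norm_natCast]
  gcongr
  exact h.norm_mul_le (by omega) (by omega) (by omega)

lemma norm_D_pow_sq_le (h : EnergyBounded n R a f) {m : ℕ} (hm : m ≤ n) (hn : 0 < n) :
    ‖(D ^ m) (f * f)‖ ≤ 2 ^ n * (agmonConst M * R * R) := by
  have hR := h.R_nonneg
  have hA := agmonConst_pos (M := M)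
  rw [D_pow_mul]
  calc _ ≤ ∑ i ∈ Finset.range (m + 1), (m.choose i : ℝ) * (agmonConst M * R * R) := by
        refine (_root_.norm_sum_le _ _).trans (Finset.sum_le_sum fun i hi => ?_)
        have := Finset.mem_range.1 hi
        rw [norm_smul, Real.norm_natCast]
        gcongr
        exact h.norm_mul_le (by omega) (by omega) (by omega)
    _ = 2 ^ m * (agmonConst M * R * R) := by
        rw [← Finset.sum_mul]
        congr 1
        exact_mod_cast Nat.sum_range_choose m
    _ ≤ _ := by
        gcongr
        norm_num

lemma abs_rpow_le (h : EnergyBounded n R a f) (ha : 0 < a) (hn : 0 < n) (q x : ℝ) :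
    |rpow f (h.pos ha) q x| ≤ a ^ q + (agmonConst M * R) ^ q := by
  have hf := h.pos ha x
  have h1 := h.abs_le hn x
  rw [pow_zero, Module.End.one_apply] at h1
  have h2 : f x ≤ agmonConst M * R := (le_abs_self _).trans h1
  have h3 : 0 ≤ agmonConst M * R := hf.le.trans h2
  rw [rpow_apply, abs_of_pos (by positivity)]
  rcases le_total 0 q with hq | hq
  · have := Real.rpow_le_rpow hf.le h2 hq
    have h4 : 0 ≤ a ^ q := by positivity
    linarith
  · have := Real.rpow_le_rpow_of_nonpos ha (h.lower x) hq
    have h4 : 0 ≤ (agmonConst M * R) ^ q := by positivity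
    linarith

end EnergyBounded

/-- Bounds for the weight `f ^ q` and its first two derivatives. -/
lemma exists_weight_bound (M : ℝ) [Fact (0 < M)] {n : ℕ} (hn : 4 ≤ n) (R : ℝ) {a : ℝ} (ha : 0 < a)
    (q : ℝ) : ∃ C : ℝ, 0 ≤ C ∧ ∀ (f : SmoothPeriodic M) (h : EnergyBounded n R a f) (x : ℝ),
      |rpow f (h.pos ha) q x| ≤ C ∧ |D (rpow f (h.pos ha) q) x| ≤ C ∧
      |(D ^ 2) (rpow f (h.pos ha) q) x| ≤ C := by
  set B := agmonConst M * R
  set c : ℝ → ℝ := fun q => |a ^ q + B ^ q|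
  set C0 := c q
  set C1 := |q| * (c (q - 1) * |B|)
  set C2 := |q| * (|q - 1| * (c (q - 2) * |B|) * |B| + c (q - 1) * |B|)
  have hc : ∀ q, 0 ≤ c q := fun q => abs_nonneg _
  have p0 : 0 ≤ C0 := hc q
  have p1 : 0 ≤ C1 := by have := hc (q - 1); positivity
  have p2 : 0 ≤ C2 := by have := hc (q - 1); have := hc (q - 2); positivity
  refine ⟨C0 + C1 + C2, by positivity, fun f h x => ?_⟩
  have hw : ∀ q, |rpow f (h.pos ha) q x| ≤ c q := fun q =>
    (h.abs_rpow_le ha (by omega) q x).trans (le_abs_self _)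
  have hD1 : |D f x| ≤ |B| := (h.abs_le (j := 1) (by omega) x).trans (le_abs_self _)
  have hD2 : |(D ^ 2) f x| ≤ |B| := (h.abs_le (j := 2) (by omega) x).trans (le_abs_self _)
  have b0 : |rpow f (h.pos ha) q x| ≤ C0 := hw q
  have b1 : |D (rpow f (h.pos ha) q) x| ≤ C1 := by
    rw [D_rpow, smul_apply, mul_apply, abs_mul, abs_mul]
    exact mul_le_mul_of_nonneg_left (mul_le_mul (hw _) hD1 (abs_nonneg _) (hc _)) (abs_nonneg q)
  have b2 : |(D ^ 2) (rpow f (h.pos ha) q) x| ≤ C2 := by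
    rw [D_pow_two, D_rpow, map_smul, D_mul, D_rpow, smul_apply, add_apply, mul_apply, mul_apply,
      smul_apply, mul_apply, abs_mul]
    have e1 := hw (q - 1)
    have e2 := hw (q - 2)
    rw [show q - 1 - 1 = q - 2 by ring]
    have := hc (q - 1)
    have := hc (q - 2)
    refine mul_le_mul_of_nonneg_left ((abs_add_le _ _).trans ?_) (abs_nonneg q)
    rw [abs_mul, abs_mul, abs_mul, abs_mul]
    rw [D_pow_two] at hD2
    exact add_le_add (mul_le_mul (mul_le_mul_of_nonneg_left (mul_le_mul e2 hD1 (abs_nonneg _)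
      (hc _)) (abs_nonneg _)) hD1 (abs_nonneg _) (by positivity))
      (mul_le_mul e1 hD2 (abs_nonneg _) (hc _))
  exact ⟨by linarith, by linarith, by linarith⟩

end SmoothPeriodic

namespace SmoothPeriodic

variable {M : ℝ}

/-- The exponent of the weight that symmetrizes the equation of the `n`-th derivative. -/
def weightExp (n : ℕ) : ℝ := (2 * n + 3) / 3

/-- The weight that symmetrizes the equation of the `n`-th derivative. -/
def weight (n : ℕ) (f : SmoothPeriodic M) (hf : ∀ x, 0 < f x) : SmoothPeriodic M :=
  rpow f hf (weightExp n)

lemma D_pow_field (n : ℕ) (f : SmoothPeriodic M) :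
    (D ^ n) (field f) = (D ^ (n + 3)) (f * f) + (D ^ (n + 1)) (f * f) := by
  rw [field, map_add, ← D_pow_add, ← D_pow_succ']

variable [hM : Fact (0 < M)]

lemma abs_I_mul_sq_le {K : SmoothPeriodic M} {C : ℝ} (hK : ∀ x, |K x| ≤ C) (w : SmoothPeriodic M) :
    |I (K * (w * w))| ≤ C * ‖w‖ ^ 2 := by
  rw [← mul_assoc]
  refine (abs_I_mul_le _ _).trans ?_
  have := norm_mul_le_of_abs_le hK w
  rw [pow_two, ← mul_assoc]
  gcongr

lemma exists_I_weight_field_le (M : ℝ) [Fact (0 < M)] {n : ℕ} (hn : 4 ≤ n) (R : ℝ) {a : ℝ}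
    (ha : 0 < a) : ∃ C : ℝ, ∀ (f : SmoothPeriodic M) (h : EnergyBounded n R a f),
      I (weight n f (h.pos ha) * (D ^ n) f * (D ^ n) (field f)) ≤ C := by
  obtain ⟨Cw, hCw0, hCw⟩ := exists_weight_bound M hn R ha (weightExp n)
  set B := agmonConst M * R with hB
  set p := weightExp n with hp
  set S : ℕ → ℝ := fun r => ∑ i ∈ Finset.range (n + 1 - r),
    ((n + r).choose (r + i) : ℝ) * (agmonConst M * R * R) with hS
  set c2 : ℝ := 2 * ((n + 3).choose 2 : ℝ) with hc2
  set C1 : ℝ := |2 * (p + 1)| * (Cw * |B| + 2 * (Cw * |B|) + Cw * |B|) with hC1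
  set C2 : ℝ := c2 * (Cw * |B| + Cw * |B|) + 2 * (Cw * |B| + Cw * |B|) with hC2
  refine ⟨(1 / 4) * (C1 * R ^ 2) + (1 / 2) * (C2 * R ^ 2) + Cw * R * S 3 + Cw * R * S 1,
    fun f h => ?_⟩
  have hR := h.R_nonneg
  set ρ := weight n f (h.pos ha) with hρ
  set w := (D ^ n) f with hw
  have b0 : ∀ x, |ρ x| ≤ Cw := fun x => (hCw f h x).1
  have b1 : ∀ x, |D ρ x| ≤ Cw := fun x => (hCw f h x).2.1
  have b2 : ∀ x, |(D ^ 2) ρ x| ≤ Cw := fun x => (hCw f h x).2.2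
  have f0 : ∀ x, |f x| ≤ |B| := fun x => (h.abs_le (j := 0) (by omega) x).trans (le_abs_self _)
  have f1 : ∀ x, |D f x| ≤ |B| := fun x => (h.abs_le (j := 1) (by omega) x).trans (le_abs_self _)
  have f2 : ∀ x, |(D ^ 2) f x| ≤ |B| := fun x =>
    (h.abs_le (j := 2) (by omega) x).trans (le_abs_self _)
  have f3 : ∀ x, |(D ^ 3) f x| ≤ |B| := fun x =>
    (h.abs_le (j := 3) (by omega) x).trans (le_abs_self _)
  have hwR : ‖w‖ ≤ R := h.norm_le n le_rfl
  set r3 := ∑ i ∈ Finset.range (n + 1 - 3),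
        ((n + 3).choose (3 + i) : ℝ) • ((D ^ (3 + i)) f * (D ^ (n - i)) f) with hr3
  set r1 := ∑ i ∈ Finset.range (n + 1 - 1),
        ((n + 1).choose (1 + i) : ℝ) • ((D ^ (1 + i)) f * (D ^ (n - i)) f) with hr1
  have hr3S : ‖r3‖ ≤ S 3 := h.norm_sum_le (r := 3) (by omega)
  have hr1S : ‖r1‖ ≤ S 1 := h.norm_sum_le (r := 1) (by omega)
  have e3 : (D ^ (n + 3)) (f * f) = (2 : ℝ) • (f * (D ^ 3) w) + (2 * (n + 3) : ℝ) • (D f * (D ^ 2) w)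
      + c2 • ((D ^ 2) f * D w) + r3 := by
    rw [D_pow_sq f (by omega : 3 ≤ n + 1), Finset.sum_range_succ, Finset.sum_range_succ,
      Finset.sum_range_one]
    simp only [Nat.choose_zero_right, Nat.choose_one_right, pow_zero, pow_one, hc2]
    push_cast
    simp only [mul_one]
    rfl
  have e1 : (D ^ (n + 1)) (f * f) = (2 : ℝ) • (f * D w) + r1 := by
    rw [D_pow_sq f (by omega : 1 ≤ n + 1), Finset.sum_range_one]
    simp only [Nat.choose_zero_right, pow_zero, Nat.cast_one, mul_one]
    rfl
  have hDρ : f * D ρ = p • (ρ * D f) := mul_D_rpow f (h.pos ha) p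
  set A : SmoothPeriodic M := (2 : ℝ) • (ρ * f) with hA
  have hDA : D A = (2 * (p + 1)) • (ρ * D f) := by
    rw [hA, map_smul, D_mul, mul_comm (D ρ), hDρ]
    module
  have h3p : 3 / 2 * (2 * (p + 1)) = 2 * (n + 3) := by rw [hp, weightExp]; ring
  set E : SmoothPeriodic M := c2 • (ρ * (D ^ 2) f) + (2 : ℝ) • (ρ * f) with hE
  have split : ρ * w * (D ^ n) (field f) =
      (A * w * (D ^ 3) w + (3 / 2 : ℝ) • (D A * w * (D ^ 2) w)) + E * w * D w
        + (ρ * w) * r3 + (ρ * w) * r1 := by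
    rw [D_pow_field, e3, e1, hDA]
    simp only [smul_mul_assoc, smul_smul, h3p, hA, hE]
    ext x
    simp only [add_apply, mul_apply, smul_apply]
    ring
  have hA3 : ∀ x, |(D ^ 3) A x| ≤ C1 := by
    intro x
    have : (D ^ 3) A = (2 * (p + 1)) • ((D ^ 2) ρ * D f + (2 : ℝ) • (D ρ * (D ^ 2) f)
        + ρ * (D ^ 3) f) := by
      rw [D_pow_succ', hDA, map_smul]
      congr 1
      simp only [D_pow_two, D_pow_three, D_mul, map_add]
      module
    rw [this, smul_apply, abs_mul, hC1]
    refine mul_le_mul_of_nonneg_left ?_ (abs_nonneg _)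
    simp only [add_apply, smul_apply, mul_apply]
    refine (abs_add_le _ _).trans (add_le_add ((abs_add_le _ _).trans (add_le_add ?_ ?_)) ?_)
    · rw [abs_mul]; exact mul_le_mul (b2 x) (f1 x) (abs_nonneg _) hCw0
    · rw [abs_mul, abs_mul, abs_two]
      exact mul_le_mul_of_nonneg_left (mul_le_mul (b1 x) (f2 x) (abs_nonneg _) hCw0) two_pos.le
    · rw [abs_mul]; exact mul_le_mul (b0 x) (f3 x) (abs_nonneg _) hCw0
  have hDE : ∀ x, |D E x| ≤ C2 := by
    intro x
    have : D E = c2 • (D ρ * (D ^ 2) f + ρ * (D ^ 3) f) + (2 : ℝ) • (D ρ * f + ρ * D f) := by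
      rw [hE, map_add, map_smul, map_smul, D_mul, D_mul]
      rfl
    rw [this, hC2]
    have hc20 : 0 ≤ c2 := by positivity
    simp only [add_apply, smul_apply, mul_apply]
    refine (abs_add_le _ _).trans (add_le_add ?_ ?_)
    · rw [abs_mul, abs_of_nonneg hc20]
      refine mul_le_mul_of_nonneg_left ((abs_add_le _ _).trans (add_le_add ?_ ?_)) hc20
      · rw [abs_mul]; exact mul_le_mul (b1 x) (f2 x) (abs_nonneg _) hCw0
      · rw [abs_mul]; exact mul_le_mul (b0 x) (f3 x) (abs_nonneg _) hCw0
    · rw [abs_mul, abs_two]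
      refine mul_le_mul_of_nonneg_left ((abs_add_le _ _).trans (add_le_add ?_ ?_)) two_pos.le
      · rw [abs_mul]; exact mul_le_mul (b1 x) (f0 x) (abs_nonneg _) hCw0
      · rw [abs_mul]; exact mul_le_mul (b0 x) (f1 x) (abs_nonneg _) hCw0
  have hρw : ‖ρ * w‖ ≤ Cw * R := (norm_mul_le_of_abs_le b0 w).trans (by gcongr)
  have hsq : ‖w‖ ^ 2 ≤ R ^ 2 := by gcongr
  have hC1' : 0 ≤ C1 := by positivity
  have hC2' : 0 ≤ C2 := by positivity
  rw [split, map_add, map_add, map_add, I_third_order, I_mul_mul_D]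
  have t1 := (abs_I_mul_sq_le hA3 w).trans (mul_le_mul_of_nonneg_left hsq hC1')
  have t2 := (abs_I_mul_sq_le hDE w).trans (mul_le_mul_of_nonneg_left hsq hC2')
  have t3 : I (ρ * w * r3) ≤ Cw * R * S 3 := (I_mul_le _ _).trans (by gcongr)
  have t4 : I (ρ * w * r1) ≤ Cw * R * S 1 := (I_mul_le _ _).trans (by gcongr)
  rw [abs_le] at t1 t2
  linarith [t1.2, t2.1]

/-- The error of truncating the equation is controlled by two more derivatives. -/
lemma exists_I_weight_truncation_le (M : ℝ) [Fact (0 < M)] {n : ℕ} (hn : 4 ≤ n) (R : ℝ) {a : ℝ}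
    (ha : 0 < a) : ∃ C : ℝ, 0 ≤ C ∧ ∀ (f : SmoothPeriodic M) (h : EnergyBounded n R a f) (N : ℕ),
      0 < N → |I (weight n f (h.pos ha) * (D ^ n) f *
        ((D ^ n) (field f) - proj N ((D ^ n) (field f))))| ≤
          C / N * (1 + ‖(D ^ 2) ((D ^ n) f)‖) ^ 2 := by
  obtain ⟨Cw, hCw0, hCw⟩ := exists_weight_bound M hn R ha (weightExp n)
  have hM0 : 0 < M := Fact.out
  set B := agmonConst M * R with hB
  set S : ℝ := ∑ i ∈ Finset.range (n + 1 - 2),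
    ((n + 2).choose (2 + i) : ℝ) * (agmonConst M * R * R) with hS
  set C1 : ℝ := Cw * (2 * |R| + 2) with hC1
  set C2 : ℝ := 2 * |B| + 2 * (n + 2) * |B| * (|R| + 1) + |S| + |2 ^ n * (agmonConst M * R * R)| with hC2
  have hC1' : 0 ≤ C1 := by positivity
  have hC2' : 0 ≤ C2 := by positivity
  refine ⟨M / (2 * Real.pi) * C1 * C2, by positivity, fun f h N hN => ?_⟩
  have hN' : (0 : ℝ) < N := by exact_mod_cast hN
  have hR := h.R_nonneg
  set ρ := weight n f (h.pos ha) with hρ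
  set w := (D ^ n) f with hw
  set X := ‖(D ^ 2) w‖ with hX
  have hX0 : 0 ≤ X := norm_nonneg _
  have b0 : ∀ x, |ρ x| ≤ Cw := fun x => (hCw f h x).1
  have b1 : ∀ x, |D ρ x| ≤ Cw := fun x => (hCw f h x).2.1
  have b2 : ∀ x, |(D ^ 2) ρ x| ≤ Cw := fun x => (hCw f h x).2.2
  have f0 : ∀ x, |f x| ≤ |B| := fun x => (h.abs_le (j := 0) (by omega) x).trans (le_abs_self _)
  have f1 : ∀ x, |D f x| ≤ |B| := fun x => (h.abs_le (j := 1) (by omega) x).trans (le_abs_self _)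
  have hwR : ‖w‖ ≤ R := h.norm_le n le_rfl
  have hDw : ‖D w‖ ≤ (R + X) / 2 := by
    refine le_of_sq_le_sq ((norm_D_sq_le w).trans ?_) (by positivity)
    rw [← D_pow_two, ← hX]
    have : ‖w‖ * X ≤ R * X := by gcongr
    nlinarith [sq_nonneg (R - X)]
  set g := ρ * w with hg
  have hg2 : ‖(D ^ 2) g‖ ≤ C1 * (1 + X) := by
    have : (D ^ 2) g = (D ^ 2) ρ * w + (2 : ℝ) • (D ρ * D w) + ρ * (D ^ 2) w := by
      rw [hg]
      simp only [D_pow_two, D_mul, map_add]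
      module
    rw [this]
    calc _ ≤ ‖(D ^ 2) ρ * w‖ + ‖(2 : ℝ) • (D ρ * D w)‖ + ‖ρ * (D ^ 2) w‖ := norm_add₃_le
      _ ≤ Cw * R + 2 * (Cw * ((R + X) / 2)) + Cw * X := by
          rw [norm_smul, Real.norm_two]
          refine add_le_add (add_le_add ?_ ?_) ?_
          · exact (norm_mul_le_of_abs_le b2 w).trans (by gcongr)
          · exact mul_le_mul_of_nonneg_left
              ((norm_mul_le_of_abs_le b1 _).trans (by gcongr)) two_pos.le
          · exact norm_mul_le_of_abs_le b0 _
      _ ≤ _ := by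
          rw [hC1, abs_of_nonneg hR]
          have := mul_nonneg hCw0 (mul_nonneg hR hX0)
          nlinarith
  set H := (D ^ (n + 2)) (f * f) + (D ^ n) (f * f) with hH
  have hDH : (D ^ n) (field f) = D H := by
    rw [D_pow_field, hH, map_add, ← D_pow_succ, ← D_pow_succ]
  have hHn : ‖H‖ ≤ C2 * (1 + X) := by
    have e2 : (D ^ (n + 2)) (f * f) = (2 : ℝ) • (f * (D ^ 2) w) + (2 * (n + 2) : ℝ) • (D f * D w)
        + ∑ i ∈ Finset.range (n + 1 - 2),
          ((n + 2).choose (2 + i) : ℝ) • ((D ^ (2 + i)) f * (D ^ (n - i)) f) := by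
      rw [D_pow_sq f (by omega : 2 ≤ n + 1), Finset.sum_range_succ, Finset.sum_range_one]
      simp only [Nat.choose_zero_right, Nat.choose_one_right, pow_zero, pow_one]
      push_cast
      simp only [mul_one]
      rfl
    have hs := h.norm_sum_le (r := 2) (by omega)
    have hl := h.norm_D_pow_sq_le (m := n) le_rfl (by omega)
    rw [hH, e2]
    refine (norm_add_le _ _).trans ((add_le_add (norm_add₃_le) hl).trans ?_)
    have u1 : ‖(2 : ℝ) • (f * (D ^ 2) w)‖ ≤ 2 * (|B| * X) := by
      rw [norm_smul, Real.norm_two]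
      exact mul_le_mul_of_nonneg_left (norm_mul_le_of_abs_le f0 _) two_pos.le
    have u2 : ‖(2 * (n + 2) : ℝ) • (D f * D w)‖ ≤ 2 * (n + 2) * (|B| * ((R + X) / 2)) := by
      rw [norm_smul, Real.norm_of_nonneg (by positivity)]
      exact mul_le_mul_of_nonneg_left ((norm_mul_le_of_abs_le f1 _).trans (by gcongr)) (by positivity)
    have u3 := le_abs_self S
    have u4 := le_abs_self (2 ^ n * (agmonConst M * R * R))
    have v1 : 0 ≤ |S| * X := by positivity
    have v2 : 0 ≤ |2 ^ n * (agmonConst M * R * R)| * X := by positivity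
    have v3 : 2 * (n + 2) * (|B| * ((R + X) / 2)) ≤ 2 * (n + 2) * |B| * (R + 1) * (1 + X) := by
      have : (R + X) / 2 ≤ (R + 1) * (1 + X) := by nlinarith [mul_nonneg hR hX0]
      calc _ ≤ 2 * (n + 2) * (|B| * ((R + 1) * (1 + X))) := by gcongr
        _ = _ := by ring
    rw [hC2, abs_of_nonneg hR]
    have v4 : 0 ≤ |B| := abs_nonneg _
    linarith
  have key : I (g * (D H - proj N (D H))) = -I ((D g - proj N (D g)) * H) := by
    rw [mul_sub, map_sub, ← I_proj_mul, ← map_sub, ← sub_mul, I_mul_D, map_sub D, D_proj]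
  rw [hDH, key, abs_neg]
  refine (abs_I_mul_le _ _).trans ?_
  have hq := norm_sub_proj_le hN (D g)
  rw [← D_pow_two] at hq
  calc _ ≤ (M / (2 * Real.pi * N) * (C1 * (1 + X))) * (C2 * (1 + X)) := by
        gcongr
        exact hq.trans (by gcongr)
    _ = _ := by field_simp

/-- Coercivity of the regularizing term. -/
lemma exists_le_I_weight_dissipation (M : ℝ) [Fact (0 < M)] {n : ℕ} (hn : 4 ≤ n) (R : ℝ) {a : ℝ}
    (ha : 0 < a) : ∃ c C : ℝ, 0 < c ∧ ∀ (f : SmoothPeriodic M) (h : EnergyBounded n R a f),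
      c * ‖(D ^ 2) ((D ^ n) f)‖ ^ 2 - C ≤
        I (weight n f (h.pos ha) * (D ^ n) f * (D ^ 4) ((D ^ n) f)) := by
  obtain ⟨Cw, hCw0, hCw⟩ := exists_weight_bound M hn R ha (weightExp n)
  set p := weightExp n with hp
  have hp0 : 0 ≤ p := by rw [hp, weightExp]; positivity
  set b := a ^ p with hb
  have hb0 : 0 < b := by positivity
  set δ := b / (8 * (Cw + 1)) with hδ
  have hδ0 : 0 < δ := by positivity
  set L := Cw * |R| + 2 * Cw * (|R| / (4 * δ)) with hL
  refine ⟨b / 2, L ^ 2 / b, by positivity, fun f h => ?_⟩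
  have hR := h.R_nonneg
  set ρ := weight n f (h.pos ha) with hρ
  set w := (D ^ n) f with hw
  set X := ‖(D ^ 2) w‖ with hX
  have hX0 : 0 ≤ X := norm_nonneg _
  have b1 : ∀ x, |D ρ x| ≤ Cw := fun x => (hCw f h x).2.1
  have b2 : ∀ x, |(D ^ 2) ρ x| ≤ Cw := fun x => (hCw f h x).2.2
  have blow : ∀ x, b ≤ ρ x := fun x => Real.rpow_le_rpow ha.le (h.lower x) hp0
  have hwR : ‖w‖ ≤ R := h.norm_le n le_rfl
  have hDw : ‖D w‖ ≤ δ * X + R / (4 * δ) := by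
    refine le_of_sq_le_sq ((norm_D_sq_le w).trans ?_) (by positivity)
    rw [← D_pow_two, ← hX]
    have h1 : ‖w‖ * X ≤ R * X := by gcongr
    have h2 : 4 * ((δ * X) * (R / (4 * δ))) = R * X := by field_simp
    nlinarith [sq_nonneg (δ * X - R / (4 * δ))]
  have e : I (ρ * w * (D ^ 4) w) = I (ρ * ((D ^ 2) w * (D ^ 2) w)) +
      I (((D ^ 2) ρ * w + (2 : ℝ) • (D ρ * D w)) * (D ^ 2) w) := by
    rw [D_pow_add w 2 2, I_mul_D_pow, ← map_add]
    rw [even_two.neg_one_pow, one_mul]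
    congr 1
    simp only [D_pow_two, D_mul, map_add]
    ext x
    simp only [mul_apply, add_apply, smul_apply]
    ring
  have t1 : b * X ^ 2 ≤ I (ρ * ((D ^ 2) w * (D ^ 2) w)) := by
    rw [hX, norm_sq_eq, ← smul_eq_mul b, ← map_smul]
    refine I_mono fun x => ?_
    simp only [mul_apply, smul_apply]
    exact mul_le_mul_of_nonneg_right (blow x) (mul_self_nonneg _)
  have t2 : |I (((D ^ 2) ρ * w + (2 : ℝ) • (D ρ * D w)) * (D ^ 2) w)| ≤
      (Cw * R + 2 * (Cw * (δ * X + R / (4 * δ)))) * X := by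
    refine (abs_I_mul_le _ _).trans (mul_le_mul_of_nonneg_right ?_ hX0)
    refine (norm_add_le _ _).trans (add_le_add ?_ ?_)
    · exact (norm_mul_le_of_abs_le b2 w).trans (by gcongr)
    · rw [norm_smul, Real.norm_two]
      exact mul_le_mul_of_nonneg_left ((norm_mul_le_of_abs_le b1 _).trans (by gcongr)) two_pos.le
  have hδ2 : 2 * (Cw * δ) ≤ b / 4 := by
    have : 2 * ((Cw + 1) * δ) = b / 4 := by rw [hδ]; field_simp; ring
    nlinarith
  have t3 : (Cw * R + 2 * (Cw * (δ * X + R / (4 * δ)))) * X ≤ b / 4 * X ^ 2 + L * X := by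
    rw [hL, abs_of_nonneg hR]
    have := mul_le_mul_of_nonneg_right hδ2 (sq_nonneg X)
    nlinarith
  have t4 : L * X ≤ b / 4 * X ^ 2 + L ^ 2 / b := by
    have : 0 ≤ b⁻¹ * (b / 2 * X - L) ^ 2 := by positivity
    have e2 : b⁻¹ * (b / 2 * X - L) ^ 2 = b / 4 * X ^ 2 + L ^ 2 / b - L * X := by
      field_simp; ring
    linarith
  rw [e]
  have := (abs_le.1 t2).1
  linarith

/-- The regularized truncated `K(2,2)` vector field. -/
def galerkinField (N : ℕ) (ε : ℝ) (f : SmoothPeriodic M) : SmoothPeriodic M :=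
  proj N (field f) - ε • (D ^ 4) f

/-- The weighted energy estimate, uniformly in the regularization. -/
theorem exists_I_weight_galerkinField_le (M : ℝ) [Fact (0 < M)] {n : ℕ} (hn : 4 ≤ n) (R : ℝ) {a : ℝ}
    (ha : 0 < a) : ∃ κ C : ℝ, 0 < κ ∧ ∀ (N : ℕ) (ε : ℝ), 0 < N → 0 < ε → ε ≤ 1 → 1 / N ≤ κ * ε →
      ∀ (f : SmoothPeriodic M) (h : EnergyBounded n R a f),
      I (weight n f (h.pos ha) * (D ^ n) f * (D ^ n) (galerkinField N ε f)) ≤ C := by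
  obtain ⟨C1, h1⟩ := exists_I_weight_field_le M hn R ha
  obtain ⟨C2, hC2, h2⟩ := exists_I_weight_truncation_le M hn R ha
  obtain ⟨c, C3, hc, h3⟩ := exists_le_I_weight_dissipation M hn R ha
  refine ⟨c / (2 * (C2 + 1)), C1 + c + |C3|, by positivity, fun N ε hN hε hε1 hNε f h => ?_⟩
  have k1 := h1 f h
  have k2 := h2 f h N hN
  have k3 := h3 f h
  have hN' : (0 : ℝ) < N := by exact_mod_cast hN
  set ρ := weight n f (h.pos ha)
  set w := (D ^ n) f
  set X := ‖(D ^ 2) w‖ with hX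
  have e : I (ρ * w * (D ^ n) (galerkinField N ε f)) = I (ρ * w * (D ^ n) (field f)) -
      I (ρ * w * ((D ^ n) (field f) - proj N ((D ^ n) (field f)))) - ε * I (ρ * w * (D ^ 4) w) := by
    rw [galerkinField, map_sub, D_pow_proj, map_smul, ← D_pow_add, add_comm n 4, D_pow_add,
      ← smul_eq_mul ε, ← map_smul I, ← map_sub, ← map_sub]
    congr 1
    simp only [mul_sub, mul_smul_comm]
    abel
  have hb : C2 / N * (1 + X) ^ 2 ≤ ε * (c * X ^ 2) + ε * c := by
    have h4 : C2 / N ≤ ε * c / 2 := by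
      calc C2 / N = C2 * (1 / N) := by ring
        _ ≤ (C2 + 1) * (c / (2 * (C2 + 1)) * ε) := by gcongr; linarith
        _ = ε * c / 2 := by field_simp
    have h5 : (1 + X) ^ 2 ≤ 2 + 2 * X ^ 2 := by nlinarith [sq_nonneg (1 - X)]
    calc _ ≤ ε * c / 2 * (2 + 2 * X ^ 2) := by gcongr
      _ = _ := by ring
  have k4 := mul_le_mul_of_nonneg_left k3 hε.le
  have k5 := (abs_le.1 k2).1
  have k6 : ε * C3 ≤ |C3| := by
    calc ε * C3 ≤ ε * |C3| := by gcongr; exact le_abs_self _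
      _ ≤ 1 * |C3| := by gcongr
      _ = _ := one_mul _
  have k7 : ε * c ≤ c := by nlinarith
  rw [e]
  linarith

/-- The regularized truncated vector field is uniformly close to the `K(2,2)` vector field. -/
theorem exists_sq_galerkinField_sub_le (M : ℝ) [Fact (0 < M)] {n : ℕ} (hn : 4 ≤ n) (R a : ℝ) :
    ∃ C : ℝ, 0 ≤ C ∧ ∀ (N : ℕ) (ε : ℝ), 0 < N → ∀ (f : SmoothPeriodic M), EnergyBounded n R a f →
      (∀ k, k ∉ Finset.Icc (-N : ℤ) N → hat (toCircle f) k = 0) → ∀ x,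
      (galerkinField N ε f x - field f x) ^ 2 ≤ C * (1 / N + ε ^ 2 * N) := by
  have hM0 : 0 < M := Fact.out
  set K := 2 * (2 ^ n * (agmonConst M * |R| * |R|)) with hK
  have hA := agmonConst_pos (M := M)
  have hK0 : 0 ≤ K := by positivity
  set c := M / (2 * Real.pi) * K with hc
  have hc0 : 0 ≤ c := by positivity
  refine ⟨2 * (c ^ 2 / M + 2 * (c * (2 * K))) + 2 * (R ^ 2 / M + 2 * (2 * Real.pi / M * R ^ 2)),
    by positivity, fun N ε hN f h hf x => ?_⟩
  have hR := h.R_nonneg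
  have hN' : (1 : ℝ) ≤ N := by exact_mod_cast hN
  have hN0 : (0 : ℝ) < N := by linarith
  set G := field f with hG
  have hDG : ‖D G‖ ≤ K := by
    have : D G = (D ^ 4) (f * f) + (D ^ 2) (f * f) := by rw [hG, field, map_add]; rfl
    rw [this]
    refine (norm_add_le _ _).trans ?_
    have l1 := h.norm_D_pow_sq_le (m := 4) hn (by omega)
    have l2 := h.norm_D_pow_sq_le (m := 2) (by omega) (by omega)
    rw [hK, abs_of_nonneg hR]
    linarith
  have hq : ‖G - proj N G‖ ≤ c / N := by
    refine (norm_sub_proj_le hN G).trans ?_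
    calc _ ≤ M / (2 * Real.pi * N) * K := by gcongr
      _ = c / N := by rw [hc]; field_simp
  have hq1 : ‖D (G - proj N G)‖ ≤ 2 * K := by
    rw [map_sub, D_proj]
    refine (norm_sub_le _ _).trans ?_
    have := norm_proj_le N (D G)
    linarith
  have s1 : (G - proj N G) x ^ 2 ≤ (c ^ 2 / M + 2 * (c * (2 * K))) * (1 / N) := by
    refine (sq_le_agmon _ x).trans ?_
    calc _ ≤ (c / N) ^ 2 / M + 2 * (c / N * (2 * K)) := by gcongr
      _ ≤ c ^ 2 / N / M + 2 * (c / N * (2 * K)) := by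
          gcongr
          rw [div_pow]
          gcongr
          nlinarith
      _ = _ := by ring
  have hb : ‖D ((D ^ 4) f)‖ ≤ 2 * Real.pi * N / M * R := by
    refine (norm_D_le_of_hat_eq_zero (N := N) fun k hk => ?_).trans ?_
    · rw [hat_D_pow, hf k hk, mul_zero]
    · gcongr
      exact h.norm_le 4 hn
  have s2 : (D ^ 4) f x ^ 2 ≤ (R ^ 2 / M + 2 * (2 * Real.pi / M * R ^ 2)) * N := by
    refine (sq_le_agmon _ x).trans ?_
    calc _ ≤ R ^ 2 / M + 2 * (R * (2 * Real.pi * N / M * R)) := by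
          gcongr <;> exact h.norm_le 4 hn
      _ ≤ R ^ 2 / M * N + 2 * (R * (2 * Real.pi * N / M * R)) := by
          have : 0 ≤ R ^ 2 / M := by positivity
          nlinarith
      _ = _ := by ring
  have e : galerkinField N ε f x - G x = -((G - proj N G) x) - ε * (D ^ 4) f x := by
    simp only [galerkinField, sub_apply, smul_apply, hG]
    ring
  rw [e]
  have s3 := mul_le_mul_of_nonneg_left s2 (sq_nonneg ε)
  have p1 : 0 ≤ (c ^ 2 / M + 2 * (c * (2 * K))) * (ε ^ 2 * N) := by positivity
  have p2 : 0 ≤ (R ^ 2 / M + 2 * (2 * Real.pi / M * R ^ 2)) * (1 / N) := by positivity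
  nlinarith [sq_nonneg (-((G - proj N G) x) + ε * (D ^ 4) f x)]

end SmoothPeriodic

/-- A compactly supported vector field has solutions on every time interval. -/
theorem exists_solution_of_hasCompactSupport {E : Type*} [NormedAddCommGroup E] [NormedSpace ℝ E]
    [CompleteSpace E] {G : E → E} (hG : ContDiff ℝ 1 G) (hs : HasCompactSupport G) (x₀ : E) {T : ℝ}
    (hT : 0 ≤ T) :
    ∃ c : ℝ → E, c 0 = x₀ ∧ ∀ t ∈ Icc 0 T, HasDerivWithinAt c (G (c t)) (Icc 0 T) t := by
  obtain ⟨K, hK⟩ := hG.lipschitzWith_of_hasCompactSupport hs one_ne_zero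
  obtain ⟨L, hL⟩ := hs.exists_bound_of_continuous hG.continuous
  have hp : IsPicardLindelof (fun _ => G) (⟨0, le_rfl, hT⟩ : Icc (0 : ℝ) T) x₀
      (L.toNNReal * T.toNNReal) 0 L.toNNReal K := by
    refine IsPicardLindelof.of_time_independent (fun x _ => ?_) hK.lipschitzOnWith ?_
    · exact (hL x).trans (Real.le_coe_toNNReal L)
    · simp [hT]
  obtain ⟨c, hc, hc'⟩ := hp.exists_eq_forall_mem_Icc_hasDerivWithinAt₀
  exact ⟨c, hc, hc'⟩

namespace SmoothPeriodic

variable {M : ℝ} [hM : Fact (0 < M)]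

lemma toCircle_injective : Function.Injective (toCircle (M := M)) := by
  intro f g h
  ext x
  rw [← toCircle_coe, h, toCircle_coe]

lemma proj_eq_self {N : ℕ} {f : SmoothPeriodic M}
    (hf : ∀ k, k ∉ Finset.Icc (-N : ℤ) N → hat (toCircle f) k = 0) : proj N f = f := by
  refine toCircle_injective (eq_of_hat_eq ?_)
  ext k
  rw [hat_proj]
  split_ifs with hk
  · rfl
  · exact (hf k hk).symm

lemma hat_trig_eq_zero {N : ℕ} (c : ℤ → ℂ) {k : ℤ} (hk : k ∉ Finset.Icc (-N : ℤ) N) :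
    hat (toCircle (trig N c : SmoothPeriodic M)) k = 0 := by
  rw [hat_trig, if_neg hk]

lemma D_pow_trig (N j : ℕ) (c : ℤ → ℂ) :
    (D ^ j) (trig N c : SmoothPeriodic M) = trig N (fun k => (Complex.I * freq M k) ^ j * c k) := by
  induction j with
  | zero => simp
  | succ j ih =>
    rw [D_pow_succ, ih, D_trig]
    congr 1
    ext k
    ring

lemma proj_galerkinField {N : ℕ} {ε : ℝ} {f : SmoothPeriodic M}
    (hf : ∀ k, k ∉ Finset.Icc (-N : ℤ) N → hat (toCircle f) k = 0) :
    proj N (galerkinField N ε f) = galerkinField N ε f := by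
  refine proj_eq_self fun k hk => ?_
  rw [galerkinField, map_sub, map_sub, Pi.sub_apply, hat_proj, if_neg hk, map_smul, map_smul,
    Pi.smul_apply, hat_D_pow, hf k hk]
  simp

/-- Extension by zero of a finite family of Fourier coefficients. -/
def extendCoeff (N : ℕ) : (Finset.Icc (-N : ℤ) N → ℂ) →ₗ[ℝ] (ℤ → ℂ) where
  toFun c k := if hk : k ∈ Finset.Icc (-N : ℤ) N then c ⟨k, hk⟩ else 0
  map_add' c d := by
    ext k
    by_cases hk : k ∈ Finset.Icc (-N : ℤ) N
    · rw [Pi.add_apply, dif_pos hk, dif_pos hk, dif_pos hk, Pi.add_apply]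
    · rw [Pi.add_apply, dif_neg hk, dif_neg hk, dif_neg hk, add_zero]
  map_smul' r c := by
    ext k
    by_cases hk : k ∈ Finset.Icc (-N : ℤ) N
    · rw [Pi.smul_apply, dif_pos hk, dif_pos hk, Pi.smul_apply, RingHom.id_apply]
    · rw [Pi.smul_apply, dif_neg hk, dif_neg hk, smul_zero]

lemma extendCoeff_of_mem {N : ℕ} (c : Finset.Icc (-N : ℤ) N → ℂ) {k : ℤ}
    (hk : k ∈ Finset.Icc (-N : ℤ) N) : extendCoeff N c k = c ⟨k, hk⟩ := dif_pos hk

lemma norm_extendCoeff_le {N : ℕ} (c : Finset.Icc (-N : ℤ) N → ℂ) (k : ℤ) :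
    ‖extendCoeff N c k‖ ≤ ‖c‖ := by
  by_cases hk : k ∈ Finset.Icc (-N : ℤ) N
  · rw [extendCoeff_of_mem c hk]
    exact norm_le_pi_norm c _
  · have : extendCoeff N c k = 0 := dif_neg hk
    rw [this, norm_zero]
    exact norm_nonneg _

/-- Restriction to finitely many Fourier coefficients. -/
def restrictCoeff (N : ℕ) : (ℤ → ℂ) →ₗ[ℝ] (Finset.Icc (-N : ℤ) N → ℂ) where
  toFun c k := c k
  map_add' _ _ := rfl
  map_smul' _ _ := rfl

lemma trig_congr {N : ℕ} {c d : ℤ → ℂ} (h : ∀ k ∈ Finset.Icc (-N : ℤ) N, c k = d k) :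
    (trig N c : SmoothPeriodic M) = trig N d := by
  ext x
  rw [trig_apply, trig_apply]
  exact Finset.sum_congr rfl fun k hk => by rw [h k hk]

lemma trig_extendCoeff_restrictCoeff (N : ℕ) (c : ℤ → ℂ) :
    (trig N (extendCoeff N (restrictCoeff N c)) : SmoothPeriodic M) = trig N c :=
  trig_congr fun _ hk => extendCoeff_of_mem _ hk

/-- The Galerkin vector field on Fourier coefficients. -/
def coeffField (M : ℝ) [Fact (0 < M)] (N : ℕ) (ε : ℝ) (c : Finset.Icc (-N : ℤ) N → ℂ) :
    Finset.Icc (-N : ℤ) N → ℂ :=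
  restrictCoeff N (hat (toCircle (galerkinField N ε (trig N (extendCoeff N c) : SmoothPeriodic M))))

lemma contDiff_coeffField (N : ℕ) (ε : ℝ) : ContDiff ℝ 1 (coeffField M N ε) := by
  set τ : (Finset.Icc (-N : ℤ) N → ℂ) →ₗ[ℝ] SmoothPeriodic M := trig N ∘ₗ extendCoeff N with hτ
  set r : SmoothPeriodic M →ₗ[ℝ] (Finset.Icc (-N : ℤ) N → ℂ) :=
    restrictCoeff N ∘ₗ hat ∘ₗ toCircle with hr
  set Q : (Finset.Icc (-N : ℤ) N → ℂ) →ₗ[ℝ] (Finset.Icc (-N : ℤ) N → ℂ) →ₗ[ℝ]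
      (Finset.Icc (-N : ℤ) N → ℂ) := LinearMap.mk₂ ℝ
      (fun c d => (r ∘ₗ proj N ∘ₗ (D ^ 3 + D)) (τ c * τ d))
      (fun c c' d => by rw [map_add τ, add_mul, map_add])
      (fun s c d => by rw [map_smul τ, smul_mul_assoc, map_smul])
      (fun c d d' => by rw [map_add τ, mul_add, map_add])
      (fun s c d => by rw [map_smul τ, mul_smul_comm, map_smul]) with hQ
  set l := r ∘ₗ (D ^ 4) ∘ₗ τ with hl
  have e : coeffField M N ε = fun c => Q c c - ε • l c := by
    ext1 c
    change r (proj N ((D ^ 3) (τ c * τ c) + D (τ c * τ c)) - ε • (D ^ 4) (τ c)) = _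
    rw [map_sub, map_smul]
    rfl
  have hQ' : ContDiff ℝ 1 fun c => Q c c := by
    set Q' := LinearMap.toContinuousLinearMap
      ((LinearMap.toContinuousLinearMap (𝕜 := ℝ) (E := Finset.Icc (-N : ℤ) N → ℂ)
        (F' := Finset.Icc (-N : ℤ) N → ℂ)).toLinearMap ∘ₗ Q)
    have : (fun c => Q c c) = fun c => Q' c c := rfl
    rw [this]
    exact Q'.contDiff.clm_apply contDiff_id
  have hl' : ContDiff ℝ 1 l := (LinearMap.toContinuousLinearMap l).contDiff
  rw [e]
  exact hQ'.sub (hl'.const_smul ε)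

/-- Global solvability of the regularized truncated equation with a cutoff. -/
theorem exists_cutoff_galerkin (N : ℕ) (ε : ℝ) {Λ T : ℝ} (hΛ : 0 < Λ) (hT : 0 ≤ T)
    (g : C(AddCircle M, ℝ)) : ∃ U V : ℝ → SmoothPeriodic M, U 0 = trig N (hat g) ∧
      (∀ t ∈ Icc 0 T, ∀ k, k ∉ Finset.Icc (-N : ℤ) N → hat (toCircle (U t)) k = 0) ∧
      (∀ t ∈ Icc 0 T, (∀ x, |U t x| ≤ Λ) → V t = galerkinField N ε (U t)) ∧
      (∀ t ∈ Icc 0 T, ∀ j x,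
        HasDerivWithinAt (fun r => (D ^ j) (U r) x) ((D ^ j) (V t) x) (Icc 0 T) t) ∧
      (∀ j, ∃ C, ∀ t ∈ Icc 0 T, ∀ x, |(D ^ j) (U t) x| ≤ C ∧ |(D ^ j) (V t) x| ≤ C) := by
  set χ : ContDiffBump (0 : Finset.Icc (-N : ℤ) N → ℂ) := ⟨Λ, Λ + 1, hΛ, by linarith⟩ with hχ
  set G : (Finset.Icc (-N : ℤ) N → ℂ) → (Finset.Icc (-N : ℤ) N → ℂ) :=
    fun c => χ c • coeffField M N ε c with hG
  have hG1 : ContDiff ℝ 1 G := χ.contDiff.smul (contDiff_coeffField N ε)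
  have hG2 : HasCompactSupport G := χ.hasCompactSupport.smul_right
  obtain ⟨c, hc0, hc⟩ := exists_solution_of_hasCompactSupport hG1 hG2 (restrictCoeff N (hat g)) hT
  have hlin : ∀ {F : Type} [NormedAddCommGroup F] [NormedSpace ℝ F]
      (l : (Finset.Icc (-N : ℤ) N → ℂ) →ₗ[ℝ] F), ∀ t ∈ Icc 0 T,
      HasDerivWithinAt (fun r => l (c r)) (l (G (c t))) (Icc 0 T) t := by
    intro F _ _ l t ht
    exact (LinearMap.toContinuousLinearMap l).hasFDerivAt.comp_hasDerivWithinAt t (hc t ht)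
  have hsymm : ∀ t ∈ Icc 0 T, ∀ k ∈ Finset.Icc (-N : ℤ) N,
      extendCoeff N (c t) k = conj (extendCoeff N (c t) (-k)) := by
    intro t ht k hk
    have hk' : -k ∈ Finset.Icc (-N : ℤ) N := by
      rw [Finset.mem_Icc] at *; omega
    set l : (Finset.Icc (-N : ℤ) N → ℂ) →ₗ[ℝ] ℂ :=
      { toFun := fun d => extendCoeff N d k - conj (extendCoeff N d (-k))
        map_add' := fun d d' => by simp only [map_add, Pi.add_apply]; ring
        map_smul' := fun s d => by
          simp only [map_smul, Pi.smul_apply, Complex.real_smul, map_mul, Complex.conj_ofReal,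
            RingHom.id_apply]
          ring } with hl
    have hl0 : ∀ f : C(AddCircle M, ℝ), l (restrictCoeff N (hat f)) = 0 := by
      intro f
      change extendCoeff N _ k - conj (extendCoeff N _ (-k)) = 0
      rw [extendCoeff_of_mem _ hk, extendCoeff_of_mem _ hk']
      change hat f k - conj (hat f (-k)) = 0
      rw [hat_neg_index, Complex.conj_conj, sub_self]
    have hlG : ∀ d, l (G d) = 0 := by
      intro d
      rw [hG]
      simp only
      rw [map_smul, coeffField, hl0, smul_zero]
    have hconst := (convex_Icc 0 T).norm_image_sub_le_of_norm_hasDerivWithin_le (C := 0)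
      (fun s hs => hlin l s hs) (fun s _ => by rw [hlG, norm_zero]) ⟨le_rfl, hT⟩ ht
    rw [zero_mul, hc0, hl0, sub_zero] at hconst
    exact sub_eq_zero.1 (norm_le_zero_iff.1 hconst)
  have hcont : ContinuousOn c (Icc 0 T) := fun t ht => (hc t ht).continuousWithinAt
  refine ⟨fun t => trig N (extendCoeff N (c t)), fun t => trig N (extendCoeff N (G (c t))),
    ?_, ?_, ?_, ?_, ?_⟩
  · simp only
    rw [hc0, trig_extendCoeff_restrictCoeff]
  · intro t _ k hk
    exact hat_trig_eq_zero _ hk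
  · intro t ht hb
    have hcΛ : c t ∈ Metric.closedBall (0 : Finset.Icc (-N : ℤ) N → ℂ) χ.rIn := by
      rw [mem_closedBall_zero_iff]
      refine (pi_norm_le_iff_of_nonneg hΛ.le).2 fun k => ?_
      have h1 := norm_hat_le (M := M) (f := toCircle (trig N (extendCoeff N (c t)))) (C := Λ)
        (fun x => by
          induction x using QuotientAddGroup.induction_on with | _ x => exact hb x) k
      rw [hat_trig, if_pos k.2, ← hsymm t ht k k.2, add_self_div_two,
        extendCoeff_of_mem _ k.2] at h1
      exact h1
    have h1 : χ (c t) = 1 := χ.one_of_mem_closedBall hcΛ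
    simp only [hG]
    rw [h1, one_smul, coeffField, trig_extendCoeff_restrictCoeff]
    exact proj_galerkinField fun k hk => hat_trig_eq_zero _ hk
  · intro t ht j x
    exact hlin (evalₗ x ∘ₗ (D ^ j) ∘ₗ trig N ∘ₗ extendCoeff N) t ht
  · intro j
    obtain ⟨C1, hC1⟩ := isCompact_Icc.exists_bound_of_continuousOn hcont
    obtain ⟨C2, hC2⟩ := hG2.exists_bound_of_continuous hG1.continuous
    set W := ∑ k ∈ Finset.Icc (-N : ℤ) N, ‖(Complex.I * freq M k) ^ j‖
    have hb : ∀ d : Finset.Icc (-N : ℤ) N → ℂ, ∀ x,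
        |(D ^ j) (trig N (extendCoeff N d) : SmoothPeriodic M) x| ≤ W * ‖d‖ := by
      intro d x
      rw [D_pow_trig]
      refine (abs_trig_le x).trans ?_
      rw [Finset.sum_mul]
      refine Finset.sum_le_sum fun k _ => ?_
      rw [norm_mul]
      gcongr
      exact norm_extendCoeff_le d k
    have hW : 0 ≤ W := Finset.sum_nonneg fun k _ => norm_nonneg _
    refine ⟨W * C1 + W * C2, fun t ht x => ⟨?_, ?_⟩⟩
    · refine (hb _ x).trans ?_
      have h1 := mul_le_mul_of_nonneg_left (hC1 t ht) hW
      have h2 := mul_nonneg hW ((norm_nonneg _).trans (hC2 0))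
      linarith
    · refine (hb _ x).trans ?_
      have h1 := mul_le_mul_of_nonneg_left (hC2 (c t)) hW
      have h2 := mul_nonneg hW ((norm_nonneg _).trans (hC1 t ht))
      linarith

end SmoothPeriodic

namespace SmoothPeriodic

variable {M : ℝ} [hM : Fact (0 < M)]

/-- The weighted energy of order `n`. -/
def energy (n : ℕ) (f : SmoothPeriodic M) : ℝ :=
  ∫ x in (0 : ℝ)..M, f x ^ weightExp n * (D ^ n) f x ^ 2

lemma weightExp_nonneg (n : ℕ) : 0 ≤ weightExp n := by unfold weightExp; positivity

lemma EnergyBounded.isC3Bounded {n : ℕ} (hn : 4 ≤ n) {R a : ℝ} {f : SmoothPeriodic M}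
    (h : EnergyBounded n R a f) : IsC3Bounded M (agmonConst M * R) f where
  contDiff := by exact_mod_cast contDiff_infty.1 f.contDiff 3
  periodic := f.periodic
  bound := fun j hj x => by rw [iteratedDeriv_eq]; exact h.abs_le (by omega) x

/-- The constant in the growth estimate of the weighted energy. -/
def growthConst (M : ℝ) (n : ℕ) (R a C Cv : ℝ) : ℝ :=
  weightExp n * (|a ^ (weightExp n - 1) + (agmonConst M * R) ^ (weightExp n - 1)| * Cv) * R ^ 2
    + 2 * |C|

theorem energy_growth {n : ℕ} (hn : 4 ≤ n) {R a C Cv T : ℝ} (ha : 0 < a) (hT : 0 ≤ T)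
    {U V : ℝ → SmoothPeriodic M} (hU : ∀ t ∈ Icc 0 T, EnergyBounded n R a (U t))
    (hd : ∀ t ∈ Icc 0 T, ∀ j x,
        HasDerivWithinAt (fun r => (D ^ j) (U r) x) ((D ^ j) (V t) x) (Icc 0 T) t)
    (hb : ∀ j, ∃ C, ∀ t ∈ Icc 0 T, ∀ x, |(D ^ j) (U t) x| ≤ C ∧ |(D ^ j) (V t) x| ≤ C)
    (hC : ∀ t (ht : t ∈ Icc 0 T),
      I (weight n (U t) ((hU t ht).pos ha) * (D ^ n) (U t) * (D ^ n) (V t)) ≤ C)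
    (hV : ∀ t ∈ Icc 0 T, ∀ x, |V t x| ≤ Cv) :
    (∀ t ∈ Icc 0 T, energy n (U t) ≤ energy n (U 0) + growthConst M n R a C Cv * t) ∧
    (∀ t ∈ Icc 0 T, ‖U t‖ ^ 2 ≤ ‖U 0‖ ^ 2 + 2 * (agmonConst M * R) * Cv * M * t) ∧
    (∀ t ∈ Icc 0 T, ∀ x, |U t x - U 0 x| ≤ Cv * t) := by
  have hM0 := hM.out
  have hT0 : (0 : ℝ) ∈ Icc 0 T := ⟨le_rfl, hT⟩
  have hR := (hU 0 hT0).R_nonneg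
  have hA := agmonConst_pos (M := M)
  have hCv : 0 ≤ Cv := (abs_nonneg _).trans (hV 0 hT0 0)
  set p := weightExp n with hp
  have hp0 : 0 ≤ p := weightExp_nonneg n
  set c := |a ^ (p - 1) + (agmonConst M * R) ^ (p - 1)| with hc
  have hpos : ∀ t ∈ Icc 0 T, ∀ x, 0 < U t x := fun t ht x => (hU t ht).pos ha x
  have hUb : ∀ t ∈ Icc 0 T, ∀ x, |U t x| ≤ agmonConst M * R := fun t ht x =>
    (hU t ht).abs_le (j := 0) (by omega) x
  have hd0 : ∀ t ∈ Icc 0 T, ∀ x, HasDerivWithinAt (fun r => U r x) (V t x) (Icc 0 T) t :=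
    fun t ht x => hd t ht 0 x
  have hpow : ∀ t ∈ Icc 0 T, ∀ x, |U t x ^ (p - 1)| ≤ c := fun t ht x =>
    ((hU t ht).abs_rpow_le ha (by omega) (p - 1) x).trans (le_abs_self _)
  have hpow0 : ∀ t ∈ Icc 0 T, ∀ x,
      |U t x ^ p| ≤ |a ^ p + (agmonConst M * R) ^ p| := fun t ht x =>
    ((hU t ht).abs_rpow_le ha (by omega) p x).trans (le_abs_self _)
  refine ⟨?_, ?_, ?_⟩
  · obtain ⟨Cn, hCn⟩ := hb n
    have hCn0 : 0 ≤ Cn := (abs_nonneg _).trans (hCn 0 hT0 0).1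
    have key := integral_le_exp_of_deriv_le (T := T) (K := 0) (L := growthConst M n R a C Cv)
      (F := fun t x => U t x ^ p * (D ^ n) (U t) x ^ 2)
      (F' := fun t x => p * (U t x ^ (p - 1) * V t x) * (D ^ n) (U t) x ^ 2 +
        2 * (U t x ^ p * (D ^ n) (U t) x * (D ^ n) (V t) x))
      (C := p * (c * Cv) * Cn ^ 2 + 2 * (|a ^ p + (agmonConst M * R) ^ p| * Cn * Cn)) hM0
      ?_ ?_ ?_ ?_ le_rfl (by unfold growthConst; positivity) ?_
    · intro t ht
      have := key t ht
      rwa [zero_mul, Real.exp_zero, one_mul] at this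
    · intro t ht x
      refine (((hd0 t ht x).rpow_const (p := p) (Or.inl (hpos t ht x).ne')).mul
        ((hd t ht n x).pow 2)).congr_deriv ?_
      simp only [Pi.pow_apply]
      push_cast
      ring
    · intro t ht
      exact (rpow (U t) (hpos t ht) p * (D ^ n) (U t) ^ 2).continuous.congr fun x => by simp
    · intro t ht
      exact (p • (rpow (U t) (hpos t ht) (p - 1) * V t) * (D ^ n) (U t) ^ 2 +
        (2 : ℝ) • (rpow (U t) (hpos t ht) p * (D ^ n) (U t) * (D ^ n) (V t))).continuous.congr
          fun x => by simp [mul_assoc]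
    · intro t ht x
      refine (abs_add_le _ _).trans ?_
      rw [abs_mul, abs_mul, abs_mul, abs_mul, abs_mul, abs_mul, abs_pow, abs_two, abs_of_nonneg hp0]
      have h1 := hpow t ht x
      have h2 := hpow0 t ht x
      have h3 := hV t ht x
      have h4 := hCn t ht x
      gcongr
      · exact h4.1
      · exact h4.1
      · exact h4.2
    · intro t ht
      rw [zero_mul, zero_add]
      have e : ∫ x in (0 : ℝ)..M, (p * (U t x ^ (p - 1) * V t x) * (D ^ n) (U t) x ^ 2 +
        2 * (U t x ^ p * (D ^ n) (U t) x * (D ^ n) (V t) x)) =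
          I (p • (rpow (U t) (hpos t ht) (p - 1) * V t) * ((D ^ n) (U t) * (D ^ n) (U t)) +
        (2 : ℝ) • (weight n (U t) (hpos t ht) * (D ^ n) (U t) * (D ^ n) (V t))) := by
        rw [I_apply]
        refine intervalIntegral.integral_congr fun x _ => ?_
        simp only [add_apply, mul_apply, smul_apply, rpow_apply, weight]
        ring
      rw [e, map_add, map_smul, smul_eq_mul, growthConst]
      have h1 : ∀ x, |(p • (rpow (U t) (hpos t ht) (p - 1) * V t)) x| ≤ p * (c * Cv) := by
        intro x
        rw [smul_apply, mul_apply, rpow_apply, abs_mul, abs_mul, abs_of_nonneg hp0]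
        have h1 := hpow t ht x
        have h3 := hV t ht x
        gcongr
      have h2 := (le_abs_self _).trans (abs_I_mul_sq_le h1 ((D ^ n) (U t)))
      have h3 : ‖(D ^ n) (U t)‖ ^ 2 ≤ R ^ 2 := by
        gcongr
        exact (hU t ht).norm_le n le_rfl
      have h4 : p * (c * Cv) * ‖(D ^ n) (U t)‖ ^ 2 ≤ p * (c * Cv) * R ^ 2 := by gcongr
      have h5 := (hC t ht).trans (le_abs_self C)
      linarith
  · have key := integral_le_exp_of_deriv_le (T := T) (K := 0) (L := 2 * (agmonConst M * R) * Cv * M)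
      (F := fun t x => U t x ^ 2) (F' := fun t x => 2 * U t x * V t x)
      (C := 2 * (agmonConst M * R) * Cv) hM0
      ?_ ?_ ?_ ?_ le_rfl (by positivity) ?_
    · intro t ht
      have := key t ht
      rw [zero_mul, Real.exp_zero, one_mul] at this
      rw [norm_sq_eq, norm_sq_eq, I_apply, I_apply]
      simp only [← pow_two]
      exact this
    · intro t ht x
      refine ((hd0 t ht x).pow 2).congr_deriv ?_
      push_cast
      ring
    · intro t ht
      exact (U t).continuous.pow 2
    · intro t ht
      exact (continuous_const.mul (U t).continuous).mul (V t).continuous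
    · intro t ht x
      rw [abs_mul, abs_mul, abs_two]
      have h1 := hUb t ht x
      have h2 := hV t ht x
      gcongr
    · intro t ht
      rw [zero_mul, zero_add]
      have h1 := intervalIntegral.norm_integral_le_of_norm_le_const (a := 0) (b := M)
        (f := fun x => 2 * U t x * V t x) (C := 2 * (agmonConst M * R) * Cv) (fun x _ => by
          rw [Real.norm_eq_abs, abs_mul, abs_mul, abs_two]
          have h1 := hUb t ht x
          have h2 := hV t ht x
          gcongr)
      rw [sub_zero, abs_of_pos hM0] at h1
      exact (le_abs_self _).trans h1
  · intro t ht x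
    have := (convex_Icc 0 T).norm_image_sub_le_of_norm_hasDerivWithin_le (C := Cv)
      (f := fun r => U r x) (fun r hr => hd0 r hr x) (fun r hr => hV r hr x) hT0 ht
    rwa [sub_zero, Real.norm_eq_abs, Real.norm_eq_abs, abs_of_nonneg ht.1] at this

lemma le_energy {n : ℕ} {a : ℝ} (ha : 0 < a) {f : SmoothPeriodic M} (hf : ∀ x, a ≤ f x) :
    a ^ weightExp n * ‖(D ^ n) f‖ ^ 2 ≤ energy n f := by
  have hM0 := hM.out
  have hpos : ∀ x, 0 < f x := fun x => ha.trans_le (hf x)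
  have e : energy n f = I (weight n f hpos * ((D ^ n) f * (D ^ n) f)) := by
    rw [I_apply, energy]
    refine intervalIntegral.integral_congr fun x _ => ?_
    simp only [mul_apply, weight, rpow_apply, pow_two]
  rw [e, norm_sq_eq, ← smul_eq_mul (_ ^ weightExp n), ← map_smul]
  refine I_mono fun x => ?_
  simp only [smul_apply, mul_apply, weight, rpow_apply]
  exact mul_le_mul_of_nonneg_right (Real.rpow_le_rpow ha.le (hf x) (weightExp_nonneg n))
    (mul_self_nonneg _)

lemma energy_le {n : ℕ} {B : ℝ} {f : SmoothPeriodic M} (hf : ∀ x, 0 < f x)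
    (hB : ∀ x, f x ≤ B) : energy n f ≤ B ^ weightExp n * ‖(D ^ n) f‖ ^ 2 := by
  have e : energy n f = I (weight n f hf * ((D ^ n) f * (D ^ n) f)) := by
    rw [I_apply, energy]
    refine intervalIntegral.integral_congr fun x _ => ?_
    simp only [mul_apply, weight, rpow_apply, pow_two]
  rw [e, norm_sq_eq, ← smul_eq_mul (_ ^ weightExp n), ← map_smul]
  refine I_mono fun x => ?_
  simp only [smul_apply, mul_apply, weight, rpow_apply]
  exact mul_le_mul_of_nonneg_right (Real.rpow_le_rpow (hf x).le (hB x) (weightExp_nonneg n))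
    (mul_self_nonneg _)

/-- Continuous induction for the bounds of a smooth family of functions. -/
theorem energyBounded_of_bootstrap {n : ℕ} {R a b T : ℝ} (hab : a < b)
    {U V : ℝ → SmoothPeriodic M}
    (hd : ∀ t ∈ Icc 0 T, ∀ j x,
        HasDerivWithinAt (fun r => (D ^ j) (U r) x) ((D ^ j) (V t) x) (Icc 0 T) t)
    (hb : ∀ j, ∃ C, ∀ t ∈ Icc 0 T, ∀ x, |(D ^ j) (U t) x| ≤ C ∧ |(D ^ j) (V t) x| ≤ C)
    (h0 : EnergyBounded n R a (U 0))
    (hstep : ∀ t ∈ Icc 0 T, (∀ r ∈ Icc 0 t, EnergyBounded n R a (U r)) →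
      (∀ j ≤ n, ‖(D ^ j) (U t)‖ < R) ∧ ∀ x, b ≤ U t x) :
    ∀ t ∈ Icc 0 T, EnergyBounded n R a (U t) := by
  have hM0 := hM.out
  have hlip : ∀ j, ∃ C, 0 ≤ C ∧ ∀ s ∈ Icc 0 T, ∀ r ∈ Icc 0 T, ∀ x,
      |(D ^ j) (U r) x - (D ^ j) (U s) x| ≤ C * |r - s| := by
    intro j
    obtain ⟨C, hC⟩ := hb j
    refine ⟨|C|, abs_nonneg _, fun s hs r hr x => ?_⟩
    exact (convex_Icc 0 T).norm_image_sub_le_of_norm_hasDerivWithin_le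
      (f := fun r => (D ^ j) (U r) x) (fun y hy => hd y hy j x)
      (fun y hy => ((hC y hy x).2).trans (le_abs_self _)) hs hr
  have hnc : ∀ j, ContinuousOn (fun t => ‖(D ^ j) (U t)‖) (Icc 0 T) := by
    intro j
    obtain ⟨C, hC0, hC⟩ := hlip j
    refine LipschitzOnWith.continuousOn (K := (C * √M).toNNReal) ?_
    refine LipschitzOnWith.of_dist_le_mul fun r hr s hs => ?_
    rw [Real.coe_toNNReal _ (by positivity), Real.dist_eq, Real.dist_eq]
    refine (abs_norm_sub_norm_le _ _).trans ?_
    refine (norm_le_of_abs_le (C := C * |r - s|) fun x => hC s hs r hr x).trans_eq ?_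
    ring
  have huc : ∀ x, ContinuousOn (fun t => U t x) (Icc 0 T) := fun x t ht =>
    (hd t ht 0 x).continuousWithinAt
  set s : Set ℝ := {t | EnergyBounded n R a (U t)} with hs
  have hclosed : IsClosed (s ∩ Icc 0 T) := by
    have e : s ∩ Icc 0 T = (⋂ j, ⋂ (_ : j ≤ n), {t ∈ Icc 0 T | ‖(D ^ j) (U t)‖ ≤ R}) ∩
        ⋂ x, {t ∈ Icc 0 T | a ≤ U t x} := by
      ext t
      simp only [hs, mem_inter_iff, mem_ofPred_eq, mem_iInter]
      constructor
      · rintro ⟨h, ht⟩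
        exact ⟨fun j hj => ⟨ht, h.norm_le j hj⟩, fun x => ⟨ht, h.lower x⟩⟩
      · rintro ⟨h1, h2⟩
        exact ⟨⟨fun j hj => (h1 j hj).2, fun x => (h2 x).2⟩, (h2 0).1⟩
    rw [e]
    refine IsClosed.inter (isClosed_iInter fun j => isClosed_iInter fun _ => ?_)
      (isClosed_iInter fun x => ?_)
    · exact isClosed_Icc.isClosed_le (hnc j) continuousOn_const
    · exact isClosed_Icc.isClosed_le continuousOn_const (huc x)
  refine hclosed.Icc_subset_of_forall_mem_nhdsGT_of_Icc_subset h0 fun t ht hts => ?_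
  have ht' : t ∈ Icc 0 T := Ico_subset_Icc_self ht
  obtain ⟨h1, h2⟩ := hstep t ht' fun r hr => hts hr
  have hle : 𝓝[>] t ≤ 𝓝[Icc 0 T] t := by
    rw [← nhdsWithin_Ioc_eq_nhdsGT ht.2]
    exact nhdsWithin_mono t fun r hr => ⟨ht.1.trans hr.1.le, hr.2⟩
  obtain ⟨C, hC0, hC⟩ := hlip 0
  have e1 : ∀ᶠ r in 𝓝[>] t, ∀ j ∈ Finset.range (n + 1), ‖(D ^ j) (U r)‖ < R := by
    rw [Filter.eventually_all_finset]
    intro j hj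
    exact ((hnc j t ht').mono_left hle).eventually
      (gt_mem_nhds (h1 j (by have := Finset.mem_range.1 hj; omega)))
  have e2 : ∀ᶠ r in 𝓝[>] t, C * |r - t| < b - a := by
    have : Tendsto (fun r => C * |r - t|) (𝓝[>] t) (𝓝 (C * |t - t|)) := by
      refine Tendsto.mono_left ?_ nhdsWithin_le_nhds
      exact (Continuous.tendsto (by fun_prop) t)
    rw [sub_self, abs_zero, mul_zero] at this
    exact this.eventually (gt_mem_nhds (by linarith))
  filter_upwards [e1, e2, hle self_mem_nhdsWithin] with r hr1 hr2 hr3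
  refine ⟨fun j hj => (hr1 j (Finset.mem_range.2 (by omega))).le, fun x => ?_⟩
  have h3 := hC t ht' r hr3 x
  have h4 := (abs_le.1 h3).1
  have h5 := h2 x
  rw [pow_zero, Module.End.one_apply, Module.End.one_apply] at h4
  linarith

/-- The bounds on the Galerkin approximations, uniformly in the regularization. -/
structure GalerkinBounds (n m : ℕ) (a R C T : ℝ) (g : C(AddCircle M, ℝ))
    (U V : ℝ → SmoothPeriodic M) : Prop where
  initial : U 0 = trig (m ^ 3) (hat g)
  bounded : ∀ t ∈ Icc 0 T, EnergyBounded n R (3 * a / 4) (U t)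
  hasDeriv : ∀ t ∈ Icc 0 T, ∀ x, HasDerivWithinAt (fun r => U r x) (V t x) (Icc 0 T) t
  error : ∀ t ∈ Icc 0 T, ∀ x, |V t x - field (U t) x| ≤ √(C / m)
  energy_le : ∀ t ∈ Icc 0 T, energy n (U t) ≤ energy n (U 0) + C * t
  abs_sub_le : ∀ t ∈ Icc 0 T, ∀ x, |U t x - U 0 x| ≤ C * t

theorem exists_galerkinBounds (M : ℝ) [Fact (0 < M)] {n : ℕ} (hn : 4 ≤ n) {a R₀ : ℝ} (ha : 0 < a)
    (hR₀ : 0 ≤ R₀) : ∃ T R C : ℝ, 0 < T ∧ 0 ≤ R ∧ 0 ≤ C ∧ ∃ m₁ : ℕ, ∀ m ≥ m₁,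
      ∀ g : C(AddCircle M, ℝ), sobolevSq n g ≤ ENNReal.ofReal (R₀ ^ 2) →
        (∀ x, a ≤ (trig (m ^ 3) (hat g) : SmoothPeriodic M) x) →
        ∃ U V : ℝ → SmoothPeriodic M, GalerkinBounds n m a R C T g U V := by
  have hM0 : 0 < M := Fact.out
  have hA := agmonConst_pos (M := M)
  set A := agmonConst M with hAdef
  set p := weightExp n with hp
  set b := (3 * a / 4) ^ p with hb
  have hb0 : 0 < b := by positivity
  set K := (A * R₀) ^ p * R₀ ^ 2 + R₀ ^ 2 + 1 with hK
  have hK0 : 0 < K := by positivity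
  set R := √(K / b + K) + 1 with hR
  have hR0 : 0 < R := by positivity
  have ha' : 0 < 3 * a / 4 := by positivity
  obtain ⟨κ, C1, hκ, h1⟩ := exists_I_weight_galerkinField_le M hn R ha'
  obtain ⟨C2, hC2, h2⟩ := exists_sq_galerkinField_sub_le M hn R (3 * a / 4)
  set Cv := 10 * (A * R) ^ 2 + √(2 * C2) with hCv
  have hCv0 : 0 ≤ Cv := by positivity
  set CE := growthConst M n R (3 * a / 4) C1 Cv with hCE
  have hCE0 : 0 ≤ CE := by
    have := weightExp_nonneg n
    rw [hCE]; unfold growthConst; positivity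
  set CU := 2 * (A * R) * Cv * M with hCU
  have hCU0 : 0 ≤ CU := by positivity
  set T := min (1 / (CE + CU + 1)) (a / (8 * (Cv + 1))) with hT
  have hT0 : 0 < T := by positivity
  have hT1 : (CE + CU) * T ≤ 1 := by
    have : T ≤ 1 / (CE + CU + 1) := min_le_left _ _
    rw [le_div_iff₀ (by positivity)] at this
    linarith
  have hT2 : Cv * T ≤ a / 8 := by
    have : T ≤ a / (8 * (Cv + 1)) := min_le_right _ _
    rw [le_div_iff₀ (by positivity)] at this
    linarith
  clear_value T
  clear_value CE CU
  clear_value Cv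
  clear_value R
  clear_value K b
  refine ⟨T, R, 2 * C2 + CE + CU + Cv, hT0, hR0.le, by positivity, ⌈1 / κ⌉₊ + 1,
    fun m hm g hg hpos => ?_⟩
  have hm1 : 1 ≤ m := by omega
  have hm1' : (1 : ℝ) ≤ m := by exact_mod_cast hm1
  have hm0 : (0 : ℝ) < m := by linarith
  have hmκ : 1 / κ ≤ m := (Nat.le_ceil _).trans (by exact_mod_cast (by omega : ⌈1 / κ⌉₊ ≤ m))
  set N := m ^ 3 with hN
  have hN0 : 0 < N := by positivity
  set ε : ℝ := 1 / (m : ℝ) ^ 2 with hε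
  have hε0 : 0 < ε := by positivity
  have hε1 : ε ≤ 1 := by
    rw [hε, div_le_one (by positivity)]
    exact one_le_pow₀ hm1'
  have hNε : 1 / (N : ℝ) ≤ κ * ε := by
    rw [hN, hε]
    push_cast
    rw [div_le_iff₀ hκ] at hmκ
    rw [mul_one_div, div_le_div_iff₀ (by positivity) (by positivity), one_mul]
    nlinarith [pow_pos hm0 2]
  obtain ⟨U, V, hU0, hUs, hUV, hd, hbd⟩ := exists_cutoff_galerkin N ε (Λ := A * R) (by positivity)
    hT0.le g
  have hV : ∀ t ∈ Icc 0 T, EnergyBounded n R (3 * a / 4) (U t) →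
      V t = galerkinField N ε (U t) ∧ (∀ x, |V t x - field (U t) x| ≤ √(2 * C2 / m)) ∧
      ∀ x, |V t x| ≤ Cv := by
    intro t ht h
    have e : V t = galerkinField N ε (U t) := hUV t ht fun x => h.abs_le (j := 0) (by omega) x
    have e2 : ∀ x, |V t x - field (U t) x| ≤ √(2 * C2 / m) := by
      intro x
      rw [e]
      refine Real.abs_le_sqrt ((h2 N ε hN0 (U t) h (hUs t ht) x).trans ?_)
      rw [hN, hε]
      push_cast
      have h3 : 1 / (m : ℝ) ^ 3 ≤ 1 / m := by
        apply one_div_le_one_div_of_le hm0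
        nlinarith [pow_le_pow_left₀ (by norm_num : (0 : ℝ) ≤ 1) hm1' 2]
      have h4 : (1 / (m : ℝ) ^ 2) ^ 2 * (m : ℝ) ^ 3 = 1 / m := by field_simp
      rw [h4]
      calc _ ≤ C2 * (1 / m + 1 / m) := by gcongr
        _ = _ := by ring
    refine ⟨e, e2, fun x => ?_⟩
    have h3 := (h.isC3Bounded hn).abs_k22_le x
    rw [← field_apply] at h3
    have h4 : √(2 * C2 / m) ≤ √(2 * C2) := by
      apply Real.sqrt_le_sqrt
      exact div_le_self (by positivity) hm1'
    have h5 := abs_sub_abs_le_abs_sub (V t x) (field (U t) x)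
    have h6 := e2 x
    rw [hCv]
    linarith
  have hU0n : ∀ j ≤ n, ‖(D ^ j) (U 0)‖ ≤ R₀ := fun j hj => by
    rw [hU0]
    exact norm_D_pow_le_of_sobolevSq_le hj hR₀ ((sobolevSq_trig_hat_le _ _ _).trans hg)
  have hU0a : ∀ x, a ≤ U 0 x := by rw [hU0]; exact hpos
  have hU0B : ∀ x, U 0 x ≤ A * R₀ := fun x => (le_abs_self _).trans
    (abs_le_agmon (hU0n 0 (by omega)) (hU0n 1 (by omega)) x)
  have hE0 : energy n (U 0) + ‖U 0‖ ^ 2 + 1 ≤ K := by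
    have h3 := energy_le (n := n) (fun x => ha.trans_le (hU0a x)) hU0B
    have h4 : ‖(D ^ n) (U 0)‖ ^ 2 ≤ R₀ ^ 2 := by
      have := hU0n n le_rfl
      gcongr
    have h5 : ‖U 0‖ ^ 2 ≤ R₀ ^ 2 := by
      have : ‖U 0‖ ≤ R₀ := hU0n 0 (by omega)
      gcongr
    have h6 : 0 ≤ (A * R₀) ^ p := by positivity
    have h7 := mul_le_mul_of_nonneg_left h4 h6
    linarith
  have hgrow : ∀ t ∈ Icc 0 T, (∀ r ∈ Icc 0 t, EnergyBounded n R (3 * a / 4) (U r)) →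
      (∀ r ∈ Icc 0 t, energy n (U r) ≤ energy n (U 0) + CE * r) ∧
      (∀ r ∈ Icc 0 t, ‖U r‖ ^ 2 ≤ ‖U 0‖ ^ 2 + CU * r) ∧
      (∀ r ∈ Icc 0 t, ∀ x, |U r x - U 0 x| ≤ Cv * r) := by
    intro t ht h
    have hsub : Icc 0 t ⊆ Icc 0 T := Icc_subset_Icc_right ht.2
    rw [hCE, hCU]
    refine energy_growth hn ha' ht.1 h (fun r hr j x => (hd r (hsub hr) j x).mono hsub)
      (fun j => ?_) (fun r hr => ?_) (fun r hr => (hV r (hsub hr) (h r hr)).2.2)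
    · obtain ⟨C, hC⟩ := hbd j
      exact ⟨C, fun r hr => hC r (hsub hr)⟩
    · rw [(hV r (hsub hr) (h r hr)).1]
      exact h1 N ε hN0 hε0 hε1 hNε (U r) (h r hr)
  have hEB0 : EnergyBounded n R (3 * a / 4) (U 0) := by
    refine ⟨fun j hj => ?_, fun x => by linarith [hU0a x]⟩
    refine (hU0n j hj).trans ?_
    have : R₀ ≤ √(K / b + K) := by
      apply Real.le_sqrt_of_sq_le
      have h3 : 0 ≤ K / b := by positivity
      have h4 : 0 ≤ (A * R₀) ^ p * R₀ ^ 2 := by positivity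
      linarith
    linarith
  have hEB := energyBounded_of_bootstrap (b := 7 * a / 8) (by linarith) hd hbd hEB0 (by
    intro t ht h
    obtain ⟨g1, g2, g3⟩ := hgrow t ht h
    have hmem : t ∈ Icc 0 t := ⟨ht.1, le_rfl⟩
    constructor
    · intro j hj
      have k1 := g1 t hmem
      have k2 := g2 t hmem
      have k3 := le_energy (n := n) ha' (h t hmem).lower
      rw [← hp, ← hb] at k3
      have k4 : CE * t + CU * t ≤ 1 := by
        have := mul_le_mul_of_nonneg_left ht.2 (add_nonneg hCE0 hCU0)
        linarith
      have k5 : b * ‖(D ^ n) (U t)‖ ^ 2 ≤ K := by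
        have := sq_nonneg ‖U t‖
        linarith
      have k6 : ‖(D ^ n) (U t)‖ ^ 2 ≤ K / b := by
        rw [le_div_iff₀ hb0]; linarith
      have k7 : ‖U t‖ ^ 2 ≤ K := by
        have : 0 ≤ b * ‖(D ^ n) (U t)‖ ^ 2 := by positivity
        linarith
      have k8 := norm_D_pow_sq_le hj (U t)
      have k9 : ‖(D ^ j) (U t)‖ ≤ √(K / b + K) := Real.le_sqrt_of_sq_le (by linarith)
      linarith
    · intro x
      have k1 := (abs_le.1 (g3 t hmem x)).1
      have k2 := hU0a x
      have k3 := mul_le_mul_of_nonneg_left ht.2 hCv0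
      linarith)
  obtain ⟨g1, -, g3⟩ := hgrow T ⟨hT0.le, le_rfl⟩ hEB
  refine ⟨U, V, hU0, hEB, fun t ht x => hd t ht 0 x, fun t ht x => ?_, fun t ht => ?_,
    fun t ht x => ?_⟩
  · refine ((hV t ht (hEB t ht)).2.1 x).trans (Real.sqrt_le_sqrt ?_)
    gcongr
    linarith
  · refine (g1 t ht).trans ?_
    have := ht.1
    gcongr
    linarith
  · refine (g3 t ht x).trans ?_
    have := ht.1
    gcongr
    linarith

end SmoothPeriodic

/-- A pointwise limit of functions whose derivatives converge uniformly on an interval is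
differentiable on the interval. -/
lemma hasDerivWithinAt_of_uniform_limit {T : ℝ} {U V : ℕ → ℝ → ℝ} {u v : ℝ → ℝ}
    (hd : ∀ k, ∀ t ∈ Icc 0 T, HasDerivWithinAt (U k) (V k t) (Icc 0 T) t)
    (hU : ∀ t ∈ Icc 0 T, Tendsto (fun k => U k t) atTop (𝓝 (u t)))
    (hV : ∀ ε > 0, ∃ k₀, ∀ k ≥ k₀, ∀ t ∈ Icc 0 T, |V k t - v t| ≤ ε) :
    ∀ t ∈ Icc 0 T, HasDerivWithinAt u (v t) (Icc 0 T) t := by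
  intro t ht
  rw [hasDerivWithinAt_iff_isLittleO, Asymptotics.isLittleO_iff]
  intro c hc
  obtain ⟨k, hk⟩ := hV (c / 4) (by positivity)
  have h1 : ∀ r ∈ Icc 0 T, |(U k r - u r) - (U k t - u t)| ≤ c / 2 * |r - t| := by
    intro r hr
    have h2 : ∀ m ≥ k, |(U k r - U m r) - (U k t - U m t)| ≤ c / 2 * |r - t| := by
      intro m hm
      refine (convex_Icc 0 T).norm_image_sub_le_of_norm_hasDerivWithin_le
        (f := fun r => U k r - U m r) (fun s hs => (hd k s hs).sub (hd m s hs))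
        (fun s hs => ?_) ht hr
      have e1 := hk k le_rfl s hs
      have e2 := hk m hm s hs
      rw [abs_sub_comm] at e2
      have := abs_sub_le (V k s) (v s) (V m s)
      rw [Real.norm_eq_abs]
      linarith
    refine le_of_tendsto (((tendsto_const_nhds.sub (hU r hr)).sub
      (tendsto_const_nhds.sub (hU t ht))).abs) ?_
    filter_upwards [eventually_ge_atTop k] with m hm using h2 m hm
  have h3 := hd k t ht
  rw [hasDerivWithinAt_iff_isLittleO, Asymptotics.isLittleO_iff] at h3
  filter_upwards [h3 (show 0 < c / 4 by positivity), self_mem_nhdsWithin] with r hr1 hr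
  have h4 := h1 r hr
  have h5 := hk k le_rfl t ht
  rw [Real.norm_eq_abs, Real.norm_eq_abs, smul_eq_mul] at hr1 ⊢
  have h6 : |(r - t) * (V k t - v t)| ≤ |r - t| * (c / 4) := by
    rw [abs_mul]; gcongr
  have h7 : u r - u t - (r - t) * v t = (U k r - U k t - (r - t) * V k t)
      - ((U k r - u r) - (U k t - u t)) + (r - t) * (V k t - v t) := by ring
  rw [h7]
  refine (abs_add_le _ _).trans ?_
  have := abs_sub (U k r - U k t - (r - t) * V k t) ((U k r - u r) - (U k t - u t))
  linarith

lemma IsC3Bounded.abs_k22_sub_le {M B ε : ℝ} {f g : ℝ → ℝ} (hf : IsC3Bounded M B f)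
    (hg : IsC3Bounded M B g) {x : ℝ}
    (h : ∀ j ≤ 3, |iteratedDeriv j f x - iteratedDeriv j g x| ≤ ε) :
    |k22 f x - k22 g x| ≤ 20 * B * ε := by
  have hp : ∀ i ≤ 3, ∀ j ≤ 3, |iteratedDeriv i f x * iteratedDeriv j f x
      - iteratedDeriv i g x * iteratedDeriv j g x| ≤ 2 * B * ε := by
    intro i hi j hj
    have e : iteratedDeriv i f x * iteratedDeriv j f x - iteratedDeriv i g x * iteratedDeriv j g x =
      iteratedDeriv i f x * (iteratedDeriv j f x - iteratedDeriv j g x) +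
        (iteratedDeriv i f x - iteratedDeriv i g x) * iteratedDeriv j g x := by ring
    rw [e]
    refine (abs_add_le _ _).trans ?_
    rw [abs_mul, abs_mul]
    have h1 := hf.bound i hi x
    have h2 := hg.bound j hj x
    have hB := (abs_nonneg _).trans h1
    have h3 := h i hi
    have h4 := h j hj
    have hε := (abs_nonneg _).trans h3
    calc _ ≤ B * ε + ε * B := by gcongr
      _ = _ := by ring
  have h03 := hp 0 (by omega) 3 (by omega)
  have h12 := hp 1 (by omega) 2 (by omega)
  have h01 := hp 0 (by omega) 1 (by omega)
  simp only [iteratedDeriv_zero, iteratedDeriv_one] at h03 h12 h01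
  rw [abs_le] at *
  unfold k22
  constructor <;> linarith

lemma exists_periodicLift_eq {M : ℝ} [Fact (0 < M)] (f : C(AddCircle M, ℝ)) (y : AddCircle M) :
    ∃ x : ℝ, (x : AddCircle M) = y ∧ periodicLift f x = f y := by
  induction y using QuotientAddGroup.induction_on with | _ x => exact ⟨x, rfl, rfl⟩

lemma isC3Bounded_of_sobolevSq_le {M : ℝ} [Fact (0 < M)] {n : ℕ} (hn : 4 ≤ n)
    {f : C(AddCircle M, ℝ)} {R : ℝ} (hR : 0 ≤ R) (hf : sobolevSq n f ≤ ENNReal.ofReal (R ^ 2)) :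
    IsC3Bounded M (SmoothPeriodic.agmonConst M * R) (periodicLift f) where
  contDiff := (regularity_of_sobolevSq_le hn hR hf).1
  periodic := periodic_periodicLift f
  bound := (regularity_of_sobolevSq_le hn hR hf).2.1

namespace SmoothPeriodic

variable {M : ℝ} [hM : Fact (0 < M)]

lemma exists_le_trig_hat {n : ℕ} (hn : 4 ≤ n) {g : C(AddCircle M, ℝ)} {a R₀ : ℝ} (hR₀ : 0 ≤ R₀)
    (hg : sobolevSq n g ≤ ENNReal.ofReal (R₀ ^ 2)) (hpos : ∀ x, a < g x) :
    ∃ N₀, ∀ N ≥ N₀, ∀ x, a ≤ (trig N (hat g) : SmoothPeriodic M) x := by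
  obtain ⟨y, -, hy⟩ := isCompact_univ.exists_isMinOn univ_nonempty g.continuous.continuousOn
  obtain ⟨N₀, h⟩ := (regularity_of_sobolevSq_le hn hR₀ hg).2.2 (g y - a) (sub_pos.2 (hpos y))
  refine ⟨N₀, fun N hN x => ?_⟩
  have h1 := (abs_le.1 (h N hN x)).1
  have h2 : g y ≤ periodicLift g x := hy (mem_univ (x : AddCircle M))
  linarith

variable {n m : ℕ} {a R C T : ℝ} {g : C(AddCircle M, ℝ)} {U V : ℝ → SmoothPeriodic M}

lemma GalerkinBounds.isApproxSolution (hn : 4 ≤ n) (h : GalerkinBounds n m a R C T g U V) {η : ℝ}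
    (hη : √(C / m) ≤ η) :
    IsApproxSolution M (agmonConst M * R) η T (fun t => U t) (fun t => V t) where
  bounded t ht := (h.bounded t ht).isC3Bounded hn
  continuous t _ := (V t).continuous
  hasDeriv := h.hasDeriv
  error t ht x := by
    rw [← field_apply]
    exact (h.error t ht x).trans hη

lemma diffRate_nonneg {B : ℝ} (ha : 0 < a) : 0 ≤ diffRate M B a := by
  have := hM.out
  unfold diffRate
  positivity

lemma GalerkinBounds.norm_sub_sq_le (hn : 4 ≤ n) (ha : 0 < a) {m' : ℕ} {U' V' : ℝ → SmoothPeriodic M}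
    (h : GalerkinBounds n m a R C T g U V) (h' : GalerkinBounds n m' a R C T g U' V') {η : ℝ}
    (hη : √(C / m) ≤ η) (hη' : √(C / m') ≤ η) (hη1 : η ≤ 1) {t : ℝ} (ht : t ∈ Icc 0 T) :
    3 * a / 4 * ‖U t - U' t‖ ^ 2 ≤ Real.exp (diffRate M (agmonConst M * R) (3 * a / 4) * T) *
      (agmonConst M * R * ‖U 0 - U' 0‖ ^ 2
        + diffRate M (agmonConst M * R) (3 * a / 4) * η * T) := by
  have hη0 : 0 ≤ η := (Real.sqrt_nonneg _).trans hη
  have ha' : 0 < 3 * a / 4 := by positivity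
  have h0 : (0 : ℝ) ∈ Icc 0 T := ⟨le_rfl, ht.1.trans ht.2⟩
  have hR := (h.bounded 0 h0).R_nonneg
  have hA := agmonConst_pos (M := M)
  have key := weighted_stability hM.out ha' hη0 hη1 (h.isApproxSolution hn hη)
    (h'.isApproxSolution hn hη') (fun t ht => (h.bounded t ht).lower) t ht
  have hd := diffRate_nonneg (M := M) (B := agmonConst M * R) ha'
  have e : ∀ s, ∫ x in (0 : ℝ)..M, U s x * (U s x - U' s x) ^ 2 =
      I (U s * ((U s - U' s) * (U s - U' s))) := by
    intro s
    rw [I_apply]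
    simp only [mul_apply, sub_apply, pow_two]
  rw [e, e] at key
  have k1 : 3 * a / 4 * ‖U t - U' t‖ ^ 2 ≤ I (U t * ((U t - U' t) * (U t - U' t))) := by
    rw [norm_sq_eq, ← smul_eq_mul, ← map_smul]
    refine I_mono fun x => ?_
    simp only [smul_apply, mul_apply]
    exact mul_le_mul_of_nonneg_right ((h.bounded t ht).lower x) (mul_self_nonneg _)
  have k2 : I (U 0 * ((U 0 - U' 0) * (U 0 - U' 0))) ≤ agmonConst M * R * ‖U 0 - U' 0‖ ^ 2 :=
    (le_abs_self _).trans (abs_I_mul_sq_le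
      (fun x => (h.bounded 0 h0).abs_le (j := 0) (by omega) x) _)
  have k0 : 0 ≤ I (U 0 * ((U 0 - U' 0) * (U 0 - U' 0))) := I_nonneg fun x =>
    mul_nonneg (ha'.le.trans ((h.bounded 0 h0).lower x)) (mul_self_nonneg _)
  refine k1.trans (key.trans ?_)
  have := ht.1
  have := ht.2
  gcongr

end SmoothPeriodic

section Limit

open SmoothPeriodic

variable {M : ℝ} [hM : Fact (0 < M)]

/-- The Galerkin approximations converge to a solution of the equation. -/
theorem exists_galerkin_limit {n m₀ : ℕ} (hn : 4 ≤ n) {a R R₀ C T : ℝ} (ha : 0 < a)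
    (hR₀ : 0 ≤ R₀) (hR : 0 ≤ R) (hT : 0 < T) {g : C(AddCircle M, ℝ)}
    (hg : sobolevSq n g ≤ ENNReal.ofReal (R₀ ^ 2)) {U V : ℕ → ℝ → SmoothPeriodic M}
    (h : ∀ k, GalerkinBounds n (k + m₀) a R C T g (U k) (V k)) :
    ∃ u : ℝ → C(AddCircle M, ℝ), u 0 = g ∧ SatisfiesK22 T u ∧
      ∀ ε > 0, ∃ k₀, ∀ k ≥ k₀, ∀ t ∈ Icc 0 T, ∀ y, |toCircle (U k t) y - u t y| ≤ ε := by
  have hA := agmonConst_pos (M := M)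
  have ha' : 0 < 3 * a / 4 := by positivity
  have hT0 : (0 : ℝ) ∈ Icc 0 T := ⟨le_rfl, hT.le⟩
  have hη : ∀ η > 0, ∃ k₀, ∀ k ≥ k₀, √(C / ((k + m₀ : ℕ) : ℝ)) ≤ η := by
    intro η hη
    have h1 : Tendsto (fun k : ℕ => √(C / ((k + m₀ : ℕ) : ℝ))) atTop (𝓝 √0) := by
      refine (Real.continuous_sqrt.tendsto 0).comp ?_
      exact (tendsto_const_div_atTop_nhds_zero_nat C).comp (tendsto_add_atTop_nat m₀)
    rw [Real.sqrt_zero] at h1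
    obtain ⟨k₀, hk₀⟩ := eventually_atTop.1 (h1.eventually (gt_mem_nhds hη))
    exact ⟨k₀, fun k hk => (hk₀ k hk).le⟩
  have hidx : ∀ N₀ : ℕ, ∀ k ≥ N₀ + 1, N₀ ≤ (k + m₀) ^ 3 := fun N₀ k hk =>
    (by omega : N₀ ≤ k + m₀).trans (Nat.le_self_pow (by norm_num) _)
  set W : ℕ → ℝ → SmoothPeriodic M := fun k t => U k (projIcc 0 T hT.le t) with hW
  have hWt : ∀ k, ∀ t ∈ Icc 0 T, W k t = U k t := fun k t ht => by
    simp only [hW]; rw [projIcc_of_mem hT.le ht]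
  have hCauchy : ∀ ε > 0, ∃ k₀, ∀ k ≥ k₀, ∀ k' ≥ k₀, ∀ t, ‖W k t - W k' t‖ ≤ ε := by
    intro ε hε
    set d := diffRate M (agmonConst M * R) (3 * a / 4) with hd
    have hd0 : 0 ≤ d := diffRate_nonneg ha'
    set e := Real.exp (d * T) with he
    have he0 : 0 < e := Real.exp_pos _
    set c := 3 * a / 4 * ε ^ 2 / e with hc
    have hc0 : 0 < c := by positivity
    obtain ⟨N₀, hN₀⟩ := exists_norm_D_pow_trig_sub_le (hg.trans_lt ENNReal.ofReal_lt_top)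
      (ε := √(c / (2 * (agmonConst M * R + 1)))) (by positivity)
    obtain ⟨k₀, hk₀⟩ := hη (min 1 (c / (2 * (d * T + 1)))) (by positivity)
    refine ⟨max k₀ (N₀ + 1), fun k hk k' hk' t => ?_⟩
    have hs : (projIcc 0 T hT.le t : ℝ) ∈ Icc 0 T := (projIcc 0 T hT.le t).2
    have key := (h k).norm_sub_sq_le hn ha (h k') (hk₀ k (le_of_max_le_left hk))
      (hk₀ k' (le_of_max_le_left hk')) (min_le_left _ _) hs
    rw [← hd, ← he] at key
    have h0 : ‖U k 0 - U k' 0‖ ^ 2 ≤ c / (2 * (agmonConst M * R + 1)) := by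
      rw [(h k).initial, (h k').initial, ← Real.sq_sqrt
        (show 0 ≤ c / (2 * (agmonConst M * R + 1)) by positivity)]
      have := hN₀ _ (hidx N₀ k (le_of_max_le_right hk)) _ (hidx N₀ k' (le_of_max_le_right hk')) 0
        (by omega)
      rw [pow_zero, Module.End.one_apply] at this
      gcongr
    have e1 : agmonConst M * R * ‖U k 0 - U k' 0‖ ^ 2 ≤ c / 2 := by
      calc _ ≤ (agmonConst M * R + 1) * (c / (2 * (agmonConst M * R + 1))) := by
            gcongr; linarith
        _ = c / 2 := by field_simp
    have e2 : d * min 1 (c / (2 * (d * T + 1))) * T ≤ c / 2 := by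
      calc _ ≤ d * (c / (2 * (d * T + 1))) * T := by gcongr; exact min_le_right _ _
        _ = (d * T) * (c / (2 * (d * T + 1))) := by ring
        _ ≤ (d * T + 1) * (c / (2 * (d * T + 1))) := by gcongr; linarith
        _ = c / 2 := by field_simp
    refine le_of_sq_le_sq ?_ hε.le
    have e3 : 3 * a / 4 * ‖W k t - W k' t‖ ^ 2 ≤ e * c := by
      refine key.trans ?_
      gcongr
      linarith
    have e4 : e * c = 3 * a / 4 * ε ^ 2 := by rw [hc]; field_simp
    rw [e4] at e3
    exact le_of_mul_le_mul_left e3 ha'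
  have hbd : ∀ k t, ∀ j ≤ 4, ‖(D ^ j) (W k t)‖ ≤ R := fun k t j hj =>
    ((h k).bounded _ (projIcc 0 T hT.le t).2).norm_le j (hj.trans hn)
  obtain ⟨u, hu3, hlim⟩ := exists_uniform_limit hbd hCauchy
  have hub : ∀ t, IsC3Bounded M (agmonConst M * R) (periodicLift (u t)) := by
    refine fun t => ⟨hu3 t, periodic_periodicLift _, fun j hj x => ?_⟩
    refine le_of_forall_pos_le_add fun ε hε => ?_
    obtain ⟨k₀, h1⟩ := hlim j hj ε hε
    have h2 := h1 k₀ le_rfl t x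
    have h3 := ((h k₀).bounded _ (projIcc 0 T hT.le t).2).abs_le (j := j) (by omega) x
    rw [abs_sub_comm] at h2
    have h4 := abs_sub_abs_le_abs_sub (iteratedDeriv j (periodicLift (u t)) x) ((D ^ j) (W k₀ t) x)
    have h5 : |(D ^ j) (W k₀ t) x| ≤ agmonConst M * R := h3
    linarith
  have hlim0 : ∀ ε > 0, ∃ k₀, ∀ k ≥ k₀, ∀ t x, |W k t x - periodicLift (u t) x| ≤ ε := by
    intro ε hε
    obtain ⟨k₀, h1⟩ := hlim 0 (by omega) ε hε
    refine ⟨k₀, fun k hk t x => ?_⟩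
    have := h1 k hk t x
    rwa [iteratedDeriv_zero] at this
  have htend : ∀ t x, Tendsto (fun k => W k t x) atTop (𝓝 (periodicLift (u t) x)) := by
    intro t x
    rw [Metric.tendsto_nhds]
    intro ε hε
    obtain ⟨k₀, h1⟩ := hlim0 (ε / 2) (by positivity)
    filter_upwards [eventually_ge_atTop k₀] with k hk
    exact (h1 k hk t x).trans_lt (by linarith)
  refine ⟨u, ?_, ?_, ?_⟩
  · ext y
    obtain ⟨x, rfl, -⟩ := exists_periodicLift_eq g y
    refine tendsto_nhds_unique (htend 0 x) ?_
    rw [Metric.tendsto_nhds]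
    intro ε hε
    obtain ⟨N₀, h1⟩ := (regularity_of_sobolevSq_le hn hR₀ hg).2.2 (ε / 2) (by positivity)
    filter_upwards [eventually_ge_atTop (N₀ + 1)] with k hk
    rw [hWt k 0 hT0, (h k).initial]
    exact (h1 _ (hidx N₀ k hk) x).trans_lt (by linarith)
  · intro t ht x
    refine hasDerivWithinAt_of_uniform_limit (U := fun k t => U k t x) (V := fun k t => V k t x)
      (v := fun t => k22 (periodicLift (u t)) x) (fun k t ht => (h k).hasDeriv t ht x)
      (fun t ht => ?_) (fun ε hε => ?_) t ht
    · simp_rw [← hWt _ t ht]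
      exact htend t x
    · set B := agmonConst M * R with hB
      have hB0 : 0 ≤ B := by positivity
      have hj : ∀ j : ℕ, ∃ k₀, j ≤ 3 → ∀ k ≥ k₀, ∀ t x,
          |(D ^ j) (W k t) x - iteratedDeriv j (periodicLift (u t)) x| ≤ ε / (2 * (20 * B + 1)) := by
        intro j
        by_cases hj : j ≤ 3
        · obtain ⟨k₀, h1⟩ := hlim j hj (ε / (2 * (20 * B + 1))) (by positivity)
          exact ⟨k₀, fun _ => h1⟩
        · exact ⟨0, fun h => absurd h hj⟩
      choose K hK using hj
      obtain ⟨k₁, hk₁⟩ := hη (ε / 2) (by positivity)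
      refine ⟨max k₁ ((Finset.range 4).sup K), fun k hk t ht => ?_⟩
      have h1 := (h k).error t ht x
      have h2 := hk₁ k (le_of_max_le_left hk)
      have h3 : |k22 (U k t) x - k22 (periodicLift (u t)) x| ≤
          20 * B * (ε / (2 * (20 * B + 1))) := by
        refine IsC3Bounded.abs_k22_sub_le (((h k).bounded t ht).isC3Bounded hn) (hub t)
          fun j hj => ?_
        rw [iteratedDeriv_eq, ← hWt k t ht]
        exact hK j hj k ((Finset.le_sup (f := K) (Finset.mem_range.2 (by omega))).trans
          (le_of_max_le_right hk)) t x
      have h4 : 20 * B * (ε / (2 * (20 * B + 1))) ≤ ε / 2 := by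
        calc _ ≤ (20 * B + 1) * (ε / (2 * (20 * B + 1))) := by gcongr; linarith
          _ = ε / 2 := by field_simp
      rw [field_apply] at h1
      have := abs_sub_le (V k t x) (k22 (U k t) x) (k22 (periodicLift (u t)) x)
      linarith
  · intro ε hε
    obtain ⟨k₀, h1⟩ := hlim0 ε hε
    refine ⟨k₀, fun k hk t ht y => ?_⟩
    obtain ⟨x, rfl, -⟩ := exists_periodicLift_eq (u t) y
    rw [← hWt k t ht]
    exact h1 k hk t x

end Limit

lemma abs_rpow_sub_rpow_le {c B p x y : ℝ} (hc : 0 < c) (hp : 1 ≤ p) (hx : x ∈ Icc c B)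
    (hy : y ∈ Icc c B) : |x ^ p - y ^ p| ≤ p * B ^ (p - 1) * |x - y| := by
  refine (convex_Icc c B).norm_image_sub_le_of_norm_hasDerivWithin_le (f := fun z => z ^ p)
    (f' := fun z => p * z ^ (p - 1)) (fun z hz => ?_) (fun z hz => ?_) hy hx
  · exact (Real.hasDerivAt_rpow_const (Or.inr hp)).hasDerivWithinAt
  · have hz0 := hc.le.trans hz.1
    rw [Real.norm_eq_abs, abs_of_nonneg (by positivity)]
    have := Real.rpow_le_rpow hz0 hz.2 (sub_nonneg.2 hp)
    gcongr

namespace SmoothPeriodic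

variable {M : ℝ} [hM : Fact (0 < M)]

lemma one_le_weightExp {n : ℕ} : 1 ≤ weightExp n := by
  unfold weightExp
  have : (0 : ℝ) ≤ n := n.cast_nonneg
  linarith

lemma EnergyBounded.mem_Icc {n : ℕ} {R a : ℝ} {f : SmoothPeriodic M} (h : EnergyBounded n R a f)
    (hn : 0 < n) (x : ℝ) : f x ∈ Icc a (agmonConst M * R) :=
  ⟨h.lower x, (le_abs_self _).trans (h.abs_le hn x)⟩

lemma energy_eq {n : ℕ} {f : SmoothPeriodic M} (hf : ∀ x, 0 < f x) :
    energy n f = I (weight n f hf * ((D ^ n) f * (D ^ n) f)) := by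
  rw [I_apply, energy]
  refine intervalIntegral.integral_congr fun x _ => ?_
  simp only [mul_apply, weight, rpow_apply, pow_two]

lemma abs_weight_sub_le {n : ℕ} (hn : 0 < n) {R a d : ℝ} (ha : 0 < a) {f g : SmoothPeriodic M}
    (hf : EnergyBounded n R a f) (hg : EnergyBounded n R a g) (hd : ∀ x, |f x - g x| ≤ d) (x : ℝ) :
    |(weight n f (hf.pos ha) - weight n g (hg.pos ha)) x| ≤
      weightExp n * (agmonConst M * R) ^ (weightExp n - 1) * d := by
  rw [sub_apply, weight, weight, rpow_apply, rpow_apply]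
  have hR := hf.R_nonneg
  have hA := agmonConst_pos (M := M)
  have hp := weightExp_nonneg n
  refine (abs_rpow_sub_rpow_le ha one_le_weightExp (hf.mem_Icc hn x) (hg.mem_Icc hn x)).trans ?_
  have := hd x
  gcongr

/-- The distance in the top norm of two functions with nearly the same weighted energy is controlled
by weaker norms. -/
lemma weight_mul_norm_D_pow_sub_sq_le {n : ℕ} (hn : 0 < n) {R a d e δ : ℝ} (ha : 0 < a)
    {f g : SmoothPeriodic M} (hf : EnergyBounded n R a f) (hg : EnergyBounded n R a g)
    (hd : ∀ x, |f x - g x| ≤ d) (he : energy n f ≤ energy n g + e) (h : SmoothPeriodic M)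
    (hδ : ‖weight n g (hg.pos ha) * (D ^ n) g - h‖ ≤ δ) :
    a ^ weightExp n * ‖(D ^ n) (f - g)‖ ^ 2 ≤
      e + 5 * (weightExp n * (agmonConst M * R) ^ (weightExp n - 1) * d) * R ^ 2 + 4 * R * δ
        + 2 * ‖(D ^ n) h‖ * (d * √M) := by
  have hR := hf.R_nonneg
  have hd0 : 0 ≤ d := (abs_nonneg _).trans (hd 0)
  have hδ0 : 0 ≤ δ := (norm_nonneg _).trans hδ
  set ρ := weight n f (hf.pos ha) with hρ
  set σ := weight n g (hg.pos ha) with hσ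
  set w := (D ^ n) f with hw
  set z := (D ^ n) g with hz
  set L := weightExp n * (agmonConst M * R) ^ (weightExp n - 1) * d with hL
  have hρσ : ∀ x, |(ρ - σ) x| ≤ L := abs_weight_sub_le hn ha hf hg hd
  have hL0 : 0 ≤ L := (abs_nonneg _).trans (hρσ 0)
  have hwR : ‖w‖ ≤ R := hf.norm_le n le_rfl
  have hzR : ‖z‖ ≤ R := hg.norm_le n le_rfl
  have hwz : ‖w - z‖ ≤ 2 * R := (norm_sub_le _ _).trans (by linarith)
  have k0 : a ^ weightExp n * ‖w - z‖ ^ 2 ≤ I (ρ * ((w - z) * (w - z))) := by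
    rw [norm_sq_eq, ← smul_eq_mul (_ ^ weightExp n), ← map_smul]
    refine I_mono fun x => ?_
    simp only [smul_apply, mul_apply, hρ, weight, rpow_apply]
    exact mul_le_mul_of_nonneg_right (Real.rpow_le_rpow ha.le (hf.lower x) (weightExp_nonneg n))
      (mul_self_nonneg _)
  have k1 : I (ρ * ((w - z) * (w - z))) = (energy n f - energy n g) - 2 * I ((σ * z - h) * (w - z))
      - 2 * I (h * (w - z)) - 2 * I ((ρ - σ) * z * (w - z)) - I ((ρ - σ) * (z * z)) := by
    rw [energy_eq (hf.pos ha), energy_eq (hg.pos ha), ← hρ, ← hσ, ← hw, ← hz, ← smul_eq_mul 2,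
      ← smul_eq_mul 2, ← smul_eq_mul 2]
    simp only [← map_smul, ← map_sub]
    congr 1
    ext x
    simp only [mul_apply, sub_apply, smul_apply]
    ring
  have k2 : |I ((σ * z - h) * (w - z))| ≤ δ * (2 * R) := (abs_I_mul_le _ _).trans (by gcongr)
  have k3 : |I (h * (w - z))| ≤ ‖(D ^ n) h‖ * (d * √M) := by
    rw [hw, hz, ← map_sub, I_mul_D_pow, abs_mul, abs_pow, abs_neg, abs_one, one_pow, one_mul]
    refine (abs_I_mul_le _ _).trans ?_
    gcongr
    exact norm_le_of_abs_le hd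
  have k4 : |I ((ρ - σ) * z * (w - z))| ≤ L * R * (2 * R) := by
    refine (abs_I_mul_le _ _).trans ?_
    have : ‖(ρ - σ) * z‖ ≤ L * R := (norm_mul_le_of_abs_le hρσ z).trans (by gcongr)
    gcongr
  have k5 : |I ((ρ - σ) * (z * z))| ≤ L * R ^ 2 :=
    (abs_I_mul_sq_le hρσ z).trans (by gcongr)
  rw [map_sub]
  rw [abs_le] at k2 k3 k4 k5
  linarith

lemma norm_weight_mul_sub_le {n : ℕ} (hn : 1 < n) {R a d : ℝ} (ha : 0 < a) {f g : SmoothPeriodic M}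
    (hf : EnergyBounded n R a f) (hg : EnergyBounded n R a g)
    (hd : ∀ j ≤ n, ‖(D ^ j) (f - g)‖ ≤ d) :
    ‖weight n f (hf.pos ha) * (D ^ n) f - weight n g (hg.pos ha) * (D ^ n) g‖ ≤
      (weightExp n * (agmonConst M * R) ^ (weightExp n - 1) * (agmonConst M * R) +
        (agmonConst M * R) ^ weightExp n) * d := by
  have hR := hf.R_nonneg
  have hA := agmonConst_pos (M := M)
  have hp := weightExp_nonneg n
  have hd0 : 0 ≤ d := (norm_nonneg _).trans (hd 0 (by omega))
  have h1 : ∀ x, |f x - g x| ≤ agmonConst M * d := fun x =>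
    abs_le_agmon (f := f - g) (hd 0 (by omega)) (hd 1 hn.le) x
  have h2 := abs_weight_sub_le (by omega) ha hf hg h1
  have h3 : ∀ x, |weight n g (hg.pos ha) x| ≤ (agmonConst M * R) ^ weightExp n := by
    intro x
    have hx := hg.mem_Icc (by omega) x
    have hx0 := (hg.pos ha x).le
    rw [weight, rpow_apply, abs_of_nonneg (by positivity)]
    exact Real.rpow_le_rpow hx0 hx.2 hp
  have e : weight n f (hf.pos ha) * (D ^ n) f - weight n g (hg.pos ha) * (D ^ n) g =
      (weight n f (hf.pos ha) - weight n g (hg.pos ha)) * (D ^ n) f +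
        weight n g (hg.pos ha) * (D ^ n) (f - g) := by
    rw [map_sub]; ring
  rw [e]
  refine (norm_add_le _ _).trans ?_
  have h4 := norm_mul_le_of_abs_le h2 ((D ^ n) f)
  have h5 := norm_mul_le_of_abs_le h3 ((D ^ n) (f - g))
  have h6 : weightExp n * (agmonConst M * R) ^ (weightExp n - 1) * (agmonConst M * d) * ‖(D ^ n) f‖ ≤
      weightExp n * (agmonConst M * R) ^ (weightExp n - 1) * (agmonConst M * d) * R := by
    have := hf.norm_le n le_rfl
    gcongr
  have h7 : (agmonConst M * R) ^ weightExp n * ‖(D ^ n) (f - g)‖ ≤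
      (agmonConst M * R) ^ weightExp n * d := by
    have := hd n le_rfl
    gcongr
  calc _ ≤ _ := add_le_add (h4.trans h6) (h5.trans h7)
    _ = _ := by ring

end SmoothPeriodic

lemma tendsto_zero_of_forall_le_ofReal {α : Type*} {l : Filter α} {f : α → ℝ≥0∞}
    (h : ∀ ε : ℝ, 0 < ε → ∀ᶠ x in l, f x ≤ ENNReal.ofReal ε) : Tendsto f l (𝓝 0) := by
  rw [ENNReal.tendsto_nhds_zero]
  intro ε hε
  obtain ⟨r, hr0, hr⟩ := ENNReal.lt_iff_exists_nnreal_btwn.1 hε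
  filter_upwards [h r (by exact_mod_cast hr0)] with x hx
  rw [ENNReal.ofReal_coe_nnreal] at hx
  exact hx.trans hr.le

section Limit

open SmoothPeriodic

variable {M : ℝ} [hM : Fact (0 < M)]

/-- The limit of the Galerkin approximations is continuous into `H^n` at the initial time. -/
theorem tendsto_sobolevSq_sub_galerkin_limit {n m₀ : ℕ} (hn : 4 ≤ n) {a R C T : ℝ} (ha : 0 < a)
    (hT : 0 < T) {g : C(AddCircle M, ℝ)} (hg : sobolevSq n g < ⊤)
    {U V : ℕ → ℝ → SmoothPeriodic M}
    (h : ∀ k, GalerkinBounds n (k + m₀) a R C T g (U k) (V k)) {u : ℝ → C(AddCircle M, ℝ)}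
    (hu : ∀ ε > 0, ∃ k₀, ∀ k ≥ k₀, ∀ t ∈ Icc 0 T, ∀ y, |toCircle (U k t) y - u t y| ≤ ε) :
    Tendsto (fun r => sobolevSq n (u r - u 0)) (𝓝[Icc 0 T] 0) (𝓝 0) := by
  have hM0 := hM.out
  have hA := agmonConst_pos (M := M)
  have ha' : 0 < 3 * a / 4 := by positivity
  have hT0 : (0 : ℝ) ∈ Icc 0 T := ⟨le_rfl, hT.le⟩
  have hR := ((h 0).bounded 0 hT0).R_nonneg
  have hp := weightExp_nonneg n
  refine tendsto_zero_of_forall_le_ofReal fun ε hε => ?_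
  set b := (3 * a / 4) ^ weightExp n with hb
  have hb0 : 0 < b := by positivity
  set K := weightExp n * (agmonConst M * R) ^ (weightExp n - 1) * (agmonConst M * R) +
    (agmonConst M * R) ^ weightExp n with hK
  have hK0 : 0 ≤ K := by positivity
  set d := ε * b / (2 * 2 ^ n * (4 * R * K + 1)) with hd
  have hd0 : 0 < d := by positivity
  obtain ⟨N₀, hN₀⟩ := exists_norm_D_pow_trig_sub_le hg hd0
  have hidx : ∀ k ≥ N₀, N₀ ≤ (k + m₀) ^ 3 := fun k hk =>
    (by omega : N₀ ≤ k + m₀).trans (Nat.le_self_pow (by norm_num) _)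
  have hE : ∀ k, ∀ t ∈ Icc 0 T, EnergyBounded n R (3 * a / 4) (U k t) := fun k => (h k).bounded
  set q := weight n (U N₀ 0) ((hE N₀ 0 hT0).pos ha') * (D ^ n) (U N₀ 0) with hq
  have hqk : ∀ k ≥ N₀,
      ‖weight n (U k 0) ((hE k 0 hT0).pos ha') * (D ^ n) (U k 0) - q‖ ≤ K * d := by
    intro k hk
    refine norm_weight_mul_sub_le (by omega) ha' (hE k 0 hT0) (hE N₀ 0 hT0) fun j hj => ?_
    rw [(h k).initial, (h N₀).initial]
    exact hN₀ _ (hidx k hk) _ (hidx N₀ le_rfl) j hj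
  set B : ℝ → ℝ := fun r => 2 ^ n * ((C * r * √M) ^ 2 +
    (C * r + 5 * (weightExp n * (agmonConst M * R) ^ (weightExp n - 1) * (C * r)) * R ^ 2
      + 4 * R * (K * d) + 2 * ‖(D ^ n) q‖ * (C * r * √M)) / b) with hB
  have hB0 : B 0 < ε := by
    have h1 : B 0 = 2 ^ n * (4 * R * K * d / b) := by simp only [hB]; ring
    rw [h1, hd]
    calc 2 ^ n * (4 * R * K * (ε * b / (2 * 2 ^ n * (4 * R * K + 1))) / b)
        = ε / 2 * ((4 * R * K) / (4 * R * K + 1)) := by field_simp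
      _ ≤ ε / 2 * 1 := by
        gcongr
        rw [div_le_one (by positivity)]
        linarith
      _ < ε := by linarith
  have hBt : ∀ᶠ r in 𝓝[Icc 0 T] (0 : ℝ), B r < ε :=
    (Continuous.tendsto (by fun_prop) 0).mono_left nhdsWithin_le_nhds |>.eventually
      (gt_mem_nhds hB0)
  filter_upwards [hBt, self_mem_nhdsWithin] with r hr1 hr
  refine sobolevSq_le_of_tendsto (F := fun k => toCircle (U k r - U k 0)) (fun η hη => ?_) ?_
  · obtain ⟨k₀, hk₀⟩ := hu (η / 2) (by positivity)
    filter_upwards [eventually_ge_atTop k₀] with k hk y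
    rw [map_sub, ContinuousMap.sub_apply, ContinuousMap.sub_apply]
    have h1 := hk₀ k hk r hr y
    have h2 := hk₀ k hk 0 hT0 y
    rw [abs_le] at *
    constructor <;> linarith
  · filter_upwards [eventually_ge_atTop N₀] with k hk
    refine (sobolevSq_toCircle_le n _).trans (ENNReal.ofReal_le_ofReal (le_trans ?_ hr1.le))
    have h1 := (h k).abs_sub_le r hr
    have h2 := weight_mul_norm_D_pow_sub_sq_le (by omega) ha' (hE k r hr) (hE k 0 hT0) h1
      ((h k).energy_le r hr) q (hqk k hk)
    have h3 : ‖U k r - U k 0‖ ≤ C * r * √M := norm_le_of_abs_le h1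
    have h4 : ‖(D ^ n) (U k r - U k 0)‖ ^ 2 ≤ (C * r + 5 * (weightExp n * (agmonConst M * R) ^
        (weightExp n - 1) * (C * r)) * R ^ 2 + 4 * R * (K * d)
          + 2 * ‖(D ^ n) q‖ * (C * r * √M)) / b := by
      rw [le_div_iff₀ hb0, mul_comm]
      exact h2
    simp only [hB]
    gcongr

/-- Existence of solutions of the initial value problem on a time interval that only depends on
bounds of the initial value. -/
theorem exists_k22_solution (M : ℝ) [Fact (0 < M)] {n : ℕ} (hn : 4 ≤ n) {a R₀ : ℝ} (ha : 0 < a)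
    (hR₀ : 0 ≤ R₀) : ∃ T R : ℝ, 0 < T ∧ 0 ≤ R ∧ ∀ g : C(AddCircle M, ℝ),
      sobolevSq n g ≤ ENNReal.ofReal (R₀ ^ 2) → (∀ x, a < g x) →
      ∃ u : ℝ → C(AddCircle M, ℝ), u 0 = g ∧ SatisfiesK22 T u ∧
        (∀ t ∈ Icc 0 T, sobolevSq n (u t) ≤ ENNReal.ofReal (R ^ 2)) ∧
        (∀ t ∈ Icc 0 T, ∀ x, 3 * a / 4 ≤ u t x) ∧
        Tendsto (fun r => sobolevSq n (u r - u 0)) (𝓝[Icc 0 T] 0) (𝓝 0) := by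
  obtain ⟨T, R, C, hT, hR, hC, m₁, hG⟩ := exists_galerkinBounds M hn ha hR₀
  refine ⟨T, √(2 ^ n * (R ^ 2 + R ^ 2)), hT, Real.sqrt_nonneg _, fun g hg hga => ?_⟩
  rw [Real.sq_sqrt (by positivity)]
  obtain ⟨N₀, hN₀⟩ := exists_le_trig_hat hn hR₀ hg hga
  have hex : ∀ k : ℕ, ∃ UV : (ℝ → SmoothPeriodic M) × (ℝ → SmoothPeriodic M),
      GalerkinBounds n (k + (m₁ + N₀)) a R C T g UV.1 UV.2 := by
    intro k
    obtain ⟨U, V, h⟩ := hG (k + (m₁ + N₀)) (by omega) g hg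
      (hN₀ _ ((by omega : N₀ ≤ k + (m₁ + N₀)).trans (Nat.le_self_pow (by norm_num) _)))
    exact ⟨(U, V), h⟩
  choose UV h using hex
  obtain ⟨u, hu0, hu, hlim⟩ := exists_galerkin_limit hn ha hR₀ hR hT hg h
  have hlim' : ∀ t ∈ Icc 0 T, ∀ ε > 0, ∀ᶠ k in atTop, ∀ y,
      |toCircle ((UV k).1 t) y - u t y| ≤ ε := by
    intro t ht ε hε
    obtain ⟨k₀, hk₀⟩ := hlim ε hε
    filter_upwards [eventually_ge_atTop k₀] with k hk using hk₀ k hk t ht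
  refine ⟨u, hu0, hu, fun t ht => ?_, fun t ht y => ?_,
    tendsto_sobolevSq_sub_galerkin_limit hn ha hT (hg.trans_lt ENNReal.ofReal_lt_top) h hlim⟩
  · refine sobolevSq_le_of_tendsto (hlim' t ht) (Eventually.of_forall fun k => ?_)
    refine (sobolevSq_toCircle_le n _).trans (ENNReal.ofReal_le_ofReal ?_)
    have h0 := ((h k).bounded t ht).norm_le 0 (by omega)
    rw [pow_zero, Module.End.one_apply] at h0
    have h1 := ((h k).bounded t ht).norm_le n le_rfl
    gcongr
  · refine le_of_forall_pos_le_add fun ε hε => ?_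
    obtain ⟨k, hk⟩ := (hlim' t ht ε hε).exists
    have h1 := (abs_le.1 (hk y)).2
    have h2 : 3 * a / 4 ≤ toCircle ((UV k).1 t) y := by
      obtain ⟨x, rfl, -⟩ := exists_periodicLift_eq (u t) y
      exact ((h k).bounded t ht).lower x
    linarith

end Limit

section SobolevTopology

variable {M : ℝ} [hM : Fact (0 < M)]

lemma sobolevSq_eq_sobolevNorm_sq (s : ℝ) (f : C(AddCircle M, ℝ)) :
    sobolevSq s f = sobolevNorm s f ^ (2 : ℝ) := by
  rw [sobolevNorm_eq, ← ENNReal.rpow_mul]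
  norm_num

lemma tendsto_sobolevNorm_zero_iff {α : Type*} {l : Filter α} {s : ℝ} {f : α → C(AddCircle M, ℝ)} :
    Tendsto (fun x => sobolevNorm s (f x)) l (𝓝 0) ↔
      Tendsto (fun x => sobolevSq s (f x)) l (𝓝 0) := by
  constructor
  · intro h
    simp_rw [sobolevSq_eq_sobolevNorm_sq]
    have := ((ENNReal.continuous_rpow_const (y := 2)).tendsto 0).comp h
    rwa [ENNReal.zero_rpow_of_pos (by norm_num)] at this
  · intro h
    simp_rw [sobolevNorm_eq]
    have := ((ENNReal.continuous_rpow_const (y := 1 / 2)).tendsto 0).comp h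
    rwa [ENNReal.zero_rpow_of_pos (by norm_num)] at this

lemma sobolevSq_mono {s r : ℝ} (h : s ≤ r) (f : C(AddCircle M, ℝ)) :
    sobolevSq s f ≤ sobolevSq r f := by
  have hM0 := hM.out
  refine ENNReal.tsum_le_tsum fun k => ENNReal.ofReal_le_ofReal ?_
  have := Real.rpow_le_rpow_of_exponent_le
    (le_add_of_nonneg_right (sq_nonneg (freq M k)) : (1 : ℝ) ≤ 1 + freq M k ^ 2) h
  gcongr

lemma eq_of_sobolevSq_sub_eq_zero {s : ℝ} {f g : C(AddCircle M, ℝ)} (h : sobolevSq s (f - g) = 0) :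
    f = g := by
  have hM0 := hM.out
  refine eq_of_hat_eq (funext fun k => ?_)
  have h1 := ENNReal.ofReal_eq_zero.1 (ENNReal.tsum_eq_zero.1 h k)
  have h2 : 0 < M * (1 + freq M k ^ 2) ^ s := by positivity
  have h3 : ‖hat (f - g) k‖ ^ 2 ≤ 0 := by
    by_contra! h4
    exact absurd h1 (not_le.2 (mul_pos h2 h4))
  have h4 : hat (f - g) k = 0 := by
    rw [← norm_eq_zero, ← pow_eq_zero_iff two_ne_zero]
    exact le_antisymm h3 (sq_nonneg _)
  rwa [map_sub, Pi.sub_apply, sub_eq_zero] at h4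

/-- A continuous curve in `H^s` on a compact interval is bounded. -/
lemma ContinuousIntoSobolev.exists_sobolevSq_le {s T : ℝ} {u : ℝ → C(AddCircle M, ℝ)}
    (hu : ContinuousIntoSobolev s T u) :
    ∃ R, 0 ≤ R ∧ ∀ t ∈ Icc 0 T, sobolevSq s (u t) ≤ ENNReal.ofReal (R ^ 2) := by
  obtain ⟨K, hK, h⟩ : ∃ K < (⊤ : ℝ≥0∞), ∀ t ∈ Icc 0 T, sobolevSq s (u t) ≤ K := by
    refine isCompact_Icc.induction_on (p := fun A => ∃ K < (⊤ : ℝ≥0∞), ∀ t ∈ A, sobolevSq s (u t) ≤ K)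
      ⟨0, ENNReal.zero_lt_top, fun _ h => h.elim⟩ ?_ ?_ ?_
    · rintro A B hAB ⟨K, hK, h⟩
      exact ⟨K, hK, fun t ht => h t (hAB ht)⟩
    · rintro A B ⟨K, hK, h⟩ ⟨L, hL, h'⟩
      refine ⟨max K L, max_lt hK hL, fun t ht => ?_⟩
      rcases ht with ht | ht
      · exact (h t ht).trans (le_max_left _ _)
      · exact (h' t ht).trans (le_max_right _ _)
    · intro t ht
      have h1 := (tendsto_sobolevNorm_zero_iff.1 (hu.2 t ht)).eventually
        (gt_mem_nhds (zero_lt_one : (0 : ℝ≥0∞) < 1))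
      refine ⟨_, h1, 2 * (sobolevSq s (u t) + 1), ?_, fun r hr => ?_⟩
      · have := memSobolev_iff.1 (hu.1 t ht)
        finiteness
      · refine (sobolevSq_le_of_sub s (u r) (u t)).trans ?_
        gcongr
        exact le_of_lt hr
  refine ⟨√K.toReal, Real.sqrt_nonneg _, fun t ht => ?_⟩
  rw [Real.sq_sqrt ENNReal.toReal_nonneg, ENNReal.ofReal_toReal hK.ne]
  exact h t ht

/-- The reflection `f(-x)` of a periodic function `f(x)`. -/
def reflect (f : C(AddCircle M, ℝ)) : C(AddCircle M, ℝ) := f.comp ⟨Neg.neg, continuous_neg⟩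

lemma reflect_apply (f : C(AddCircle M, ℝ)) (x : AddCircle M) : reflect f x = f (-x) := rfl

lemma reflect_sub (f g : C(AddCircle M, ℝ)) : reflect (f - g) = reflect f - reflect g := rfl

lemma hat_reflect (f : C(AddCircle M, ℝ)) (k : ℤ) : hat (reflect f) k = hat f (-k) := by
  rw [hat_apply, hat_apply, fourierCoeff, fourierCoeff, ← MeasureTheory.integral_neg_eq_self]
  refine MeasureTheory.integral_congr_ae (Eventually.of_forall fun x => ?_)
  simp only [reflect_apply, neg_neg, smul_eq_mul]
  congr 1
  simp only [fourier_apply, neg_smul, smul_neg, neg_neg]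

lemma sobolevSq_reflect (s : ℝ) (f : C(AddCircle M, ℝ)) : sobolevSq s (reflect f) = sobolevSq s f := by
  refine tsum_congr fun k => ?_
  rw [hat_reflect, hat_neg_index, RCLike.norm_conj]

end SobolevTopology

section Solutions

open SmoothPeriodic

variable {M : ℝ}

lemma SatisfiesK22.mono {T T' : ℝ} {u : ℝ → C(AddCircle M, ℝ)} (h : SatisfiesK22 T u) (hT : T' ≤ T) :
    SatisfiesK22 T' u := fun t ht x =>
  (h t ⟨ht.1, ht.2.trans hT⟩ x).mono (Icc_subset_Icc_right hT)

lemma SatisfiesK22.comp_const_add {T t₀ : ℝ} {u : ℝ → C(AddCircle M, ℝ)} (h : SatisfiesK22 T u)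
    (ht₀ : 0 ≤ t₀) : SatisfiesK22 (T - t₀) (fun r => u (t₀ + r)) := by
  intro t ht x
  have h1 := h (t₀ + t) ⟨by linarith [ht.1], by linarith [ht.2]⟩ x
  have h2 := h1.scomp t (((hasDerivAt_id t).const_add t₀).hasDerivWithinAt (s := Icc 0 (T - t₀)))
    (fun r hr => ⟨add_nonneg ht₀ hr.1, by have := hr.2; change t₀ + r ≤ T; linarith⟩)
  rwa [one_smul] at h2

lemma k22_comp_neg (f : ℝ → ℝ) (x : ℝ) : k22 (fun y => f (-y)) x = -k22 f (-x) := by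
  simp only [k22, iteratedDeriv_comp_neg, deriv_comp_neg, smul_eq_mul]
  ring

lemma SatisfiesK22.reflect {T : ℝ} {u : ℝ → C(AddCircle M, ℝ)} (h : SatisfiesK22 T u) :
    SatisfiesK22 T (fun r => reflect (u (T - r))) := by
  intro t ht x
  have h1 := h (T - t) ⟨by linarith [ht.2], by linarith [ht.1]⟩ (-x)
  have h2 := h1.scomp t (((hasDerivAt_id t).const_sub T).hasDerivWithinAt (s := Icc 0 T))
    (fun r hr => ⟨sub_nonneg.2 hr.2, sub_le_self T hr.1⟩)
  rw [neg_smul, one_smul] at h2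
  exact h2.congr_deriv (k22_comp_neg (periodicLift (u (T - t))) x).symm

variable [hM : Fact (0 < M)]

lemma SatisfiesK22.isApproxSolution {n : ℕ} (hn : 4 ≤ n) {T R : ℝ} (hR : 0 ≤ R)
    {u : ℝ → C(AddCircle M, ℝ)} (h : SatisfiesK22 T u)
    (hu : ∀ t ∈ Icc 0 T, sobolevSq n (u t) ≤ ENNReal.ofReal (R ^ 2)) :
    IsApproxSolution M (agmonConst M * R) 0 T (fun t => periodicLift (u t))
      (fun t => k22 (periodicLift (u t))) where
  bounded t ht := isC3Bounded_of_sobolevSq_le hn hR (hu t ht)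
  continuous t ht := (isC3Bounded_of_sobolevSq_le hn hR (hu t ht)).continuous_k22
  hasDeriv := h
  error t _ x := by simp

/-- Solutions depend Lipschitz continuously on their initial values in the norm of `L²`. -/
theorem SatisfiesK22.sobolevSq_zero_sub_le {n : ℕ} (hn : 4 ≤ n) {a T R : ℝ} (ha : 0 < a) (hR : 0 ≤ R)
    {u v : ℝ → C(AddCircle M, ℝ)} (hu : SatisfiesK22 T u) (hv : SatisfiesK22 T v)
    (huR : ∀ t ∈ Icc 0 T, sobolevSq n (u t) ≤ ENNReal.ofReal (R ^ 2))
    (hvR : ∀ t ∈ Icc 0 T, sobolevSq n (v t) ≤ ENNReal.ofReal (R ^ 2))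
    (hua : ∀ t ∈ Icc 0 T, ∀ x, a ≤ u t x) {t : ℝ} (ht : t ∈ Icc 0 T) :
    sobolevSq 0 (u t - v t) ≤
      ENNReal.ofReal (Real.exp (diffRate M (agmonConst M * R) a * T) * (agmonConst M * R) / a) *
        sobolevSq 0 (u 0 - v 0) := by
  have hM0 := hM.out
  have hA := agmonConst_pos (M := M)
  have hd := diffRate_nonneg (M := M) (B := agmonConst M * R) ha
  have h0 : (0 : ℝ) ∈ Icc 0 T := ⟨le_rfl, ht.1.trans ht.2⟩
  have key := weighted_stability hM0 ha le_rfl zero_le_one (hu.isApproxSolution hn hR huR)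
    (hv.isApproxSolution hn hR hvR) (fun s hs x => hua s hs x) t ht
  rw [mul_zero, zero_mul, add_zero] at key
  have hc : ∀ s, Continuous (periodicLift (u s)) := fun s => continuous_periodicLift _
  have hc' : ∀ s, Continuous (periodicLift (v s)) := fun s => continuous_periodicLift _
  have k1 : a * ∫ x in (0 : ℝ)..M, periodicLift (u t - v t) x ^ 2 ≤
      ∫ x in (0 : ℝ)..M, periodicLift (u t) x * (periodicLift (u t) x - periodicLift (v t) x) ^ 2 := by
    rw [← intervalIntegral.integral_const_mul]
    refine intervalIntegral.integral_mono hM0.le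
      (((continuous_periodicLift _).pow 2).const_mul a |>.intervalIntegrable _ _)
      (((hc t).mul (((hc t).sub (hc' t)).pow 2)).intervalIntegrable _ _) fun x => ?_
    exact mul_le_mul_of_nonneg_right (hua t ht x) (sq_nonneg _)
  have k2 : ∫ x in (0 : ℝ)..M, periodicLift (u 0) x * (periodicLift (u 0) x - periodicLift (v 0) x) ^ 2
      ≤ agmonConst M * R * ∫ x in (0 : ℝ)..M, periodicLift (u 0 - v 0) x ^ 2 := by
    rw [← intervalIntegral.integral_const_mul]
    refine intervalIntegral.integral_mono hM0.le
      (((hc 0).mul (((hc 0).sub (hc' 0)).pow 2)).intervalIntegrable _ _)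
      (((continuous_periodicLift _).pow 2).const_mul _ |>.intervalIntegrable _ _) fun x => ?_
    have := (isC3Bounded_of_sobolevSq_le hn hR (huR 0 h0)).bound 0 (by omega) x
    rw [iteratedDeriv_zero] at this
    exact mul_le_mul_of_nonneg_right ((le_abs_self _).trans this) (sq_nonneg _)
  have k3 : 0 ≤ ∫ x in (0 : ℝ)..M, periodicLift (u 0 - v 0) x ^ 2 :=
    intervalIntegral.integral_nonneg hM0.le fun x _ => sq_nonneg _
  rw [sobolevSq_zero_index, sobolevSq_zero_index, ← ENNReal.ofReal_mul (by positivity)]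
  refine ENNReal.ofReal_le_ofReal ?_
  rw [div_mul_eq_mul_div, le_div_iff₀ ha, mul_comm]
  refine k1.trans (key.trans ?_)
  have := ht.2
  calc _ ≤ Real.exp (diffRate M (agmonConst M * R) a * T) *
        (agmonConst M * R * ∫ x in (0 : ℝ)..M, periodicLift (u 0 - v 0) x ^ 2) := by
        have hpos : 0 ≤ agmonConst M * R * ∫ x in (0 : ℝ)..M, periodicLift (u 0 - v 0) x ^ 2 := by
          positivity
        exact mul_le_mul (Real.exp_le_exp.2 (by gcongr)) k2
          (intervalIntegral.integral_nonneg hM0.le fun x _ => mul_nonneg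
            (ha.le.trans (hua 0 h0 x)) (sq_nonneg _)) (Real.exp_pos _).le
    _ = _ := by ring

theorem SatisfiesK22.eq_of_initial_eq {n : ℕ} (hn : 4 ≤ n) {a T R R' : ℝ} (ha : 0 < a) (hR : 0 ≤ R)
    (hR' : 0 ≤ R') {u v : ℝ → C(AddCircle M, ℝ)} (hu : SatisfiesK22 T u) (hv : SatisfiesK22 T v)
    (huR : ∀ t ∈ Icc 0 T, sobolevSq n (u t) ≤ ENNReal.ofReal (R ^ 2))
    (hvR : ∀ t ∈ Icc 0 T, sobolevSq n (v t) ≤ ENNReal.ofReal (R' ^ 2))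
    (hua : ∀ t ∈ Icc 0 T, ∀ x, a ≤ u t x) (h0 : u 0 = v 0) {t : ℝ} (ht : t ∈ Icc 0 T) :
    u t = v t := by
  have h := hu.sobolevSq_zero_sub_le hn ha (R := max R R') (hR.trans (le_max_left _ _)) hv
    (fun t ht => (huR t ht).trans (ENNReal.ofReal_le_ofReal
      (pow_le_pow_left₀ hR (le_max_left _ _) 2)))
    (fun t ht => (hvR t ht).trans (ENNReal.ofReal_le_ofReal
      (pow_le_pow_left₀ hR' (le_max_right _ _) 2))) hua ht
  have e : sobolevSq 0 (u 0 - v 0) = 0 := by rw [h0, sub_self]; simp [sobolevSq]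
  rw [e, mul_zero] at h
  exact eq_of_sobolevSq_sub_eq_zero (le_antisymm h bot_le)

/-- Bounded solutions are continuous into `H^n` at the initial time. -/
lemma SatisfiesK22.tendsto_sobolevSq_sub_initial {n : ℕ} (hn : 4 ≤ n) {a T R : ℝ} (ha : 0 < a)
    (hR : 0 ≤ R) (hT : 0 ≤ T) {u : ℝ → C(AddCircle M, ℝ)} (hu : SatisfiesK22 T u)
    (huR : ∀ t ∈ Icc 0 T, sobolevSq n (u t) ≤ ENNReal.ofReal (R ^ 2))
    (hua : ∀ t ∈ Icc 0 T, ∀ x, a < u t x) :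
    Tendsto (fun r => sobolevSq n (u r - u 0)) (𝓝[Icc 0 T] 0) (𝓝 0) := by
  have h0 : (0 : ℝ) ∈ Icc 0 T := ⟨le_rfl, hT⟩
  obtain ⟨T', R', hT', hR', hex⟩ := exists_k22_solution M hn ha hR
  obtain ⟨w, hw0, hw, hwR, -, hwt⟩ := hex (u 0) (huR 0 h0) (hua 0 h0)
  have hlt : ∀ᶠ r in 𝓝[Icc 0 T] (0 : ℝ), r < T' :=
    nhdsWithin_le_nhds (gt_mem_nhds hT')
  have hle : 𝓝[Icc 0 T] (0 : ℝ) ≤ 𝓝[Icc 0 T'] 0 := by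
    refine nhdsWithin_le_iff.2 ?_
    filter_upwards [hlt, self_mem_nhdsWithin] with r hr1 hr2 using ⟨hr2.1, hr1.le⟩
  refine (hwt.mono_left hle).congr' ?_
  filter_upwards [hlt, self_mem_nhdsWithin] with r hr1 hr2
  have hS : Icc 0 (min T T') ⊆ Icc 0 T := Icc_subset_Icc_right (min_le_left _ _)
  have hS' : Icc 0 (min T T') ⊆ Icc 0 T' := Icc_subset_Icc_right (min_le_right _ _)
  rw [hw0, (hu.mono (min_le_left T T')).eq_of_initial_eq hn ha hR hR' (hw.mono (min_le_right T T'))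
    (fun t ht => huR t (hS ht)) (fun t ht => hwR t (hS' ht)) (fun t ht x => (hua t (hS ht) x).le)
    hw0.symm ⟨hr2.1, le_min hr2.2 hr1.le⟩]

/-- Bounded solutions are continuous curves in `H^n`. -/
theorem SatisfiesK22.continuousIntoSobolev {n : ℕ} (hn : 4 ≤ n) {a T R : ℝ} (ha : 0 < a)
    (hR : 0 ≤ R) {u : ℝ → C(AddCircle M, ℝ)} (hu : SatisfiesK22 T u)
    (huR : ∀ t ∈ Icc 0 T, sobolevSq n (u t) ≤ ENNReal.ofReal (R ^ 2))
    (hua : ∀ t ∈ Icc 0 T, ∀ x, a < u t x) : ContinuousIntoSobolev n T u := by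
  refine ⟨fun t ht => memSobolev_iff.2 ((huR t ht).trans_lt ENNReal.ofReal_lt_top), fun t ht => ?_⟩
  rw [tendsto_sobolevNorm_zero_iff, ← Icc_union_Icc_eq_Icc ht.1 ht.2, nhdsWithin_union, tendsto_sup]
  constructor
  · have hsub : ∀ r ∈ Icc 0 t, t - r ∈ Icc 0 T := fun r hr =>
      ⟨by linarith [hr.2], by linarith [hr.1, ht.2]⟩
    have h1 := (hu.mono ht.2).reflect.tendsto_sobolevSq_sub_initial hn ha hR ht.1
      (fun r hr => (sobolevSq_reflect _ _).trans_le (huR _ (hsub r hr)))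
      (fun r hr x => hua _ (hsub r hr) (-x))
    simp_rw [← reflect_sub, sobolevSq_reflect, sub_zero] at h1
    have h2 : Tendsto (fun r => t - r) (𝓝[Icc 0 t] t) (𝓝[Icc 0 t] 0) := by
      refine tendsto_nhdsWithin_iff.2 ⟨?_, ?_⟩
      · refine Tendsto.mono_left ?_ nhdsWithin_le_nhds
        have : Tendsto (fun r => t - r) (𝓝 t) (𝓝 (t - t)) := Continuous.tendsto (by fun_prop) t
        rwa [sub_self] at this
      · filter_upwards [self_mem_nhdsWithin] with r hr
        exact ⟨by linarith [hr.2], by linarith [hr.1]⟩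
    simpa only [Function.comp_def, sub_sub_cancel] using h1.comp h2
  · have hsub : ∀ r ∈ Icc 0 (T - t), t + r ∈ Icc 0 T := fun r hr =>
      ⟨by linarith [hr.1, ht.1], by linarith [hr.2]⟩
    have h1 := (hu.comp_const_add ht.1).tendsto_sobolevSq_sub_initial hn ha hR (by linarith [ht.2])
      (fun r hr => huR _ (hsub r hr)) (fun r hr x => hua _ (hsub r hr) x)
    simp_rw [add_zero] at h1
    have h2 : Tendsto (fun r => r - t) (𝓝[Icc t T] t) (𝓝[Icc 0 (T - t)] 0) := by
      refine tendsto_nhdsWithin_iff.2 ⟨?_, ?_⟩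
      · refine Tendsto.mono_left ?_ nhdsWithin_le_nhds
        have : Tendsto (fun r => r - t) (𝓝 t) (𝓝 (t - t)) := Continuous.tendsto (by fun_prop) t
        rwa [sub_self] at this
      · filter_upwards [self_mem_nhdsWithin] with r hr
        exact ⟨by linarith [hr.1], by linarith [hr.2]⟩
    simpa only [Function.comp_def, add_sub_cancel] using h1.comp h2

/-- Bounded positive solutions are unique. -/
theorem SatisfiesK22.isUniqueK22Solution {n : ℕ} (hn : 4 ≤ n) {a T R : ℝ} (ha : 0 < a)
    (hR : 0 ≤ R) {u : ℝ → C(AddCircle M, ℝ)} (hu : SatisfiesK22 T u)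
    (huR : ∀ t ∈ Icc 0 T, sobolevSq n (u t) ≤ ENNReal.ofReal (R ^ 2))
    (hua : ∀ t ∈ Icc 0 T, ∀ x, a < u t x) : IsUniqueK22Solution n T (u 0) u := by
  refine ⟨⟨hu.continuousIntoSobolev hn ha hR huR hua, hu, rfl⟩, fun v hv t ht => ?_⟩
  obtain ⟨R', hR', hvR⟩ := hv.1.exists_sobolevSq_le
  exact (hu.eq_of_initial_eq hn ha hR hR' hv.2.1 huR hvR (fun t ht x => (hua t ht x).le)
    hv.2.2.symm ht).symm

/-- Continuous dependence on the initial value in weaker norms. -/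
theorem exists_sobolevNorm_sub_le {n : ℕ} (hn : 4 ≤ n) {a T R s : ℝ} (ha : 0 < a)
    (hR : 0 ≤ R) (hs0 : 0 ≤ s) (hsn : s < n) {ε : ℝ} (hε : 0 < ε) :
    ∃ δ, 0 < δ ∧ δ ≤ 1 ∧ ∀ u v : ℝ → C(AddCircle M, ℝ), SatisfiesK22 T u → SatisfiesK22 T v →
      (∀ t ∈ Icc 0 T, sobolevSq n (u t) ≤ ENNReal.ofReal (R ^ 2)) →
      (∀ t ∈ Icc 0 T, sobolevSq n (v t) ≤ ENNReal.ofReal (R ^ 2)) →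
      (∀ t ∈ Icc 0 T, ∀ x, a ≤ u t x) → sobolevSq n (u 0 - v 0) ≤ ENNReal.ofReal (δ ^ 2) →
      ∀ t ∈ Icc 0 T, sobolevNorm s (u t - v t) ≤ ENNReal.ofReal ε := by
  have hA := agmonConst_pos (M := M)
  set K := Real.exp (diffRate M (agmonConst M * R) a * T) * (agmonConst M * R) / a with hK
  have hK0 : 0 ≤ K := by positivity
  obtain ⟨Λ, hΛ, hΛ0⟩ : ∃ Λ : ℝ, Λ ^ (s - n) * (4 * R ^ 2) ≤ ε ^ 2 / 2 ∧ 0 < Λ := by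
    have h1 := (tendsto_rpow_neg_atTop (sub_pos.2 hsn)).mul_const (4 * R ^ 2)
    rw [zero_mul] at h1
    obtain ⟨Λ, h2, h3⟩ := ((h1.eventually (gt_mem_nhds (show 0 < ε ^ 2 / 2 by positivity))).and
      (eventually_gt_atTop 0)).exists
    rw [neg_sub] at h2
    exact ⟨Λ, h2.le, h3⟩
  set c := Λ ^ s * K with hc
  have hc0 : 0 ≤ c := by positivity
  set δ := min 1 √(ε ^ 2 / (2 * (c + 1))) with hδ
  have hδ0 : 0 < δ := by positivity
  have hδc : c * δ ^ 2 ≤ ε ^ 2 / 2 := by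
    have h1 : δ ^ 2 ≤ ε ^ 2 / (2 * (c + 1)) := by
      rw [← Real.sq_sqrt (show 0 ≤ ε ^ 2 / (2 * (c + 1)) by positivity)]
      exact pow_le_pow_left₀ hδ0.le (min_le_right _ _) 2
    calc _ ≤ (c + 1) * (ε ^ 2 / (2 * (c + 1))) := by gcongr; linarith
      _ = ε ^ 2 / 2 := by field_simp
  refine ⟨δ, hδ0, min_le_left _ _, fun u v hu hv huR hvR hua huv t ht => ?_⟩
  rw [sobolevNorm_le_iff hε.le]
  have h1 := sobolevSq_le_interp hs0 hsn.le hΛ0 (u t - v t)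
  have h2 : sobolevSq 0 (u t - v t) ≤ ENNReal.ofReal (K * δ ^ 2) := by
    rw [ENNReal.ofReal_mul hK0]
    refine (hu.sobolevSq_zero_sub_le hn ha hR hv huR hvR hua ht).trans ?_
    gcongr
    exact (sobolevSq_mono n.cast_nonneg _).trans huv
  have h3 : sobolevSq n (u t - v t) ≤ ENNReal.ofReal (4 * R ^ 2) := by
    refine (sobolevSq_sub_le n (u t) (v t)).trans ?_
    calc _ ≤ 2 * (ENNReal.ofReal (R ^ 2) + ENNReal.ofReal (R ^ 2)) := by
          gcongr
          · exact huR t ht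
          · exact hvR t ht
      _ = ENNReal.ofReal (4 * R ^ 2) := by
        rw [← ENNReal.ofReal_add (by positivity) (by positivity),
          show (2 : ℝ≥0∞) = ENNReal.ofReal 2 by simp, ← ENNReal.ofReal_mul (by norm_num)]
        congr 1; ring
  refine h1.trans ?_
  calc _ ≤ ENNReal.ofReal (Λ ^ s) * ENNReal.ofReal (K * δ ^ 2) +
        ENNReal.ofReal (Λ ^ (s - n)) * ENNReal.ofReal (4 * R ^ 2) := by gcongr
    _ = ENNReal.ofReal (c * δ ^ 2 + Λ ^ (s - n) * (4 * R ^ 2)) := by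
      rw [← ENNReal.ofReal_mul (by positivity), ← ENNReal.ofReal_mul (by positivity),
        ← ENNReal.ofReal_add (by positivity) (by positivity), hc, mul_assoc]
    _ ≤ ENNReal.ofReal (ε ^ 2) := ENNReal.ofReal_le_ofReal (by linarith)

end Solutions

end

theorem corollary3 (M : ℝ) [Fact (0 < M)] (n : ℕ) (hn : 4 ≤ n) (a₀ : ℝ) (ha₀ : 0 < a₀)
    (u₀ : C(AddCircle M, ℝ)) (hu₀ : MemSobolev (n : ℝ) u₀) (hu₀_pos : ∀ x, a₀ < u₀ x) :
    ∃ T : ℝ, 0 < T ∧ ∃ u : ℝ → C(AddCircle M, ℝ),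
      IsUniqueK22Solution (n : ℝ) T u₀ u ∧
      (∀ t ∈ Set.Icc 0 T, ∀ x, a₀ / 2 < u t x) ∧
      ∀ n' : ℝ, 0 ≤ n' → n' < n → ∀ ε : ℝ, 0 < ε →
        ∃ δ : ℝ, 0 < δ ∧ ∀ v₀ : C(AddCircle M, ℝ), MemSobolev (n : ℝ) v₀ → (∀ x, a₀ < v₀ x) →
          sobolevNorm (n : ℝ) (v₀ - u₀) ≤ ENNReal.ofReal δ →
          ∃ v : ℝ → C(AddCircle M, ℝ),
            IsUniqueK22Solution (n : ℝ) T v₀ v ∧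
            (⨆ t ∈ Set.Icc 0 T, sobolevNorm n' (u t - v t)) < ENNReal.ofReal ε := by
  have hS := memSobolev_iff.1 hu₀
  set r := (sobolevSq n u₀).toReal with hr
  have hr0 : 0 ≤ r := ENNReal.toReal_nonneg
  have hSr : sobolevSq n u₀ = ENNReal.ofReal r := (ENNReal.ofReal_toReal hS.ne).symm
  obtain ⟨T, R, hT, hR, hex⟩ := exists_k22_solution M hn ha₀ (Real.sqrt_nonneg (2 * (r + 1)))
  rw [Real.sq_sqrt (by positivity)] at hex
  have hlow : ∀ y : ℝ, 3 * a₀ / 4 ≤ y → a₀ / 2 < y := fun y hy => by linarith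
  obtain ⟨u, rfl, hu, huR, hua, -⟩ := hex u₀
    (hSr.trans_le (ENNReal.ofReal_le_ofReal (by linarith))) hu₀_pos
  refine ⟨T, hT, u, hu.isUniqueK22Solution hn (half_pos ha₀) hR huR
    fun t ht x => hlow _ (hua t ht x), fun t ht x => hlow _ (hua t ht x), fun n' hn0 hn' ε hε => ?_⟩
  obtain ⟨δ, hδ, hδ1, hstab⟩ := exists_sobolevNorm_sub_le (M := M) hn (T := T) (half_pos ha₀) hR hn0
    hn' (half_pos hε)
  refine ⟨δ, hδ, fun v₀ _ hv₀_pos hv₀ => ?_⟩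
  rw [sobolevNorm_le_iff hδ.le] at hv₀
  have hv₀S : sobolevSq n v₀ ≤ ENNReal.ofReal (2 * (r + 1)) := by
    refine (sobolevSq_le_of_sub n v₀ (u 0)).trans ?_
    calc _ ≤ 2 * (ENNReal.ofReal r + ENNReal.ofReal 1) := by
          gcongr
          · exact hSr.le
          · exact hv₀.trans (ENNReal.ofReal_le_ofReal (pow_le_one₀ hδ.le hδ1))
      _ = _ := by
        rw [← ENNReal.ofReal_add hr0 zero_le_one, show (2 : ℝ≥0∞) = ENNReal.ofReal 2 by simp,
          ← ENNReal.ofReal_mul (by norm_num)]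
  obtain ⟨v, rfl, hv, hvR, hva, -⟩ := hex v₀ hv₀S hv₀_pos
  refine ⟨v, hv.isUniqueK22Solution hn (half_pos ha₀) hR hvR fun t ht x => hlow _ (hva t ht x), ?_⟩
  refine lt_of_le_of_lt (iSup₂_le fun t ht => ?_)
    ((ENNReal.ofReal_lt_ofReal_iff hε).2 (half_lt_self hε))
  refine hstab u v hu hv huR hvR (fun t ht x => (hlow _ (hua t ht x)).le) ?_ t ht
  rwa [sobolevSq_sub_comm]
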